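/- **Definitions.** A polyomino is a finite nonempty set $P\subset\mathbb Z^2$ of cells (tiles) whose induced grid graph is connected; holes are allowed. It is monotone if every vertical line, or every horizontal line, meets it in a connected set. A tile $t\in P$ is locally reflex if some $2\times2$ square meets $P$ in exactly $t$ and the two neighbours of $t$ in that square; $r(P)$ is the number of locally reflex tiles. Tiles are red or blue; the tiles of a polyomino are coloured alternately, and two tiles stick together whenever they are adjacent and their colours differ. A valid straight 2-cut splits a polyomino into two disjoint polyominoes $A,B$ such that, for one of the four directions $d$, the cut meets the polyomino only in segments perpendicular to $d$ with $B$ on the side of $d$ (if $a\in A$, $b\in B$ are adjacent, then $b=a+d$), and $A$ and $B$ can be pulled apart along $d$ without blocking each other: for every $k\ge1$, when $A$ is translated by $-kd$, no tile of $A$ coincides with a tile of $B$ or is adjacent to a tile of $B$ of the other colour. A polyomino is straight 2-cuttable if it can be subdivided into monotone polyominoes by finitely many (possibly no) valid straight 2-cuts, each applied to one of the current pieces. A workspace is the grid $\mathbb Z^2$ with finitely many cells occupied by fixed obstacles and finitely many others by single tiles, initially no two of them sticking together. In a unit step (movement step) in one of the four directions, all assemblies (maximal sets of tiles sticking together) move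 simultaneously at unit speed in that direction, sticking to whatever tiles of the other colour they become adjacent to, until every assembly is blocked, directly or through other blocked assemblies, by an obstacle. $D$ copies of $P$ can be built within $n$ unit steps if there are a workspace and a sequence of at most $n$ unit steps after which the workspace contains $D$ distinct assemblies each of which is a translate of $P$, with alternating colours. **Theorem.** There is an absolute constant $C$ such that every straight 2-cuttable polyomino $P$ can be built within $C\,(r(P)+1)$ unit steps, and, for every $D\ge 0$, $D$ copies of $P$ can be built within $C\,(r(P)+D)$ unit steps. -/

import Mathlib

namespace TiltAssembly

/-- Cells of the planar grid (first coordinate: column, second coordinate: row). -/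
abbrev Cell : Type := ℤ × ℤ

/-! ### Polyominoes -/

/-- The grid graph on `ℤ²`: two cells are adjacent if they are at unit distance. -/
def gridGraph : SimpleGraph Cell where
  Adj p q := |p.1 - q.1| + |p.2 - q.2| = 1
  symm := ⟨fun p q h => by
    rw [abs_sub_comm q.1, abs_sub_comm q.2]; exact h⟩
  loopless := ⟨fun p h => by simp at h⟩

/-- A polyomino is a finite nonempty set of cells whose induced grid graph is connected. -/
def IsPolyomino (P : Finset Cell) : Prop :=
  (gridGraph.induce (P : Set Cell)).Connected

/-- `x`-monotone (column convex): every vertical line meets `P` in a connected set. -/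
def IsXMonotone (P : Finset Cell) : Prop :=
  ∀ x y₁ y₂ y : ℤ, (x, y₁) ∈ P → (x, y₂) ∈ P → y₁ ≤ y → y ≤ y₂ → (x, y) ∈ P

/-- `y`-monotone (row convex): every horizontal line meets `P` in a connected set. -/
def IsYMonotone (P : Finset Cell) : Prop :=
  ∀ y x₁ x₂ x : ℤ, (x₁, y) ∈ P → (x₂, y) ∈ P → x₁ ≤ x → x ≤ x₂ → (x, y) ∈ P

/-- A polyomino is monotone if it is `x`-monotone or `y`-monotone. -/
def IsMonotone (P : Finset Cell) : Prop :=
  IsXMonotone P ∨ IsYMonotone P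

/-- A tile `t` of `P` is locally reflex if some `2 × 2` square meets `P` exactly in `t` and the two
neighbours of `t` in that square. -/
def IsLocallyReflex (P : Finset Cell) (t : Cell) : Prop :=
  t ∈ P ∧ ∃ sx ∈ ({1, -1} : Finset ℤ), ∃ sy ∈ ({1, -1} : Finset ℤ),
    (t.1 + sx, t.2) ∈ P ∧ (t.1, t.2 + sy) ∈ P ∧ (t.1 + sx, t.2 + sy) ∉ P

instance (P : Finset Cell) : DecidablePred (IsLocallyReflex P) := fun t => by
  unfold IsLocallyReflex; infer_instance

/-- The number of locally reflex tiles. -/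
def reflexCount (P : Finset Cell) : ℕ :=
  (P.filter (IsLocallyReflex P)).card

/-! ### Directions and colours -/

/-- The four directions of movement. -/
inductive Dir : Type
  | up
  | right
  | down
  | left

/-- The unit vector of a direction. -/
def Dir.vec : Dir → Cell
  | .up => (0, 1)
  | .right => (1, 0)
  | .down => (0, -1)
  | .left => (-1, 0)

/-- The two kinds of tiles. -/
inductive Colour : Type
  | red
  | blue

/-- The alternating colouring of the tiles of a polyomino, under which all pairs of neighbouring
tiles differ in colour, and hence stick together. -/
def tileColour (p : Cell) : Colour :=
  if Even (p.1 + p.2) then Colour.red else Colour.blue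

/-! ### Valid straight 2-cuts -/

/-- `A` and `B` are the two polyominoes into which a 2-cut splits the polyomino `P`. -/
structure IsTwoCut (P A B : Finset Cell) : Prop where
  polyomino : IsPolyomino P
  union : A ∪ B = P
  disjoint : Disjoint A B
  left : IsPolyomino A
  right : IsPolyomino B

/-- The cut between `A` and `B` meets the polyomino only in straight segments perpendicular to `d`,
with `B` lying on the side of `d`: any two neighbouring tiles separated by the cut are neighbours in
direction `d`. For `d` left or right this is a vertical cut, for `d` up or down a horizontal cut. -/
def IsStraightCut (d : Dir) (A B : Finset Cell) : Prop :=
  ∀ a ∈ A, ∀ b ∈ B, gridGraph.Adj a b → b = a + d.vec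

/-- The tiles `a` and `b` do not obstruct each other once `a` has moved to the cell `a'`: the cells
are distinct, and the tiles do not stick together, i.e. they are not adjacent with distinct
colours. -/
def Clear (a a' b : Cell) : Prop :=
  a' ≠ b ∧ (gridGraph.Adj a' b → tileColour a = tileColour b)

/-- `A` and `B` can be pulled apart, `A` against direction `d` and `B` in direction `d`, without
blocking each other; `k` is the distance by which `A` has moved relative to `B`. -/
def CanPullApart (d : Dir) (A B : Finset Cell) : Prop :=
  ∀ k : ℕ, 1 ≤ k → ∀ a ∈ A, ∀ b ∈ B, Clear a (a - k • d.vec) b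

/-- A valid straight 2-cut of `P` into `A` and `B`. -/
def IsValidStraightTwoCut (P A B : Finset Cell) : Prop :=
  IsTwoCut P A B ∧ ∃ d : Dir, IsStraightCut d A B ∧ CanPullApart d A B

/-- `P` is straight 2-cuttable: finitely many (possibly no) valid straight 2-cuts, each applied to
one of the current pieces, subdivide `P` into monotone polyominoes. -/
inductive StraightTwoCuttable : Finset Cell → Prop
  | monotone {P : Finset Cell} (hP : IsPolyomino P) (hm : IsMonotone P) : StraightTwoCuttable P
  | cut {P A B : Finset Cell} (h : IsValidStraightTwoCut P A B)
      (hA : StraightTwoCuttable A) (hB : StraightTwoCuttable B) : StraightTwoCuttable P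

/-! ### Workspaces and movement steps -/

/-- The particles of a workspace: each cell holds at most one tile, given by its colour. -/
abbrev Config : Type := Cell → Option Colour

/-- Two adjacent tiles stick together if their colours differ. -/
def bondGraph (c : Config) : SimpleGraph Cell where
  Adj p q := gridGraph.Adj p q ∧ ∃ u v, c p = some u ∧ c q = some v ∧ u ≠ v
  symm := ⟨fun _ _ ⟨h, u, v, hu, hv, huv⟩ => ⟨h.symm, v, u, hv, hu, huv.symm⟩⟩
  loopless := ⟨fun p h => gridGraph.loopless.irrefl p h.1⟩

/-- An assembly: a maximal set of tiles that stick together, i.e. the set of tiles of a connected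
component of the bond graph. -/
def IsAssembly (c : Config) (S : Set Cell) : Prop :=
  ∃ p, (c p).isSome ∧ S = {q | (bondGraph c).Reachable p q}

/-- The tiles that cannot move in direction `d`: those directly in front of an obstacle, those
directly in front of a blocked tile, and those belonging to an assembly with a blocked tile. -/
inductive Blocked (W : Finset Cell) (d : Dir) (c : Config) : Cell → Prop
  | obstacle {p : Cell} (hp : (c p).isSome) (h : p + d.vec ∈ W) : Blocked W d c p
  | tile {p : Cell} (hp : (c p).isSome) (h : Blocked W d c (p + d.vec)) : Blocked W d c p
  | bond {p q : Cell} (h : (bondGraph c).Adj p q) (hq : Blocked W d c q) : Blocked W d c p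

open Classical in
/-- One time unit of a movement step: every tile that is not blocked moves by one cell. -/
noncomputable def advance (W : Finset Cell) (d : Dir) (c : Config) : Config := fun p =>
  if Blocked W d c p then c p
  else if Blocked W d c (p - d.vec) then none
  else c (p - d.vec)

/-- A movement step (unit step) in direction `d` leads from `c` to `c'`: all assemblies move at unit
speed, sticking to the assemblies that they touch on their way, until every tile is blocked. -/
def IsMove (W : Finset Cell) (d : Dir) (c c' : Config) : Prop :=
  (∃ n : ℕ, c' = (advance W d)^[n] c) ∧ ∀ p, (c' p).isSome → Blocked W d c' p

/-- The sequence `σ` of movement steps leads from `c` to `c'`. -/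
def IsRun (W : Finset Cell) : Config → List Dir → Config → Prop
  | c, [], c' => c' = c
  | c, d :: σ, c' => ∃ c₁, IsMove W d c c₁ ∧ IsRun W c₁ σ c'

/-- An initial configuration in a workspace with set of obstacles `W`: finitely many tiles, none on
an obstacle and no two of which stick together. -/
def IsInitial (W : Finset Cell) (c : Config) : Prop :=
  {p | (c p).isSome}.Finite ∧ (∀ p ∈ W, c p = none) ∧ ∀ p q, ¬ (bondGraph c).Adj p q

/-- The translate of `P` by `t` is an assembly of `c`, with alternating colours. -/
def IsCopyAt (P : Finset Cell) (c : Config) (t : Cell) : Prop :=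
  IsAssembly c {q | ∃ p ∈ P, q = p + t} ∧ ∀ p ∈ P, c (p + t) = some (tileColour p)

/-- `D` copies of `P` can be built from single tiles within `n` unit steps: there are a workspace
and a sequence of at most `n` movement steps, at the end of which the workspace contains `D`
(distinct) assemblies that are copies of `P`. -/
def CopiesBuildableWithin (P : Finset Cell) (D n : ℕ) : Prop :=
  ∃ (W : Finset Cell) (c₀ c : Config) (σ : List Dir),
    IsInitial W c₀ ∧ IsRun W c₀ σ c ∧ σ.length ≤ n ∧
      ∃ T : Finset Cell, T.card = D ∧ ∀ t ∈ T, IsCopyAt P c t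

/-- `P` can be built within `n` unit steps. -/
def BuildableWithin (P : Finset Cell) (n : ℕ) : Prop :=
  CopiesBuildableWithin P 1 n

end TiltAssembly

/-! A valid cut, read backwards, is a movement step: if `A` and `B` can be pulled apart, then a tilt
that stops `A` at an obstacle lets `B` arrive behind it and lock on (`merge_isMove`). A few further
steps carry the new assembly out of its workspace, so that it can be merged again (`Ready.merge`).
The two pieces come from workspaces placed far apart, which do not influence each other, and all
pieces obey the same global sequence. Hence all merges on one level of a hierarchy of cuts happen in
parallel, and a piece that is not merged on this level is merely carried through the same 30 steps
(`Ready.levelSteps`, `Ready.cut`). A full rectangle takes two steps (`ready_rect`). A hierarchy of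
depth `n` with rectangles as leaves therefore costs `2 + 30 * n` steps, and any number of copies can
be built side by side at no extra cost.

It remains to find a hierarchy of depth linear in the number of reflex tiles; a given sequence of
cuts may be far deeper. The depth is controlled by `complexity`, which counts four kinds of corner
features in eight orientations. It is at most 32 times the number of reflex tiles, and the pieces of
a straight cut together have no more features than the whole, because such a cut creates no corners.
If both pieces have smaller complexity, one recurses.

Otherwise one piece, say `B`, keeps the full complexity, and `A` has no corner, so it is a rectangle
(`exists_eq_rect`) at the end of a strip of equal rows. If no tile lies beside the continuation of
the strip beyond its end, the end down to the first irregular row is cut off at once. This destroys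
a feature, and the rest is still 2-cuttable because the end is a tab
(`StraightTwoCuttable.sdiff_tab`). If there is such a tile, it must have the colour of every tile of
`A` that passes it, so `A` is a single row. The next row then has the wrong colour to pass. This is
what `Settled` records: the corner at the foot of the strip is unsettled in `P` and settled in `B`,
so `B` has lost a feature after all, a contradiction. Settledness is inherited by pieces
(`Settled.left`), which makes unsettled corners admissible features. So the depth is at most
`complexity P` (`StraightTwoCuttable.hasTree`). -/

namespace TiltAssembly

/-! ### Grid basics -/

theorem adj_iff {p q : Cell} : gridGraph.Adj p q ↔
    (p.1 = q.1 ∧ (q.2 = p.2 + 1 ∨ p.2 = q.2 + 1)) ∨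
      (p.2 = q.2 ∧ (q.1 = p.1 + 1 ∨ p.1 = q.1 + 1)) := by
  change |p.1 - q.1| + |p.2 - q.2| = 1 ↔ _
  constructor
  · intro h
    rcases abs_cases (p.1 - q.1) with h1 | h1 <;> rcases abs_cases (p.2 - q.2) with h2 | h2 <;> omega
  · intro h
    rcases abs_cases (p.1 - q.1) with h1 | h1 <;> rcases abs_cases (p.2 - q.2) with h2 | h2 <;> omega

theorem adj_add_vec (p : Cell) (d : Dir) : gridGraph.Adj p (p + d.vec) := by
  rw [adj_iff]; cases d <;> simp [Dir.vec]

theorem adj_add_right {p q t : Cell} : gridGraph.Adj (p + t) (q + t) ↔ gridGraph.Adj p q := by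
  simp only [adj_iff, Prod.fst_add, Prod.snd_add]; omega

theorem tileColour_eq_iff {p q : Cell} :
    tileColour p = tileColour q ↔ (Even (p.1 + p.2) ↔ Even (q.1 + q.2)) := by
  unfold tileColour
  by_cases h1 : Even (p.1 + p.2) <;> by_cases h2 : Even (q.1 + q.2) <;> simp [h1, h2]

theorem tileColour_ne_of_adj {p q : Cell} (h : gridGraph.Adj p q) :
    tileColour p ≠ tileColour q := by
  rw [adj_iff] at h
  rw [Ne, tileColour_eq_iff]
  simp only [Int.even_iff]; omega

/-- Connectedness as an induction principle. -/
theorem IsPolyomino.induction {P : Finset Cell} (h : IsPolyomino P) {motive : Cell → Prop}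
    {p₀ : Cell} (h₀ : p₀ ∈ P) (base : motive p₀)
    (step : ∀ p ∈ P, ∀ q ∈ P, gridGraph.Adj p q → motive p → motive q) :
    ∀ p ∈ P, motive p := by
  intro p hp
  obtain ⟨w⟩ := h.preconnected ⟨p₀, h₀⟩ ⟨p, hp⟩
  have key : ∀ (u v : (P : Set Cell)), (gridGraph.induce (P : Set Cell)).Walk u v →
      motive u → motive v := by
    intro u v w
    induction w with
    | nil => exact id
    | @cons a b c hab _ ih => exact fun hu => ih (step a a.2 b b.2 hab hu)
  exact key _ _ w base

theorem IsPolyomino.nonempty {P : Finset Cell} (h : IsPolyomino P) : P.Nonempty := by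
  obtain ⟨⟨p, hp⟩⟩ := SimpleGraph.Connected.nonempty h
  exact ⟨p, hp⟩

theorem isPolyomino_of_induction {P : Finset Cell} {p₀ : Cell} (h₀ : p₀ ∈ P)
    (h : ∀ motive : Cell → Prop, motive p₀ →
      (∀ p ∈ P, ∀ q ∈ P, gridGraph.Adj p q → motive p → motive q) → ∀ p ∈ P, motive p) :
    IsPolyomino P := by
  have : Nonempty (P : Set Cell) := ⟨⟨p₀, h₀⟩⟩
  have key : ∀ p ∈ P, ∃ hp : p ∈ P,
      (gridGraph.induce (P : Set Cell)).Reachable ⟨p₀, h₀⟩ ⟨p, hp⟩ := by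
    refine h _ ⟨h₀, SimpleGraph.Reachable.refl _⟩ ?_
    rintro p hp q hq hpq ⟨_, hr⟩
    refine ⟨hq, hr.trans (SimpleGraph.Adj.reachable ?_)⟩
    exact hpq
  refine SimpleGraph.Connected.mk ?_
  intro u v
  obtain ⟨_, hu⟩ := key u u.2
  obtain ⟨_, hv⟩ := key v v.2
  exact hu.symm.trans hv

/-! ### Tile families -/

/-- The tiles of `c` are the tiles `i`, at the cells `pos i` and with the colours `col i`. -/
structure Rep {ι : Type} (c : Config) (pos : ι → Cell) (col : ι → Colour) : Prop where
  inj : Function.Injective pos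
  col : ∀ i, c (pos i) = some (col i)
  surj : ∀ q, (c q).isSome → ∃ i, q = pos i

theorem Rep.ext {ι : Type} {c c' : Config} {pos : ι → Cell} {col : ι → Colour}
    (h : Rep c pos col) (h' : Rep c' pos col) : c = c' := by
  funext q
  by_cases hq : ∃ i, q = pos i
  · obtain ⟨i, rfl⟩ := hq
    rw [h.col, h'.col]
  · have h1 : c q = none := by
      by_contra hn
      exact hq (h.surj q (Option.isSome_iff_ne_none.2 hn))
    have h2 : c' q = none := by
      by_contra hn
      exact hq (h'.surj q (Option.isSome_iff_ne_none.2 hn))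
    rw [h1, h2]

theorem Blocked.isSome {W : Finset Cell} {d : Dir} {c : Config} {p : Cell}
    (h : Blocked W d c p) : (c p).isSome := by
  cases h with
  | obstacle hp _ => exact hp
  | tile hp _ => exact hp
  | bond h _ =>
    obtain ⟨_, u, v, hu, _⟩ := h
    simp [hu]

theorem advance_of_stable {W : Finset Cell} {d : Dir} {c : Config}
    (h : ∀ p, (c p).isSome → Blocked W d c p) : advance W d c = c := by
  funext p
  unfold advance
  by_cases h1 : Blocked W d c p
  · simp [h1]
  · have hp : c p = none := by
      by_contra hn
      exact h1 (h p (Option.isSome_iff_ne_none.2 hn))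
    by_cases h2 : Blocked W d c (p - d.vec)
    · simp [h1, h2, hp]
    · have hp' : c (p - d.vec) = none := by
        by_contra hn
        exact h2 (h _ (Option.isSome_iff_ne_none.2 hn))
      simp [h1, h2, hp, hp']

theorem iterate_advance_of_stable {W : Finset Cell} {d : Dir} {c : Config}
    (h : ∀ p, (c p).isSome → Blocked W d c p) (n : ℕ) : (advance W d)^[n] c = c :=
  Function.iterate_fixed (advance_of_stable h) n

open Classical in
theorem Rep.advance {ι : Type} {W : Finset Cell} {d : Dir} {c : Config} {pos : ι → Cell}
    {col : ι → Colour} (h : Rep c pos col) (S : ι → Prop)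
    (hS : ∀ i, Blocked W d c (pos i) ↔ S i) :
    Rep (advance W d c) (fun i => if S i then pos i else pos i + d.vec) col := by
  -- A tile directly behind a blocked tile is blocked, so a moving tile never enters the cell of a
  -- resting one.
  have hcol : ∀ i j, S i → ¬ S j → pos i ≠ pos j + d.vec := by
    intro i j hi hj hij
    refine hj ((hS j).1 (Blocked.tile (by simp [h.col]) ?_))
    rw [← hij]
    exact (hS i).2 hi
  refine ⟨?_, ?_, ?_⟩
  · intro i j hij
    by_cases hi : S i <;> by_cases hj : S j <;> simp only [hi, hj, if_true, if_false] at hij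
    · exact h.inj hij
    · exact absurd hij (hcol i j hi hj)
    · exact absurd hij.symm (hcol j i hj hi)
    · exact h.inj (add_right_cancel hij)
  · intro i
    by_cases hi : S i
    · simp only [hi, if_true, TiltAssembly.advance, (hS i).2 hi, h.col]
    · have h1 : ¬ Blocked W d c (pos i) := fun hb => hi ((hS i).1 hb)
      have h2 : ¬ Blocked W d c (pos i + d.vec) := fun hb =>
        h1 (Blocked.tile (by simp [h.col]) hb)
      simp only [hi, if_false, TiltAssembly.advance, h2, add_sub_cancel_right, h1, h.col]
  · intro q hq
    unfold TiltAssembly.advance at hq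
    by_cases h1 : Blocked W d c q
    · obtain ⟨i, rfl⟩ := h.surj q h1.isSome
      exact ⟨i, by simp [(hS i).1 h1]⟩
    · by_cases h2 : Blocked W d c (q - d.vec)
      · simp [h1, h2] at hq
      · simp only [h1, h2, if_false] at hq
        obtain ⟨i, hi⟩ := h.surj _ hq
        refine ⟨i, ?_⟩
        have : ¬ S i := fun hs => h2 (hi ▸ (hS i).2 hs)
        simp [this, ← hi]

/-- If a tile `i` runs freely over `f i` cells and is blocked afterwards, then a movement step
moves it by `f i` cells. -/
theorem Rep.isMove {ι : Type} [Finite ι] {W : Finset Cell} {d : Dir} {c : Config}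
    {pos : ι → Cell} {col : ι → Colour} (h : Rep c pos col) (f : ι → ℕ)
    (hW : ∀ i s, s < f i → pos i + (s + 1) • d.vec ∉ W)
    (hij : ∀ i j s, f j ≤ s → s < f i → pos i + (s + 1) • d.vec ≠ pos j + f j • d.vec ∧
      (gridGraph.Adj (pos i + s • d.vec) (pos j + f j • d.vec) → col i = col j))
    (hb : ∀ s c', Rep c' (fun i => pos i + min s (f i) • d.vec) col →
      ∀ i, f i ≤ s → Blocked W d c' (pos i + f i • d.vec)) :
    ∃ c', IsMove W d c c' ∧ Rep c' (fun i => pos i + f i • d.vec) col := by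
  have hs : ∀ s, Rep ((TiltAssembly.advance W d)^[s] c)
      (fun i => pos i + min s (f i) • d.vec) col := by
    intro s
    induction s with
    | zero => simpa using h
    | succ s ih =>
      rw [Function.iterate_succ_apply']
      set c' := (TiltAssembly.advance W d)^[s] c
      -- Blocking starts at an obstacle and spreads backwards or along bonds; `hW` and `hij` exclude
      -- each way of reaching a tile still under way. With `hb`, the tiles blocked at time `s` are
      -- exactly those with `f i ≤ s`.
      have hup : ∀ q, Blocked W d c' q → ∀ i, q = pos i + min s (f i) • d.vec → f i ≤ s := by
        intro q hq
        induction hq with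
        | @obstacle p hp hpW =>
          rintro i rfl
          by_contra hlt
          push Not at hlt
          refine hW i s hlt ?_
          rw [min_eq_left hlt.le] at hpW
          rwa [succ_nsmul, ← add_assoc]
        | @tile p hp hb' ih' =>
          rintro i rfl
          by_contra hlt
          push Not at hlt
          obtain ⟨j, hj⟩ := ih.surj _ hb'.isSome
          have hjs := ih' j hj
          refine (hij i j s hjs hlt).1 ?_
          rw [min_eq_left hlt.le, min_eq_right hjs] at hj
          rw [← hj, succ_nsmul, ← add_assoc]
        | @bond p q hpq hq ih' =>
          rintro i rfl
          by_contra hlt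
          push Not at hlt
          obtain ⟨j, rfl⟩ := ih.surj _ hq.isSome
          have hjs := ih' j rfl
          obtain ⟨hadj, u, v, hu, hv, huv⟩ := hpq
          have e1 := ih.col i
          have e2 := ih.col j
          rw [e1] at hu
          rw [e2] at hv
          rw [min_eq_left hlt.le, min_eq_right hjs] at hadj
          have := (hij i j s hjs hlt).2 hadj
          simp only [Option.some.injEq] at hu hv
          exact huv (hu ▸ hv ▸ this)
      have := ih.advance (fun i => f i ≤ s) (W := W) (d := d) (fun i => ⟨fun hq => hup _ hq i rfl,
        fun hi => by simpa only [min_eq_right hi] using hb s c' ih i hi⟩)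
      convert this using 2 with i
      by_cases hi : f i ≤ s
      · simp [hi, min_eq_right (Nat.le_succ_of_le hi)]
      · push Not at hi
        rw [if_neg (by omega), min_eq_left hi.le, min_eq_left (by omega), succ_nsmul, ← add_assoc]
  have := Fintype.ofFinite ι
  set n := Finset.univ.sup f
  have hn : ∀ i, f i ≤ n := fun i => Finset.le_sup (Finset.mem_univ i)
  have hfin := hs n
  refine ⟨_, ⟨⟨n, rfl⟩, ?_⟩, ?_⟩
  · intro p hp
    obtain ⟨i, rfl⟩ := hfin.surj p hp
    simpa only [min_eq_right (hn i)] using hb n _ hfin i (hn i)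
  · simpa only [min_eq_right (hn _)] using hfin

/-! ### Placed polyominoes -/

/-- The configuration that consists of the translate of `P` by `t`. -/
def place (P : Finset Cell) (t : Cell) : Config := fun q =>
  if q - t ∈ P then some (tileColour (q - t)) else none

theorem place_rep (P : Finset Cell) (t : Cell) :
    Rep (place P t) (fun p : P => (p : Cell) + t) (fun p => tileColour p) := by
  refine ⟨fun p q h => Subtype.ext (add_right_cancel h), fun p => by simp [place], ?_⟩
  intro q hq
  by_cases h : q - t ∈ P
  · exact ⟨⟨_, h⟩, by simp⟩
  · simp [place, h] at hq

/-- In the alternating colouring all neighbours are bonded, so one blocked tile blocks the whole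
connected shape. -/
theorem blocked_of_isPolyomino {A : Finset Cell} (hA : IsPolyomino A) {W : Finset Cell} {d : Dir}
    {c : Config} {t : Cell} (hc : ∀ p ∈ A, c (p + t) = some (tileColour p)) {p₀ : Cell}
    (h₀ : p₀ ∈ A) (hb : Blocked W d c (p₀ + t)) : ∀ p ∈ A, Blocked W d c (p + t) := by
  refine hA.induction h₀ hb ?_
  intro p hp q hq hpq h
  exact Blocked.bond ⟨adj_add_right.2 hpq.symm, _, _, hc q hq, hc p hp,
    tileColour_ne_of_adj hpq.symm⟩ h

/-- All tiles travel for the same time `n`, so none passes a resting one, and a single contact with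
an obstacle stops them all. -/
theorem place_isMove {P : Finset Cell} (hP : IsPolyomino P) {W : Finset Cell} {d : Dir} {t : Cell}
    {n : ℕ} (hfree : ∀ p ∈ P, ∀ s, s < n → p + t + (s + 1) • d.vec ∉ W)
    (hwall : ∃ p ∈ P, p + t + n • d.vec + d.vec ∈ W) :
    IsMove W d (place P t) (place P (t + n • d.vec)) := by
  obtain ⟨p₀, h₀, hp₀⟩ := hwall
  obtain ⟨c', hm, hr⟩ := (place_rep P t).isMove (W := W) (d := d) (fun _ => n)
    (fun i s hs => hfree i i.2 s hs) (fun i j s h1 h2 => absurd h1 (not_le.2 h2)) (by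
      intro s c' hr i hi
      rw [min_eq_right hi] at hr
      have hc : ∀ p ∈ P, c' (p + (t + n • d.vec)) = some (tileColour p) := fun p hp => by
        rw [← add_assoc]; exact hr.col ⟨p, hp⟩
      have := blocked_of_isPolyomino hP hc h₀ (W := W) (d := d)
        (Blocked.obstacle (by rw [hc p₀ h₀]; rfl) (by rwa [← add_assoc])) i i.2
      rwa [← add_assoc] at this)
  have : c' = place P (t + n • d.vec) := hr.ext (by
    have := place_rep P (t + n • d.vec)
    simpa only [← add_assoc] using this)
  exact this ▸ hm

/-! ### Symmetries of the grid -/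

/-- `e` maps the workspace `W, c` to `W', c'` and the direction `d` to `d'`. -/
structure Carries (e : Cell ≃ Cell) (δ : Dir → Dir) : Prop where
  vec : ∀ p d, e (p + d.vec) = e p + (δ d).vec
  adj : ∀ p q, gridGraph.Adj (e p) (e q) ↔ gridGraph.Adj p q

theorem bondGraph_adj_comp {e : Cell ≃ Cell} {δ : Dir → Dir} (h : Carries e δ) (c : Config)
    {p q : Cell} : (bondGraph (c ∘ e)).Adj p q ↔ (bondGraph c).Adj (e p) (e q) := by
  simp only [bondGraph, Function.comp, h.adj]

theorem Carries.vec_symm {e : Cell ≃ Cell} {δ : Dir → Dir} (h : Carries e δ) (q : Cell) (d : Dir) :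
    e.symm (q + (δ d).vec) = e.symm q + d.vec := by
  apply e.injective
  rw [h.vec]; simp

/-- The dynamics is invariant under symmetries of the grid, so each construction has to be carried
out in one orientation only. -/
theorem blocked_comp {e : Cell ≃ Cell} {δ : Dir → Dir} (h : Carries e δ) {W W' : Finset Cell}
    (hW : ∀ p, e p ∈ W' ↔ p ∈ W) {d : Dir} {c : Config} {p : Cell} :
    Blocked W d (c ∘ e) p ↔ Blocked W' (δ d) c (e p) := by
  constructor
  · intro hb
    induction hb with
    | obstacle hp hw => exact Blocked.obstacle hp (by rw [← h.vec]; exact (hW _).2 hw)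
    | tile hp _ ih => exact Blocked.tile hp (by rw [← h.vec]; exact ih)
    | bond hpq _ ih => exact Blocked.bond ((bondGraph_adj_comp h c).1 hpq) ih
  · intro hb
    have key : ∀ q, Blocked W' (δ d) c q → Blocked W d (c ∘ e) (e.symm q) := by
      intro q hq
      induction hq with
      | @obstacle q hp hw =>
        refine Blocked.obstacle (by simpa using hp) ((hW _).1 ?_)
        rw [h.vec]; simpa using hw
      | @tile q hp _ ih =>
        refine Blocked.tile (by simpa using hp) ?_
        rwa [← h.vec_symm]
      | bond hpq _ ih => exact Blocked.bond ((bondGraph_adj_comp h c).2 (by simpa using hpq)) ih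
    simpa using key _ hb

open Classical in
theorem advance_comp {e : Cell ≃ Cell} {δ : Dir → Dir} (h : Carries e δ) {W W' : Finset Cell}
    (hW : ∀ p, e p ∈ W' ↔ p ∈ W) {d : Dir} {c : Config} :
    advance W d (c ∘ e) = advance W' (δ d) c ∘ e := by
  funext p
  have h1 : e (p - d.vec) = e p - (δ d).vec := by
    rw [eq_sub_iff_add_eq, ← h.vec, sub_add_cancel]
  simp only [Function.comp_apply, advance]
  have b1 := blocked_comp h hW (d := d) (c := c) (p := p)
  have b2 := blocked_comp h hW (d := d) (c := c) (p := p - d.vec)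
  simp only [b1, b2, h1]

theorem iterate_advance_comp {e : Cell ≃ Cell} {δ : Dir → Dir} (h : Carries e δ)
    {W W' : Finset Cell} (hW : ∀ p, e p ∈ W' ↔ p ∈ W) {d : Dir} {c : Config} (n : ℕ) :
    (advance W d)^[n] (c ∘ e) = (advance W' (δ d))^[n] c ∘ e := by
  induction n generalizing c with
  | zero => rfl
  | succ n ih => rw [Function.iterate_succ_apply, Function.iterate_succ_apply, advance_comp h hW, ih]

theorem IsMove.comp {e : Cell ≃ Cell} {δ : Dir → Dir} (h : Carries e δ) {W W' : Finset Cell}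
    (hW : ∀ p, e p ∈ W' ↔ p ∈ W) {d : Dir} {c c' : Config} (hm : IsMove W' (δ d) c c') :
    IsMove W d (c ∘ e) (c' ∘ e) := by
  obtain ⟨⟨n, rfl⟩, hs⟩ := hm
  exact ⟨⟨n, (iterate_advance_comp h hW n).symm⟩, fun p hp => (blocked_comp h hW).2 (hs _ hp)⟩

theorem IsRun.comp {e : Cell ≃ Cell} {δ : Dir → Dir} (h : Carries e δ) {W W' : Finset Cell}
    (hW : ∀ p, e p ∈ W' ↔ p ∈ W) {σ : List Dir} {c c' : Config}
    (hr : IsRun W' c (σ.map δ) c') : IsRun W (c ∘ e) σ (c' ∘ e) := by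
  induction σ generalizing c with
  | nil => exact congrArg (· ∘ e) hr
  | cons d σ ih =>
    obtain ⟨c₁, hm, hr⟩ := hr
    exact ⟨c₁ ∘ e, hm.comp h hW, ih hr⟩

theorem IsInitial.comp {e : Cell ≃ Cell} {δ : Dir → Dir} (h : Carries e δ) {W W' : Finset Cell}
    (hW : ∀ p, e p ∈ W' ↔ p ∈ W) {c : Config} (hi : IsInitial W' c) : IsInitial W (c ∘ e) := by
  obtain ⟨h1, h2, h3⟩ := hi
  refine ⟨?_, fun p hp => h2 _ ((hW p).2 hp), fun p q hpq => h3 _ _ ((bondGraph_adj_comp h c).1 hpq)⟩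
  exact h1.preimage e.injective.injOn

theorem IsRun.append {W : Finset Cell} {σ τ : List Dir} {c c₁ c' : Config}
    (h : IsRun W c σ c₁) (h' : IsRun W c₁ τ c') : IsRun W c (σ ++ τ) c' := by
  induction σ generalizing c with
  | nil => cases h; exact h'
  | cons d σ ih =>
    obtain ⟨c₂, hm, hr⟩ := h
    exact ⟨c₂, hm, ih hr⟩

theorem carries_addRight (t : Cell) : Carries (Equiv.addRight t) id where
  vec p d := by simp [add_right_comm]
  adj p q := by simpa using adj_add_right

/-! ### Independent workspaces -/

/-- No cell of `R` is equal or adjacent to a cell of `S`. -/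
def Apart (R S : Set Cell) : Prop :=
  ∀ p ∈ R, ∀ q ∈ S, p ≠ q ∧ ¬ gridGraph.Adj p q

theorem Apart.symm {R S : Set Cell} (h : Apart R S) : Apart S R := fun p hp q hq =>
  ⟨(h q hq p hp).1.symm, fun ha => (h q hq p hp).2 ha.symm⟩

/-- All tiles of `c` lie in `R`. -/
def Within (R : Set Cell) (c : Config) : Prop :=
  ∀ p, (c p).isSome → p ∈ R

/-- The tiles of `c` and those of `c'`. -/
def join (c c' : Config) : Config := fun p => (c p).or (c' p)

/-- A run during which all tiles stay in `R`. -/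
def IsRunWithin (R : Set Cell) (W : Finset Cell) : Config → List Dir → Config → Prop
  | c, [], c' => c' = c ∧ Within R c
  | c, d :: σ, c' => ∃ n, (∀ p, ((advance W d)^[n] c p).isSome →
      Blocked W d ((advance W d)^[n] c) p) ∧ (∀ k, Within R ((advance W d)^[k] c)) ∧
      IsRunWithin R W ((advance W d)^[n] c) σ c'

theorem Within.mono {R S : Set Cell} (h : R ⊆ S) {c : Config} (hc : Within R c) : Within S c :=
  fun p hp => h (hc p hp)

theorem IsRunWithin.mono {R S : Set Cell} (h : R ⊆ S) {W : Finset Cell} {σ : List Dir}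
    {c c' : Config} (hr : IsRunWithin R W c σ c') : IsRunWithin S W c σ c' := by
  induction σ generalizing c with
  | nil => exact ⟨hr.1, hr.2.mono h⟩
  | cons d σ ih =>
    obtain ⟨n, h1, h2, h3⟩ := hr
    exact ⟨n, h1, fun k => (h2 k).mono h, ih h3⟩

theorem IsRunWithin.isRun {R : Set Cell} {W : Finset Cell} {σ : List Dir}
    {c c' : Config} (hr : IsRunWithin R W c σ c') : IsRun W c σ c' := by
  induction σ generalizing c with
  | nil => exact hr.1
  | cons d σ ih =>
    obtain ⟨n, h1, h2, h3⟩ := hr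
    exact ⟨_, ⟨⟨n, rfl⟩, h1⟩, ih h3⟩

theorem IsRunWithin.within_start {R : Set Cell} {W : Finset Cell} {σ : List Dir}
    {c c' : Config} (hr : IsRunWithin R W c σ c') : Within R c := by
  cases σ with
  | nil => exact hr.2
  | cons d σ => obtain ⟨n, _, h2, _⟩ := hr; exact h2 0

theorem IsRunWithin.within_end {R : Set Cell} {W : Finset Cell} {σ : List Dir}
    {c c' : Config} (hr : IsRunWithin R W c σ c') : Within R c' := by
  induction σ generalizing c with
  | nil => exact hr.1 ▸ hr.2
  | cons d σ ih => obtain ⟨n, _, _, h3⟩ := hr; exact ih h3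

theorem finite_advance {W : Finset Cell} {d : Dir} {c : Config} (h : {p | (c p).isSome}.Finite) :
    {p | (advance W d c p).isSome}.Finite := by
  refine (h.union (h.image (· + d.vec))).subset ?_
  intro p hp
  simp only [Set.mem_ofPred_eq, advance] at hp
  split_ifs at hp with h1 h2
  · exact Or.inl hp
  · simp at hp
  · exact Or.inr ⟨p - d.vec, hp, by simp⟩

/-- Every movement step ends in a stable configuration, so only finitely many configurations occur,
each with finitely many tiles. -/
theorem IsRun.exists_within {W : Finset Cell} {σ : List Dir} {c c' : Config}
    (hc : {p | (c p).isSome}.Finite) (hr : IsRun W c σ c') :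
    ∃ R : Set Cell, R.Finite ∧ IsRunWithin R W c σ c' := by
  induction σ generalizing c with
  | nil => exact ⟨_, hc, hr, fun p hp => hp⟩
  | cons d σ ih =>
    obtain ⟨c₁, ⟨⟨n, rfl⟩, hs⟩, hr⟩ := hr
    have hfin : ∀ k, {p | ((advance W d)^[k] c p).isSome}.Finite := by
      intro k
      induction k with
      | zero => exact hc
      | succ k ihk => rw [Function.iterate_succ_apply']; exact finite_advance ihk
    obtain ⟨R, hR, hrun⟩ := ih (hfin n) hr
    refine ⟨R ∪ ⋃ k ∈ Finset.range (n + 1), {p | ((advance W d)^[k] c p).isSome},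
      hR.union (Set.Finite.biUnion (Finset.finite_toSet _) fun k _ => hfin k), n, hs, ?_,
      hrun.mono Set.subset_union_left⟩
    intro k p hp
    refine Or.inr ?_
    rcases le_total k n with hk | hk
    · exact Set.mem_biUnion (x := k) (by simpa using Nat.lt_succ_of_le hk) hp
    · obtain ⟨m, rfl⟩ := Nat.exists_eq_add_of_le' hk
      rw [Function.iterate_add_apply, iterate_advance_of_stable hs] at hp
      exact Set.mem_biUnion (x := n) (by simp) hp

/-! ### Independence of configurations in regions that are apart -/

section Join

variable {R₁ R₂ : Set Cell} {W₁ W₂ : Finset Cell} {c₁ c₂ : Config} {d : Dir}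

theorem join_comm_of_apart (hR : Apart R₁ R₂) (h₁ : Within R₁ c₁) (h₂ : Within R₂ c₂) :
    join c₁ c₂ = join c₂ c₁ := by
  funext p
  unfold join
  cases e1 : c₁ p with
  | none => simp
  | some u =>
    cases e2 : c₂ p with
    | none => simp
    | some v =>
      exact absurd rfl (hR p (h₁ p (by simp [e1])) p (h₂ p (by simp [e2]))).1

theorem join_eq_left (h : Apart R₁ R₂) (h₂ : Within R₂ c₂) {p : Cell} (hp : p ∈ R₁) :
    join c₁ c₂ p = c₁ p := by
  have : c₂ p = none := by
    by_contra hn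
    exact (h p hp p (h₂ p (Option.isSome_iff_ne_none.2 hn))).1 rfl
  simp [join, this]

theorem join_isSome {p : Cell} : (join c₁ c₂ p).isSome ↔ (c₁ p).isSome ∨ (c₂ p).isSome := by
  simp [join, Option.isSome_or]

theorem bondGraph_join_left (hR : Apart R₁ R₂) (h₁ : Within R₁ c₁) (h₂ : Within R₂ c₂)
    {p q : Cell} (hp : p ∈ R₁) :
    (bondGraph (join c₁ c₂)).Adj p q ↔ (bondGraph c₁).Adj p q := by
  have ep := join_eq_left (c₁ := c₁) hR h₂ hp
  constructor
  · rintro ⟨hadj, u, v, hu, hv, huv⟩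
    have hq : (c₁ q).isSome := by
      rcases join_isSome.1 (show (join c₁ c₂ q).isSome by simp [hv]) with h | h
      · exact h
      · exact absurd hadj (hR p hp q (h₂ q h)).2
    exact ⟨hadj, u, v, ep ▸ hu, join_eq_left (c₁ := c₁) hR h₂ (h₁ q hq) ▸ hv, huv⟩
  · rintro ⟨hadj, u, v, hu, hv, huv⟩
    have hq : q ∈ R₁ := h₁ q (by simp [hv])
    exact ⟨hadj, u, v, ep ▸ hu, (join_eq_left (c₁ := c₁) hR h₂ hq).trans hv, huv⟩

theorem Blocked.join_left (hR : Apart R₁ R₂) (h₁ : Within R₁ c₁) (h₂ : Within R₂ c₂) {p : Cell}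
    (h : Blocked W₁ d c₁ p) : Blocked (W₁ ∪ W₂) d (join c₁ c₂) p := by
  induction h with
  | obstacle hp hw => exact Blocked.obstacle (join_isSome.2 (Or.inl hp)) (Finset.mem_union_left _ hw)
  | tile hp _ ih => exact Blocked.tile (join_isSome.2 (Or.inl hp)) ih
  | @bond p q hpq _ ih =>
    have hp : p ∈ R₁ := by
      obtain ⟨_, u, _, hu, _⟩ := hpq
      exact h₁ p (by simp [hu])
    exact Blocked.bond ((bondGraph_join_left hR h₁ h₂ hp).2 hpq) ih

theorem Blocked.of_join (hR : Apart R₁ R₂) (h₁ : Within R₁ c₁) (h₂ : Within R₂ c₂)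
    (hW₂ : (W₂ : Set Cell) ⊆ R₂) {p : Cell} (h : Blocked (W₁ ∪ W₂) d (join c₁ c₂) p)
    (hp : p ∈ R₁) : Blocked W₁ d c₁ p := by
  induction h with
  | @obstacle p hs hw =>
    rw [join_eq_left hR h₂ hp] at hs
    rcases Finset.mem_union.1 hw with hw | hw
    · exact Blocked.obstacle hs hw
    · exact absurd (adj_add_vec p d) (hR p hp _ (hW₂ hw)).2
  | @tile p hs hb ih =>
    rw [join_eq_left hR h₂ hp] at hs
    refine Blocked.tile hs (ih ?_)
    rcases join_isSome.1 hb.isSome with h | h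
    · exact h₁ _ h
    · exact absurd (adj_add_vec p d) (hR p hp _ (h₂ _ h)).2
  | @bond p q hpq _ ih =>
    have hpq' := (bondGraph_join_left hR h₁ h₂ hp).1 hpq
    refine Blocked.bond hpq' (ih ?_)
    obtain ⟨_, _, _, _, hv, _⟩ := hpq'
    exact h₁ q (by simp [hv])

theorem blocked_join (hR : Apart R₁ R₂) (h₁ : Within R₁ c₁) (h₂ : Within R₂ c₂)
    (hW₁ : (W₁ : Set Cell) ⊆ R₁) (hW₂ : (W₂ : Set Cell) ⊆ R₂) {p : Cell} :
    Blocked (W₁ ∪ W₂) d (join c₁ c₂) p ↔ Blocked W₁ d c₁ p ∨ Blocked W₂ d c₂ p := by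
  have hc := join_comm_of_apart hR h₁ h₂
  constructor
  · intro h
    rcases join_isSome.1 h.isSome with hp | hp
    · exact Or.inl (h.of_join hR h₁ h₂ hW₂ (h₁ p hp))
    · rw [hc, Finset.union_comm] at h
      exact Or.inr (h.of_join hR.symm h₂ h₁ hW₁ (h₂ p hp))
  · rintro (h | h)
    · exact h.join_left hR h₁ h₂
    · rw [hc, Finset.union_comm]
      exact h.join_left hR.symm h₂ h₁

-- The new content of `p` depends on the old content and the blocking of `p` and `p - d.vec` only.
-- If one of these cells holds a tile of one region, apartness keeps both free of tiles of the
-- other.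
open Classical in
theorem advance_join (hR : Apart R₁ R₂) (h₁ : Within R₁ c₁) (h₂ : Within R₂ c₂)
    (hW₁ : (W₁ : Set Cell) ⊆ R₁) (hW₂ : (W₂ : Set Cell) ⊆ R₂) :
    advance (W₁ ∪ W₂) d (join c₁ c₂) = join (advance W₁ d c₁) (advance W₂ d c₂) := by
  funext p
  have key : ∀ {R₁ R₂ : Set Cell} {W₁ W₂ : Finset Cell} {c₁ c₂ : Config}, Apart R₁ R₂ →
      Within R₁ c₁ → Within R₂ c₂ → ((c₁ p).isSome ∨ (c₁ (p - d.vec)).isSome) →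
      ¬ Blocked W₂ d c₂ p ∧ ¬ Blocked W₂ d c₂ (p - d.vec) ∧ c₂ p = none ∧
        c₂ (p - d.vec) = none := by
    intro R₁ R₂ W₁ W₂ c₁ c₂ hR h₁ h₂ h
    have hadj : gridGraph.Adj (p - d.vec) p := by simpa using adj_add_vec (p - d.vec) d
    have a1 : p ∉ R₂ := by
      intro hp
      rcases h with h | h
      · exact (hR _ (h₁ _ h) _ hp).1 rfl
      · exact (hR _ (h₁ _ h) _ hp).2 hadj
    have a2 : p - d.vec ∉ R₂ := by
      intro hp
      rcases h with h | h
      · exact (hR _ (h₁ _ h) _ hp).2 hadj.symm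
      · exact (hR _ (h₁ _ h) _ hp).1 rfl
    have n1 : c₂ p = none := by
      by_contra hn; exact a1 (h₂ _ (Option.isSome_iff_ne_none.2 hn))
    have n2 : c₂ (p - d.vec) = none := by
      by_contra hn; exact a2 (h₂ _ (Option.isSome_iff_ne_none.2 hn))
    exact ⟨fun hb => by simpa [n1] using hb.isSome, fun hb => by simpa [n2] using hb.isSome, n1, n2⟩
  by_cases ha : (c₁ p).isSome ∨ (c₁ (p - d.vec)).isSome
  · obtain ⟨b1, b2, n1, n2⟩ := key (W₁ := W₁) (W₂ := W₂) hR h₁ h₂ ha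
    simp only [advance, blocked_join hR h₁ h₂ hW₁ hW₂, b1, b2, or_false, join, n1, n2,
      Option.or_none, if_false]
  · by_cases hb : (c₂ p).isSome ∨ (c₂ (p - d.vec)).isSome
    · obtain ⟨b1, b2, n1, n2⟩ := key (W₁ := W₂) (W₂ := W₁) hR.symm h₂ h₁ hb
      simp only [advance, blocked_join hR h₁ h₂ hW₁ hW₂, b1, b2, false_or, join, n1, n2,
        Option.none_or, if_false]
    · have e1 : ∀ {c : Config} {W : Finset Cell}, ¬ ((c p).isSome ∨ (c (p - d.vec)).isSome) →
          ¬ Blocked W d c p ∧ ¬ Blocked W d c (p - d.vec) ∧ c (p - d.vec) = none := by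
        intro c W h
        push Not at h
        exact ⟨fun hb => h.1 hb.isSome, fun hb => h.2 hb.isSome, by simpa using h.2⟩
      obtain ⟨a1, a2, a3⟩ := e1 (W := W₁) ha
      obtain ⟨b1, b2, b3⟩ := e1 (W := W₂) hb
      simp only [advance, blocked_join hR h₁ h₂ hW₁ hW₂, a1, a2, b1, b2, or_false, join, a3, b3,
        Option.or_none, if_false]

theorem IsRunWithin.join (hR : Apart R₁ R₂) (hW₁ : (W₁ : Set Cell) ⊆ R₁)
    (hW₂ : (W₂ : Set Cell) ⊆ R₂) {σ : List Dir} {c₁' c₂' : Config}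
    (h₁ : IsRunWithin R₁ W₁ c₁ σ c₁') (h₂ : IsRunWithin R₂ W₂ c₂ σ c₂') :
    IsRunWithin (R₁ ∪ R₂) (W₁ ∪ W₂) (join c₁ c₂) σ (join c₁' c₂') := by
  have hw : ∀ {c₁ c₂}, Within R₁ c₁ → Within R₂ c₂ → Within (R₁ ∪ R₂) (TiltAssembly.join c₁ c₂) := by
    intro c₁ c₂ h₁ h₂ p hp
    exact (join_isSome.1 hp).imp (h₁ p) (h₂ p)
  induction σ generalizing c₁ c₂ with
  | nil => exact ⟨by rw [h₁.1, h₂.1], hw h₁.2 h₂.2⟩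
  | cons d σ ih =>
    obtain ⟨n₁, s₁, w₁, r₁⟩ := h₁
    obtain ⟨n₂, s₂, w₂, r₂⟩ := h₂
    have hk : ∀ k, (advance (W₁ ∪ W₂) d)^[k] (TiltAssembly.join c₁ c₂) =
        TiltAssembly.join ((advance W₁ d)^[k] c₁) ((advance W₂ d)^[k] c₂) := by
      intro k
      induction k with
      | zero => rfl
      | succ k ihk =>
        rw [Function.iterate_succ_apply', ihk, advance_join hR (w₁ k) (w₂ k) hW₁ hW₂,
          Function.iterate_succ_apply', Function.iterate_succ_apply']
    -- The two sides may need different times for this step; stable configurations do not change, so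
    -- the later time serves both.
    have e₁ : (advance W₁ d)^[max n₁ n₂] c₁ = (advance W₁ d)^[n₁] c₁ := by
      obtain ⟨m, hm⟩ := Nat.exists_eq_add_of_le' (le_max_left n₁ n₂)
      rw [hm, Function.iterate_add_apply, iterate_advance_of_stable s₁]
    have e₂ : (advance W₂ d)^[max n₁ n₂] c₂ = (advance W₂ d)^[n₂] c₂ := by
      obtain ⟨m, hm⟩ := Nat.exists_eq_add_of_le' (le_max_right n₁ n₂)
      rw [hm, Function.iterate_add_apply, iterate_advance_of_stable s₂]
    refine ⟨max n₁ n₂, ?_, fun k => by rw [hk]; exact hw (w₁ k) (w₂ k), ?_⟩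
    · rw [hk, e₁, e₂]
      intro p hp
      rw [blocked_join hR r₁.within_start r₂.within_start hW₁ hW₂]
      exact (join_isSome.1 hp).imp (s₁ p) (s₂ p)
    · rw [hk, e₁, e₂]
      exact ih r₁ r₂

theorem IsInitial.join (hR : Apart R₁ R₂) (h₁ : Within R₁ c₁) (h₂ : Within R₂ c₂)
    (hW₁ : (W₁ : Set Cell) ⊆ R₁) (hW₂ : (W₂ : Set Cell) ⊆ R₂) (i₁ : IsInitial W₁ c₁)
    (i₂ : IsInitial W₂ c₂) : IsInitial (W₁ ∪ W₂) (join c₁ c₂) := by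
  have hc := join_comm_of_apart hR h₁ h₂
  refine ⟨?_, ?_, ?_⟩
  · refine (i₁.1.union i₂.1).subset ?_
    intro p hp
    exact join_isSome.1 hp
  · intro p hp
    rcases Finset.mem_union.1 hp with hp | hp
    · rw [join_eq_left hR h₂ (hW₁ hp)]; exact i₁.2.1 p hp
    · rw [hc, join_eq_left hR.symm h₁ (hW₂ hp)]; exact i₂.2.1 p hp
  · intro p q hpq
    have hp : (TiltAssembly.join c₁ c₂ p).isSome := by
      obtain ⟨_, u, _, hu, _⟩ := hpq
      simp [hu]
    rcases join_isSome.1 hp with h | h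
    · exact i₁.2.2 p q ((bondGraph_join_left hR h₁ h₂ (h₁ p h)).1 hpq)
    · rw [hc] at hpq
      exact i₂.2.2 p q ((bondGraph_join_left hR.symm h₂ h₁ (h₂ p h)).1 hpq)

theorem IsAssembly.join_left (hR : Apart R₁ R₂) (h₁ : Within R₁ c₁) (h₂ : Within R₂ c₂)
    {S : Set Cell} (h : IsAssembly c₁ S) : IsAssembly (join c₁ c₂) S := by
  obtain ⟨p, hp, rfl⟩ := h
  refine ⟨p, join_isSome.2 (Or.inl hp), ?_⟩
  have hmem : ∀ {a b}, (bondGraph c₁).Adj a b → a ∈ R₁ := by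
    rintro a b ⟨_, u, _, hu, _⟩
    exact h₁ a (by simp [hu])
  ext q
  constructor
  · rintro ⟨w⟩
    simp only [Set.mem_ofPred_eq]
    clear hp
    induction w with
    | nil => exact SimpleGraph.Reachable.refl _
    | cons h _ ih => exact (SimpleGraph.Adj.reachable
        ((bondGraph_join_left hR h₁ h₂ (hmem h)).2 h)).trans ih
  · rintro ⟨w⟩
    simp only [Set.mem_ofPred_eq]
    have hp' := h₁ p hp
    clear hp
    induction w with
    | nil => exact SimpleGraph.Reachable.refl _
    | cons h _ ih =>
      have h' := (bondGraph_join_left hR h₁ h₂ hp').1 h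
      exact h'.reachable.trans (ih (hmem h'.symm))

end Join

/-! ### Linear symmetries -/

/-- A linear symmetry of the grid of order two that preserves the colours of tiles. -/
structure IsSym (e : Cell ≃ Cell) (δ : Dir → Dir) : Prop extends Carries e δ where
  add : ∀ p q, e (p + q) = e p + e q
  colour : ∀ p, tileColour (e p) = tileColour p
  symm_eq : e.symm = e
  dir : ∀ d, δ (δ d) = d

/-- The reflection in the diagonal. -/
def diag : Cell ≃ Cell := Equiv.prodComm ℤ ℤ

/-- The action of `diag` on directions. -/
def diagDir : Dir → Dir
  | .up => .right
  | .right => .up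
  | .down => .left
  | .left => .down

/-- The reflection in the vertical axis. -/
def flipX : Cell ≃ Cell := (Equiv.neg ℤ).prodCongr (Equiv.refl ℤ)

/-- The action of `flipX` on directions. -/
def flipXDir : Dir → Dir
  | .up => .up
  | .right => .left
  | .down => .down
  | .left => .right

@[simp] theorem diag_apply (p : Cell) : diag p = (p.2, p.1) := rfl
@[simp] theorem diag_symm : diag.symm = diag := rfl
@[simp] theorem flipX_apply (p : Cell) : flipX p = (-p.1, p.2) := rfl
@[simp] theorem flipX_symm : flipX.symm = flipX := by ext p <;> rfl

theorem isSym_diag : IsSym diag diagDir where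
  vec p d := by cases d <;> ext <;> simp [diagDir, Dir.vec]
  adj p q := by simp only [adj_iff, diag_apply]; omega
  add p q := rfl
  colour p := by rw [tileColour_eq_iff]; simp [add_comm]
  symm_eq := rfl
  dir d := by cases d <;> rfl

theorem isSym_flipX : IsSym flipX flipXDir where
  vec p d := by cases d <;> ext <;> simp [flipXDir, Dir.vec, add_comm]
  adj p q := by simp only [adj_iff, flipX_apply]; omega
  add p q := by ext <;> simp [add_comm]
  colour p := by rw [tileColour_eq_iff]; simp only [flipX_apply, Int.even_iff]; omega
  symm_eq := by simp
  dir d := by cases d <;> rfl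

namespace IsSym

variable {e : Cell ≃ Cell} {δ : Dir → Dir}

theorem apply_apply (h : IsSym e δ) (p : Cell) : e (e p) = p := by
  nth_rewrite 1 [← h.symm_eq]; simp

theorem mem_map (h : IsSym e δ) {P : Finset Cell} {p : Cell} :
    p ∈ P.map e.toEmbedding ↔ e p ∈ P := by
  rw [Finset.mem_map_equiv, h.symm_eq]

theorem map_map (h : IsSym e δ) (P : Finset Cell) :
    (P.map e.toEmbedding).map e.toEmbedding = P := by
  ext p; rw [h.mem_map, h.mem_map, h.apply_apply]

theorem sub (h : IsSym e δ) (p q : Cell) : e (p - q) = e p - e q := by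
  rw [eq_sub_iff_add_eq, ← h.add, sub_add_cancel]

theorem place_comp (h : IsSym e δ) (P : Finset Cell) (t : Cell) :
    place P t ∘ e = place (P.map e.toEmbedding) (e t) := by
  funext q
  simp only [Function.comp, place, h.mem_map, h.sub, h.apply_apply]
  rw [← h.colour (e q - t), h.sub, h.apply_apply]

theorem map_dir (h : IsSym e δ) (σ : List Dir) : (σ.map δ).map δ = σ := by
  simp [List.map_map, Function.comp_def, h.dir]

theorem isRun (h : IsSym e δ) {W : Finset Cell} {c c' : Config} {σ : List Dir}
    (hr : IsRun W c σ c') : IsRun (W.map e.toEmbedding) (c ∘ e) (σ.map δ) (c' ∘ e) :=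
  IsRun.comp h.toCarries (W' := W) (fun _ => h.mem_map.symm) (by rwa [h.map_dir])

theorem isInitial (h : IsSym e δ) {W : Finset Cell} {c : Config} (hi : IsInitial W c) :
    IsInitial (W.map e.toEmbedding) (c ∘ e) :=
  IsInitial.comp h.toCarries (W' := W) (fun _ => h.mem_map.symm) hi

theorem isPolyomino (h : IsSym e δ) {P : Finset Cell} (hP : IsPolyomino P) :
    IsPolyomino (P.map e.toEmbedding) := by
  obtain ⟨p₀, h₀⟩ := hP.nonempty
  refine isPolyomino_of_induction (p₀ := e p₀) (by rwa [h.mem_map, h.apply_apply]) ?_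
  intro motive base step p hp
  rw [h.mem_map] at hp
  have := hP.induction (motive := fun q => motive (e q)) h₀ base (fun a ha b hb hab hm =>
    step (e a) (by rwa [h.mem_map, h.apply_apply]) (e b) (by rwa [h.mem_map, h.apply_apply])
      ((h.adj a b).2 hab) hm) _ hp
  rwa [h.apply_apply] at this

end IsSym

/-! ### Merging two assemblies -/

/-- This is pulling apart in reverse. `A` has the shorter way `m` and rests when `B` closes in;
`CanPullApart` says that no tile of `B` meets or sticks to `A` before the remaining distance is
zero. -/
theorem merge_isMove {A B W : Finset Cell} (hA : IsPolyomino A) (hP : IsPolyomino (A ∪ B))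
    (hpull : CanPullApart Dir.right A B) {t : Cell} {m n : ℕ} (hmn : m < n)
    {c : Config}
    (hc : Rep c (fun p : ↥(A ∪ B) => (p : Cell) + t + (if (p : Cell) ∈ A then m else n) •
      Dir.right.vec) (fun p => tileColour p))
    (hfA : ∀ a ∈ A, ∀ s < m, a + t + (m - s - 1 : ℤ) • Dir.right.vec ∉ W)
    (hfB : ∀ b ∈ B, ∀ s < n, b + t + (n - s - 1 : ℤ) • Dir.right.vec ∉ W)
    (hwall : ∃ a ∈ A, a + t + Dir.left.vec ∈ W) :
    IsMove W Dir.left c (place (A ∪ B) t) := by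
  have e1 : ∀ (p : Cell) (k s : ℕ), p + t + k • Dir.right.vec + (s + 1) • Dir.left.vec =
      p + t + (k - s - 1 : ℤ) • Dir.right.vec := by
    intro p k s; ext <;> simp [Dir.vec]; ring
  have e2 : ∀ (p : Cell) (k : ℕ), p + t + k • Dir.right.vec + k • Dir.left.vec = p + t := by
    intro p k; ext <;> simp [Dir.vec]
  have memB : ∀ p : ↥(A ∪ B), (p : Cell) ∉ A → (p : Cell) ∈ B := fun p hp =>
    (Finset.mem_union.1 p.2).resolve_left hp
  obtain ⟨a₀, ha₀, hw₀⟩ := hwall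
  obtain ⟨c', hm, hr⟩ := hc.isMove (W := W) (d := Dir.left)
    (fun p => if (p : Cell) ∈ A then m else n)
    (by
      intro p s hs
      by_cases hp : (p : Cell) ∈ A
      · simp only [hp, if_true] at hs ⊢
        rw [e1]; exact hfA p hp s hs
      · simp only [hp, if_false] at hs ⊢
        rw [e1]; exact hfB p (memB p hp) s hs)
    (by
      intro p q s hq hs
      by_cases hp : (p : Cell) ∈ A
      · by_cases hq' : (q : Cell) ∈ A <;> simp only [hp, hq', if_true, if_false] at hs hq <;> omega
      · by_cases hq' : (q : Cell) ∈ A <;> simp only [hp, hq', if_true, if_false] at hs hq ⊢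
        -- Here `p` in `B` approaches the resting `q` in `A`, with `n - s` cells still to go. After
        -- its next step `n - s - 1` remain; if this is zero, `p` is at its final cell, which
        -- differs from that of `q`.
        · rw [e2]
          have hpB := memB p hp
          constructor
          · intro heq
            rw [e1] at heq
            rcases Nat.lt_or_ge (s + 1) n with h | h
            · have hcl := (hpull (n - s - 1) (by omega) q hq' p hpB).1
              apply hcl
              have h1 := congrArg Prod.fst heq
              have h2 := congrArg Prod.snd heq
              simp only [Dir.vec, Prod.fst_add, Prod.snd_add, Prod.smul_fst, Prod.smul_snd,
                smul_eq_mul] at h1 h2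
              ext
              · simp [Dir.vec]; push_cast [Nat.cast_sub (show s ≤ n by omega),
                  Nat.cast_sub (show 1 ≤ n - s by omega)]; linarith
              · simp [Dir.vec]; linarith
            · have : (n - s - 1 : ℤ) = 0 := by omega
              rw [this, zero_smul, add_zero] at heq
              exact hp (add_right_cancel heq ▸ hq')
          · intro hadj
            refine ((hpull (n - s) (by omega) q hq' p hpB).2 ?_).symm
            rw [adj_iff] at hadj ⊢
            simp [Dir.vec] at hadj ⊢
            push_cast [Nat.cast_sub (show s ≤ n by omega)]
            omega
        · omega)
    (by
      intro s c' hr p hp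
      have hcA : m ≤ s → ∀ a ∈ A, c' (a + t) = some (tileColour a) := by
        intro hs a ha
        have := hr.col ⟨a, Finset.mem_union_left _ ha⟩
        simp only [ha, if_true, min_eq_right hs, e2] at this
        exact this
      have hcB : n ≤ s → ∀ a ∈ A ∪ B, c' (a + t) = some (tileColour a) := by
        intro hs a ha
        by_cases ha' : a ∈ A
        · exact hcA (by omega) a ha'
        · have := hr.col ⟨a, ha⟩
          simp only [ha', if_false, min_eq_right hs, e2] at this
          exact this
      by_cases hp' : (p : Cell) ∈ A
      · simp only [hp', if_true] at hp ⊢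
        rw [e2]
        exact blocked_of_isPolyomino hA (hcA hp) ha₀
          (Blocked.obstacle (by rw [hcA hp a₀ ha₀]; rfl) hw₀) p hp'
      · simp only [hp', if_false] at hp ⊢
        rw [e2]
        have h₀ := Finset.mem_union_left B ha₀
        exact blocked_of_isPolyomino hP (hcB hp) h₀
          (Blocked.obstacle (by rw [hcB hp a₀ h₀]; rfl) hw₀) p p.2)
  have : c' = place (A ∪ B) t := hr.ext (by
    have := place_rep (A ∪ B) t
    convert this using 2
    exact e2 _ _)
  exact this ▸ hm

/-! ### Polyominoes that are ready for the next step -/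

/-- The sequence `σ` builds `P` in such a way that the rows of `P`, and the `K` rows below them, are
free of obstacles at the end. -/
def Ready (σ : List Dir) (P : Finset Cell) : Prop :=
  ∀ K : ℕ, ∃ (W : Finset Cell) (c : Config) (t : Cell), IsInitial W c ∧ IsRun W c σ (place P t) ∧
    ∀ w ∈ W, (∀ p ∈ P, w.2 + K < p.2 + t.2) ∨ (∀ p ∈ P, p.2 + t.2 < w.2)

theorem exists_bound {S : Set Cell} (hS : S.Finite) :
    ∃ N : ℕ, ∀ p ∈ S, -(N : ℤ) ≤ p.1 ∧ p.1 ≤ N ∧ -(N : ℤ) ≤ p.2 ∧ p.2 ≤ N := by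
  refine ⟨∑ p ∈ hS.toFinset, (p.1.natAbs + p.2.natAbs), fun p hp => ?_⟩
  have := Finset.single_le_sum (f := fun p : Cell => p.1.natAbs + p.2.natAbs)
    (fun _ _ => Nat.zero_le _) (hS.mem_toFinset.2 hp)
  omega

/-- With an empty second piece, carrying an assembly along becomes a special case of merging. -/
theorem ready_empty (σ : List Dir) : Ready σ ∅ := by
  intro K
  have he : place ∅ 0 = fun _ => none := by funext q; simp [place]
  refine ⟨∅, fun _ => none, 0, ⟨by simp, by simp, ?_⟩, ?_, by simp⟩
  · rintro p q ⟨_, u, _, hu, _⟩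
    simp at hu
  · rw [he]
    induction σ with
    | nil => rfl
    | cons d σ ih => exact ⟨_, ⟨⟨0, rfl⟩, by simp⟩, ih⟩

theorem Ready.flipX {σ : List Dir} {P : Finset Cell} (h : Ready σ P) :
    Ready (σ.map flipXDir) (P.map flipX.toEmbedding) := by
  intro K
  obtain ⟨W, c, t, hi, hr, hw⟩ := h K
  have hs := isSym_flipX
  refine ⟨W.map TiltAssembly.flipX.toEmbedding, c ∘ TiltAssembly.flipX, TiltAssembly.flipX t,
    hs.isInitial hi, hs.place_comp P t ▸ hs.isRun hr, ?_⟩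
  intro w hwW
  rw [hs.mem_map] at hwW
  refine (hw _ hwW).imp (fun h p hp => ?_) (fun h p hp => ?_) <;>
  · rw [hs.mem_map] at hp
    simpa using h _ hp

theorem apart_of_lt {R S : Set Cell} {x : ℤ} (hR : ∀ p ∈ R, p.1 ≤ x) (hS : ∀ q ∈ S, x + 1 < q.1) :
    Apart R S := by
  intro p hp q hq
  have h1 := hR p hp
  have h2 := hS q hq
  refine ⟨fun h => by rw [h] at h1; omega, fun h => ?_⟩
  rw [adj_iff] at h
  omega

theorem IsRun.addRight {W : Finset Cell} {c c' : Config} {σ : List Dir} (h : IsRun W c σ c')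
    (t : Cell) : IsRun (W.map (Equiv.addRight t).toEmbedding) (fun q => c (q - t)) σ
      (fun q => c' (q - t)) := by
  have := IsRun.comp (carries_addRight (-t)) (W := W.map (Equiv.addRight t).toEmbedding) (W' := W)
    (fun p => by simp [Finset.mem_map_equiv]) (σ := σ) (c := c) (c' := c')
    (by simpa using h)
  simpa [Function.comp_def, sub_eq_add_neg] using this

theorem IsInitial.addRight {W : Finset Cell} {c : Config} (h : IsInitial W c) (t : Cell) :
    IsInitial (W.map (Equiv.addRight t).toEmbedding) (fun q => c (q - t)) := by
  have := IsInitial.comp (carries_addRight (-t)) (W := W.map (Equiv.addRight t).toEmbedding)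
    (W' := W) (fun p => by simp [Finset.mem_map_equiv]) h
  simpa [Function.comp_def, sub_eq_add_neg] using this

theorem place_addRight (P : Finset Cell) (t u : Cell) :
    (fun q => place P t (q - u)) = place P (t + u) := by
  funext q; simp only [place, sub_sub, add_comm t u]

theorem IsRunWithin.comp {e : Cell ≃ Cell} {δ : Dir → Dir} (h : Carries e δ) {W W' : Finset Cell}
    (hW : ∀ p, e p ∈ W' ↔ p ∈ W) {R : Set Cell} {σ : List Dir} {c c' : Config}
    (hr : IsRunWithin R W' c (σ.map δ) c') : IsRunWithin (e ⁻¹' R) W (c ∘ e) σ (c' ∘ e) := by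
  induction σ generalizing c with
  | nil => exact ⟨congrArg (· ∘ e) hr.1, fun p hp => hr.2 _ hp⟩
  | cons d σ ih =>
    obtain ⟨n, h1, h2, h3⟩ := hr
    have hit := fun k => iterate_advance_comp h hW (d := d) (c := c) k
    refine ⟨n, ?_, ?_, ?_⟩
    · rw [hit]
      exact fun p hp => (blocked_comp h hW).2 (h1 _ hp)
    · intro k p hp
      rw [hit] at hp
      exact h2 k _ hp
    · rw [hit]
      exact ih h3

/-- Two workspaces can be put side by side, in prescribed rows. -/
theorem exists_join {W₁ W₂ : Finset Cell} {c₁ c₂ c₁' c₂' : Config} {σ : List Dir}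
    (i₁ : IsInitial W₁ c₁) (r₁ : IsRun W₁ c₁ σ c₁') (i₂ : IsInitial W₂ c₂)
    (r₂ : IsRun W₂ c₂ σ c₂') (y X₀ : ℤ) :
    ∃ (x X : ℤ) (R₁ R₂ : Set Cell) (c : Config), X₀ < x ∧ R₁.Finite ∧ R₂.Finite ∧
      (∀ p ∈ R₁, p.1 ≤ X) ∧ (∀ p ∈ R₂, X + 1 < p.1) ∧ (W₁ : Set Cell) ⊆ R₁ ∧
      (W₂.map (Equiv.addRight (x, y)).toEmbedding : Set Cell) ⊆ R₂ ∧ Within R₁ c₁' ∧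
      Within R₂ (fun q => c₂' (q - (x, y))) ∧
      IsInitial (W₁ ∪ W₂.map (Equiv.addRight (x, y)).toEmbedding) c ∧
      IsRunWithin (R₁ ∪ R₂) (W₁ ∪ W₂.map (Equiv.addRight (x, y)).toEmbedding) c σ
        (join c₁' (fun q => c₂' (q - (x, y)))) := by
  obtain ⟨S₁, f₁, s₁⟩ := r₁.exists_within i₁.1
  obtain ⟨S₂, f₂, s₂⟩ := r₂.exists_within i₂.1
  obtain ⟨N₁, h₁⟩ := exists_bound (f₁.union W₁.finite_toSet)
  obtain ⟨N₂, h₂⟩ := exists_bound (f₂.union W₂.finite_toSet)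
  -- The second region then starts at column `N₁ + 2` or later, leaving a free column behind the
  -- first.
  set x : ℤ := N₁ + N₂ + |X₀| + 2
  have hx : X₀ < x := by have := le_abs_self X₀; omega
  have hx' : (N₁ : ℤ) + N₂ + 2 ≤ x := by have := abs_nonneg X₀; omega
  have i₂' := i₂.addRight (x, y)
  have r₂' := r₂.addRight (x, y)
  set W₂' := W₂.map (Equiv.addRight (x, y)).toEmbedding
  have hW₂' : ∀ p, p ∈ W₂' ↔ p - (x, y) ∈ W₂ := by
    intro p; simp [W₂', Finset.mem_map_equiv, sub_eq_add_neg]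
  have hrange : ∀ q, q - (x, y) ∈ S₂ ∪ (W₂ : Set Cell) → (N₁ : ℤ) + 1 < q.1 := by
    intro q hq
    have := (h₂ _ hq).1
    simp only [Prod.fst_sub] at this
    omega
  -- the translated run stays in the translated region
  have s₂' : IsRunWithin {q | q - (x, y) ∈ S₂} W₂' (fun q => c₂ (q - (x, y))) σ
      (fun q => c₂' (q - (x, y))) := by
    have := IsRunWithin.comp (carries_addRight (-(x, y))) (W := W₂') (W' := W₂)
      (fun p => by rw [hW₂']; simp [sub_eq_add_neg]) (σ := σ) (by simpa using s₂)
    simpa [Function.comp_def, sub_eq_add_neg, Set.preimage] using this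
  have hap : Apart (S₁ ∪ (W₁ : Set Cell)) ({q | q - (x, y) ∈ S₂} ∪ (W₂' : Set Cell)) :=
    apart_of_lt (x := N₁) (fun p hp => (h₁ p hp).2.1) (by
      rintro q (hq | hq)
      · exact hrange q (Or.inl hq)
      · exact hrange q (Or.inr ((hW₂' q).1 hq)))
  have t₁ := s₁.mono (Set.subset_union_left (t := (W₁ : Set Cell)))
  have t₂ := s₂'.mono (Set.subset_union_left (t := (W₂' : Set Cell)))
  refine ⟨x, N₁, S₁ ∪ W₁, {q | q - (x, y) ∈ S₂} ∪ W₂', _, hx, f₁.union W₁.finite_toSet, ?_,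
    fun p hp => (h₁ p hp).2.1, ?_, Set.subset_union_right, Set.subset_union_right,
    t₁.within_end, t₂.within_end,
    IsInitial.join hap t₁.within_start t₂.within_start Set.subset_union_right
      Set.subset_union_right i₁ i₂',
    IsRunWithin.join hap Set.subset_union_right Set.subset_union_right t₁ t₂⟩
  · refine Set.Finite.union ?_ W₂'.finite_toSet
    exact f₂.preimage (f := fun q => q - (x, y)) (sub_left_injective.injOn)
  · rintro q (hq | hq)
    · exact hrange q (Or.inl hq)
    · exact hrange q (Or.inr ((hW₂' q).1 hq))

theorem join_none (c : Config) : join c (fun _ => none) = c := by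
  funext p; simp [join]

theorem isRunWithin_none {R : Set Cell} {W : Finset Cell} (σ : List Dir) :
    IsRunWithin R W (fun _ => none) σ (fun _ => none) := by
  have hs : ∀ d p, ((fun _ => none : Config) p).isSome → Blocked W d (fun _ => none) p := by simp
  induction σ with
  | nil => exact ⟨rfl, fun p hp => by simp at hp⟩
  | cons d σ ih =>
    refine ⟨0, hs d, fun k => ?_, ih⟩
    rw [iterate_advance_of_stable (hs d)]
    intro p hp
    simp at hp

theorem isInitial_none (W : Finset Cell) : IsInitial W (fun _ => none) := by
  refine ⟨by simp, by simp, ?_⟩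
  rintro p q ⟨_, u, _, hu, _⟩
  simp at hu

/-- `A` comes to rest at the left and `B` joins it from the right. Then the whole assembly leaves
the obstacles behind. -/
theorem Ready.merge {σ : List Dir} {A B : Finset Cell} (rA : Ready σ A) (rB : Ready σ B)
    (hA : IsPolyomino A) (hP : IsPolyomino (A ∪ B)) (hdisj : Disjoint A B)
    (hpull : CanPullApart Dir.right A B) (htop : ∃ a ∈ A, ∀ p ∈ A ∪ B, p.2 ≤ a.2) :
    Ready ((σ ++ [Dir.left, Dir.down, Dir.right]).map diagDir)
      ((A ∪ B).map diag.toEmbedding) := by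
  intro K
  -- distinguished tiles of `P`
  obtain ⟨a₁, ha₁, hmax⟩ := htop
  -- The obstacle that stops the step to the left will stand beside the leftmost tile of `A` in the
  -- top row. Being in the top row, it cannot be hit when the assembly moves down afterwards.
  obtain ⟨a₀, ha₀, hleft⟩ := Finset.exists_min_image (A.filter fun a => a.2 = a₁.2) Prod.fst
    ⟨a₁, by simp [ha₁]⟩
  simp only [Finset.mem_filter] at ha₀ hleft
  obtain ⟨ha₀, ha₀₁⟩ := ha₀
  rw [← ha₀₁] at hmax hleft
  clear ha₁ ha₀₁ a₁
  obtain ⟨pb, hpb, hbot⟩ := Finset.exists_min_image (A ∪ B) Prod.snd hP.nonempty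
  obtain ⟨pr, hpr, hright⟩ := Finset.exists_max_image (A ∪ B) Prod.fst hP.nonempty
  obtain ⟨NP, hNP⟩ := exists_bound (A ∪ B).finite_toSet
  -- the two workspaces side by side
  obtain ⟨W₁, c₁, tA, i₁, r₁, hW₁⟩ := rA (2 * NP)
  obtain ⟨W₂, c₂, tB₀, i₂, r₂, hW₂⟩ := rB 0
  obtain ⟨x, X, R₁, R₂, c, hx, f₁, f₂, hR₁, hR₂, hWR₁, hWR₂, w₁, w₂, hi, hr⟩ :=
    exists_join i₁ r₁ i₂ r₂ (tA.2 - tB₀.2) (tA.1 - tB₀.1)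
  set tB : Cell := tB₀ + (x, tA.2 - tB₀.2) with htB
  have htB1 : tA.1 < tB.1 := by simp [htB]; omega
  have htB2 : tB.2 = tA.2 := by simp [htB]
  rw [place_addRight, ← htB] at w₂ hr
  set W₂' := W₂.map (Equiv.addRight (x, tA.2 - tB₀.2)).toEmbedding with hW₂'
  have hW₂r : ∀ w ∈ W₂', ∀ b ∈ B, w.2 ≠ b.2 + tA.2 := by
    intro w hw b hb
    rw [hW₂', Finset.mem_map_equiv] at hw
    have h := hW₂ _ hw
    simp only [Equiv.addRight_symm, Equiv.coe_addRight, Prod.snd_add, Prod.snd_neg] at h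
    rcases h with h | h <;> have := h b hb <;> push_cast at this <;> omega
  have hA₁ : ∀ a ∈ A, a + tA ∈ R₁ := fun a ha => w₁ _ (by simp [place, ha])
  have hB₂ : ∀ b ∈ B, b + tB ∈ R₂ := fun b hb => w₂ _ (by simp [place, hb])
  obtain ⟨N, hN⟩ := exists_bound ((f₁.union f₂).union
    ((A ∪ B).finite_toSet.union (Set.toFinite {tA, tB})))
  have hNR : ∀ p ∈ R₁ ∪ R₂, -(N : ℤ) ≤ p.1 ∧ p.1 ≤ N := fun p hp =>
    ⟨(hN p (Or.inl hp)).1, (hN p (Or.inl hp)).2.1⟩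
  have hNR2 : ∀ p ∈ R₁ ∪ R₂, -(N : ℤ) ≤ p.2 ∧ p.2 ≤ N := fun p hp =>
    (hN p (Or.inl hp)).2.2
  have hNP' : ∀ p ∈ A ∪ B, -(N : ℤ) ≤ p.1 ∧ p.1 ≤ N ∧ -(N : ℤ) ≤ p.2 ∧ p.2 ≤ N := fun p hp =>
    hN p (Or.inr (Or.inl hp))
  have hNtA := hN tA (Or.inr (Or.inr (by simp)))
  have hNtB := hN tB (Or.inr (Or.inr (by simp)))
  clear hN
  -- With this distance the steps left and down leave both workspaces, and the step right over `2 *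
  -- L` ends more than `K` columns beyond them.
  set L : ℕ := 10 * N + 10 + K with hL
  set t₁ : Cell := (-(L : ℤ), tA.2) with ht₁
  set t₂ : Cell := (-(L : ℤ), tA.2 - L) with ht₂
  set t₃ : Cell := ((L : ℤ), tA.2 - L) with ht₃
  set O : Finset Cell := {a₀ + t₁ + Dir.left.vec, pb + t₂ + Dir.down.vec,
    pr + t₃ + Dir.right.vec} with hO
  have memO : ∀ w ∈ O, (w.1 = a₀.1 - L - 1 ∧ w.2 = a₀.2 + tA.2) ∨
      (w.1 = pb.1 - L ∧ w.2 = pb.2 + tA.2 - L - 1) ∨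
      (w.1 = pr.1 + L + 1 ∧ w.2 = pr.2 + tA.2 - L) := by
    intro w hw
    simp only [hO, Finset.mem_insert, Finset.mem_singleton, ht₁, ht₂, ht₃, Dir.vec] at hw
    rcases hw with rfl | rfl | rfl <;> simp <;> omega
  have ba := hNP' a₀ (Finset.mem_union_left _ ha₀)
  have bb := hNP' pb hpb
  have br := hNP' pr hpr
  have hap : Apart (R₁ ∪ R₂) (O : Set Cell) := by
    intro p hp q hq
    have h1 := hNR p hp
    have h2 := memO q hq
    refine ⟨?_, ?_⟩
    · rintro rfl; omega
    · rw [adj_iff]; omega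
  have hrun := IsRunWithin.join hap (Set.union_subset_union hWR₁ hWR₂ |> fun h => by
    simpa using h) subset_rfl hr (isRunWithin_none σ)
  have hini := IsInitial.join hap hr.within_start (isRunWithin_none (R := (O : Set Cell)) (W := O) σ).within_start
    (Set.union_subset_union hWR₁ hWR₂ |> fun h => by simpa using h) subset_rfl hi
    (isInitial_none O)
  rw [join_none] at hini
  rw [join_none, join_none] at hrun
  set W := W₁ ∪ W₂' ∪ O with hW
  have memW : ∀ w ∈ W, w ∈ W₁ ∨ w ∈ W₂' ∨ w ∈ O := by
    intro w hw
    simpa [hW, or_assoc] using hw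
  have rep : Rep (join (place A tA) (place B tB)) (fun p : ↥(A ∪ B) => (p : Cell) + t₁ +
      (if (p : Cell) ∈ A then (tA.1 + L).toNat else (tB.1 + L).toNat) • Dir.right.vec)
      (fun p => tileColour p) := by
    have e : (fun p : ↥(A ∪ B) => (p : Cell) + t₁ +
        (if (p : Cell) ∈ A then (tA.1 + L).toNat else (tB.1 + L).toNat) • Dir.right.vec) =
        fun p : ↥(A ∪ B) => (p : Cell) + if (p : Cell) ∈ A then tA else tB := by
      funext p
      split_ifs with h <;> ext <;> simp [Dir.vec, ht₁] <;> omega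
    rw [e]
    have memB : ∀ p : ↥(A ∪ B), (p : Cell) ∉ A → (p : Cell) ∈ B := fun p hp =>
      (Finset.mem_union.1 p.2).resolve_left hp
    have key : ∀ a ∈ A, ∀ b ∈ B, a + tA ≠ b + tB := by
      intro a ha b hb hab
      have h1 := hR₁ _ (hA₁ a ha)
      have h2 := hR₂ _ (hB₂ b hb)
      rw [hab] at h1
      omega
    refine ⟨?_, ?_, ?_⟩
    · intro p q hpq
      by_cases hp : (p : Cell) ∈ A <;> by_cases hq : (q : Cell) ∈ A <;>
        simp only [hp, hq, if_true, if_false] at hpq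
      · exact Subtype.ext (add_right_cancel hpq)
      · exact absurd hpq (key _ hp _ (memB q hq))
      · exact absurd hpq.symm (key _ hq _ (memB p hp))
      · exact Subtype.ext (add_right_cancel hpq)
    · intro p
      by_cases hp : (p : Cell) ∈ A
      · simp [join, place, hp]
      · have hb := memB p hp
        have : (p : Cell) + tB - tA ∉ A := fun h => key _ h _ hb (by simp)
        simp [join, place, hp, hb, this]
    · intro q hq
      rcases join_isSome.1 hq with h | h
      · have h' : q - tA ∈ A := by
          by_contra hn
          simp [place, hn] at h
        exact ⟨⟨_, Finset.mem_union_left _ h'⟩, by simp [h']⟩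
      · have h' : q - tB ∈ B := by
          by_contra hn
          simp [place, hn] at h
        have hn : q - tB ∉ A := fun hA' => Finset.disjoint_left.1 hdisj hA' h'
        exact ⟨⟨_, Finset.mem_union_right _ h'⟩, by simp [hn]⟩
  have m₁ : IsMove W Dir.left (join (place A tA) (place B tB)) (place (A ∪ B) t₁) := by
    refine merge_isMove hA hP hpull (by omega) rep ?_ ?_ ⟨a₀, ha₀, by simp [hW, hO]⟩
    · intro a ha s hs hw
      have hs' : (s : ℤ) + 1 ≤ tA.1 + L := by omega
      have e1 : (a + t₁ + (((tA.1 + L).toNat : ℤ) - s - 1) • Dir.right.vec).1 =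
          a.1 + tA.1 - s - 1 := by
        simp [Dir.vec, ht₁]; omega
      have e2 : (a + t₁ + (((tA.1 + L).toNat : ℤ) - s - 1) • Dir.right.vec).2 =
          a.2 + tA.2 := by
        simp [Dir.vec, ht₁]
      have b := hNP' a (Finset.mem_union_left _ ha)
      generalize a + t₁ + (((tA.1 + L).toNat : ℤ) - s - 1) • Dir.right.vec = w at hw e1 e2
      rcases memW w hw with h | h | h
      · rcases hW₁ w h with h | h <;> have := h a ha <;> push_cast at this <;> omega
      · have h1 := hR₂ w (hWR₂ h)
        have h2 := hR₁ _ (hA₁ a ha)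
        simp only [Prod.fst_add] at h2
        omega
      · rcases memO w h with h | h | h
        · have := hleft a ⟨ha, by omega⟩
          omega
        · omega
        · omega
    · intro a ha s hs hw
      have hs' : (s : ℤ) + 1 ≤ tB.1 + L := by omega
      have e1 : (a + t₁ + (((tB.1 + L).toNat : ℤ) - s - 1) • Dir.right.vec).1 =
          a.1 + tB.1 - s - 1 := by
        simp [Dir.vec, ht₁]; omega
      have e2 : (a + t₁ + (((tB.1 + L).toNat : ℤ) - s - 1) • Dir.right.vec).2 =
          a.2 + tA.2 := by
        simp [Dir.vec, ht₁]
      have b := hNP' a (Finset.mem_union_right _ ha)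
      generalize a + t₁ + (((tB.1 + L).toNat : ℤ) - s - 1) • Dir.right.vec = w at hw e1 e2
      rcases memW w hw with h | h | h
      · have c1 := hNP a (Finset.mem_coe.2 (Finset.mem_union_right _ ha))
        have c2 := hNP a₀ (Finset.mem_coe.2 (Finset.mem_union_left _ ha₀))
        have c3 := hmax a (Finset.mem_union_right _ ha)
        rcases hW₁ w h with h | h <;> have := h a₀ ha₀ <;> push_cast at this <;> omega
      · exact hW₂r w h a ha e2
      · rcases memO w h with h | h | h
        -- A tile of `B` to the left of `a₀` in the same row would be hit by `a₀` when the pieces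
        -- are pulled apart.
        · refine (hpull (a₀.1 - a.1).toNat (by omega) a₀ ha₀ a ha).1 ?_
          ext <;> simp [Dir.vec] <;> omega
        · omega
        · omega
  have m₂ : IsMove W Dir.down (place (A ∪ B) t₁) (place (A ∪ B) t₂) := by
    have e : t₂ = t₁ + L • Dir.down.vec := by ext <;> simp [ht₁, ht₂, Dir.vec]; ring
    rw [e]
    refine place_isMove hP ?_ ⟨pb, hpb, by rw [add_assoc pb, ← e]; simp [hW, hO]⟩
    intro p hp s hs hw
    have e1 : (p + t₁ + (s + 1) • Dir.down.vec).1 = p.1 - L := by simp [Dir.vec, ht₁]; ring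
    have e2 : (p + t₁ + (s + 1) • Dir.down.vec).2 = p.2 + tA.2 - s - 1 := by
      simp [Dir.vec, ht₁]; ring
    have b := hNP' p hp
    generalize p + t₁ + (s + 1) • Dir.down.vec = w at hw e1 e2
    rcases memW w hw with h | h | h
    · have := hNR w (Or.inl (hWR₁ h)); omega
    · have := hNR w (Or.inr (hWR₂ h)); omega
    · have := hmax p hp
      have := hbot p hp
      rcases memO w h with h | h | h <;> omega
  have m₃ : IsMove W Dir.right (place (A ∪ B) t₂) (place (A ∪ B) t₃) := by
    have e : t₃ = t₂ + (2 * L) • Dir.right.vec := by ext <;> simp [ht₂, ht₃, Dir.vec]; ring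
    rw [e]
    refine place_isMove hP ?_ ⟨pr, hpr, by rw [add_assoc pr, ← e]; simp [hW, hO]⟩
    intro p hp s hs hw
    have e1 : (p + t₂ + (s + 1) • Dir.right.vec).1 = p.1 - L + s + 1 := by
      simp [Dir.vec, ht₂]; ring
    have e2 : (p + t₂ + (s + 1) • Dir.right.vec).2 = p.2 + tA.2 - L := by
      simp [Dir.vec, ht₂]; ring
    have b := hNP' p hp
    generalize p + t₂ + (s + 1) • Dir.right.vec = w at hw e1 e2
    rcases memW w hw with h | h | h
    · have := hNR2 w (Or.inl (hWR₁ h)); omega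
    · have := hNR2 w (Or.inr (hWR₂ h)); omega
    · have := hbot p hp
      have := hright p hp
      rcases memO w h with h | h | h <;> omega
  have hfinal : IsRun W c (σ ++ [Dir.left, Dir.down, Dir.right]) (place (A ∪ B) t₃) :=
    hrun.isRun.append ⟨_, m₁, _, m₂, _, m₃, rfl⟩
  -- At the end the columns of the assembly, and `K` columns to their left, are free; the reflection
  -- in the diagonal turns them into rows.
  refine ⟨W.map diag.toEmbedding, c ∘ diag, diag t₃, isSym_diag.isInitial hini,
    isSym_diag.place_comp (A ∪ B) t₃ ▸ isSym_diag.isRun hfinal, ?_⟩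
  intro w hw
  rw [isSym_diag.mem_map] at hw
  have hgoal : (∀ p ∈ A ∪ B, w.2 + K < p.1 + t₃.1) ∨ (∀ p ∈ A ∪ B, p.1 + t₃.1 < w.2) := by
    rcases memW _ hw with h | h | h
    · refine Or.inl fun p hp => ?_
      have := hNR _ (Or.inl (hWR₁ h))
      have := hNP' p hp
      simp only [diag_apply, ht₃] at *; omega
    · refine Or.inl fun p hp => ?_
      have := hNR _ (Or.inr (hWR₂ h))
      have := hNP' p hp
      simp only [diag_apply, ht₃] at *; omega
    · rcases memO _ h with h | h | h
      · refine Or.inl fun p hp => ?_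
        have := hNP' p hp
        simp only [diag_apply, ht₃] at *; omega
      · refine Or.inl fun p hp => ?_
        have := hNP' p hp
        simp only [diag_apply, ht₃] at *; omega
      · refine Or.inr fun p hp => ?_
        have := hright p hp
        simp only [diag_apply, ht₃] at *; omega
  refine hgoal.imp (fun h p hp => ?_) (fun h p hp => ?_) <;>
  · rw [isSym_diag.mem_map] at hp
    simpa using h _ hp

/-- Pieces that wait must survive the same steps as those that merge: this is a merge with the empty
shape. -/
theorem Ready.transport {σ : List Dir} {P : Finset Cell} (h : Ready σ P) (hP : IsPolyomino P) :
    Ready ((σ ++ [Dir.left, Dir.down, Dir.right]).map diagDir) (P.map diag.toEmbedding) := by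
  obtain ⟨a, ha, hmax⟩ := Finset.exists_max_image P Prod.snd hP.nonempty
  have := h.merge (ready_empty σ) hP (by simpa using hP) (Finset.disjoint_empty_right _)
    (fun _ _ _ _ b hb => by simp at hb) ⟨a, ha, by simpa using hmax⟩
  simpa using this

/-! ### Symmetries of cuts -/

/-- The opposite direction. -/
def Dir.opp : Dir → Dir
  | .up => .down
  | .right => .left
  | .down => .up
  | .left => .right

theorem Dir.opp_vec (d : Dir) : d.opp.vec = -d.vec := by cases d <;> rfl

theorem adj_sub_comm {p q v : Cell} : gridGraph.Adj (p - v) q ↔ gridGraph.Adj p (q + v) := by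
  simp only [adj_iff, Prod.fst_add, Prod.snd_add, Prod.fst_sub, Prod.snd_sub]; omega

theorem IsStraightCut.symm {d : Dir} {A B : Finset Cell} (h : IsStraightCut d A B) :
    IsStraightCut d.opp B A := by
  intro b hb a ha hab
  rw [h a ha b hb hab.symm, Dir.opp_vec]; simp

theorem CanPullApart.symm {d : Dir} {A B : Finset Cell} (h : CanPullApart d A B) :
    CanPullApart d.opp B A := by
  intro k hk b hb a ha
  obtain ⟨h1, h2⟩ := h k hk a ha b hb
  rw [Dir.opp_vec, smul_neg, sub_neg_eq_add]
  refine ⟨fun he => h1 (by rw [← he]; simp), fun ha => (h2 ?_).symm⟩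
  rw [adj_sub_comm]
  exact ha.symm

theorem IsValidStraightTwoCut.symm {P A B : Finset Cell} (h : IsValidStraightTwoCut P A B) :
    IsValidStraightTwoCut P B A := by
  obtain ⟨⟨h1, h2, h3, h4, h5⟩, d, hs, hp⟩ := h
  exact ⟨⟨h1, by rw [Finset.union_comm, h2], h3.symm, h5, h4⟩, d.opp, hs.symm, hp.symm⟩

section Sym

variable {e : Cell ≃ Cell} {δ : Dir → Dir}

theorem IsSym.nsmul_vec (h : IsSym e δ) (p : Cell) (k : ℕ) (d : Dir) :
    e (p - k • d.vec) = e p - k • (δ d).vec := by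
  induction k generalizing p with
  | zero => simp
  | succ k ih =>
    have h1 : e (p - d.vec) = e p - (δ d).vec := by
      rw [eq_sub_iff_add_eq, ← h.vec, sub_add_cancel]
    rw [succ_nsmul', succ_nsmul', ← sub_sub, ih, h1, sub_sub]

theorem IsStraightCut.map (h : IsSym e δ) {d : Dir} {A B : Finset Cell} (hc : IsStraightCut d A B) :
    IsStraightCut (δ d) (A.map e.toEmbedding) (B.map e.toEmbedding) := by
  intro a ha b hb hab
  rw [h.mem_map] at ha hb
  have := hc _ ha _ hb ((h.adj a b).2 hab)
  apply e.injective
  rw [this, h.vec, h.dir]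

theorem CanPullApart.map (h : IsSym e δ) {d : Dir} {A B : Finset Cell} (hc : CanPullApart d A B) :
    CanPullApart (δ d) (A.map e.toEmbedding) (B.map e.toEmbedding) := by
  intro k hk a ha b hb
  rw [h.mem_map] at ha hb
  obtain ⟨h1, h2⟩ := hc k hk _ ha _ hb
  have hv : e a - k • d.vec = e (a - k • (δ d).vec) := by rw [h.nsmul_vec, h.dir]
  rw [hv] at h1 h2
  rw [h.adj, h.colour, h.colour] at h2
  exact ⟨fun he => h1 (by rw [he]), h2⟩

theorem IsTwoCut.map (h : IsSym e δ) {P A B : Finset Cell} (hc : IsTwoCut P A B) :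
    IsTwoCut (P.map e.toEmbedding) (A.map e.toEmbedding) (B.map e.toEmbedding) where
  polyomino := h.isPolyomino hc.polyomino
  union := by rw [← Finset.map_union, hc.union]
  disjoint := (Finset.disjoint_map _).2 hc.disjoint
  left := h.isPolyomino hc.left
  right := h.isPolyomino hc.right

theorem IsValidStraightTwoCut.map (h : IsSym e δ) {P A B : Finset Cell}
    (hc : IsValidStraightTwoCut P A B) :
    IsValidStraightTwoCut (P.map e.toEmbedding) (A.map e.toEmbedding) (B.map e.toEmbedding) := by
  obtain ⟨h1, d, h2, h3⟩ := hc
  exact ⟨h1.map h, δ d, h2.map h, h3.map h⟩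

end Sym

/-! ### One level of a hierarchical construction -/

/-- After the merge it is columns that are free. A transport in the reflected orientation makes the
rows free again, which gives the last three steps. -/
theorem Ready.mergeLeft {σ : List Dir} {A B : Finset Cell} (rA : Ready σ A) (rB : Ready σ B)
    (hA : IsPolyomino A) (hP : IsPolyomino (A ∪ B)) (hdisj : Disjoint A B)
    (hpull : CanPullApart Dir.right A B) (htop : ∃ a ∈ A, ∀ p ∈ A ∪ B, p.2 ≤ a.2) :
    Ready (σ ++ [.left, .down, .right, .down, .left, .up]) (A ∪ B) := by
  have := (rA.merge rB hA hP hdisj hpull htop).transport (isSym_diag.isPolyomino hP)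
  rw [isSym_diag.map_map, List.map_append, isSym_diag.map_dir] at this
  simpa [diagDir] using this

theorem Ready.cycle {σ : List Dir} {P : Finset Cell} (h : Ready σ P) (hP : IsPolyomino P) :
    Ready (σ ++ [.left, .down, .right, .down, .left, .up]) P := by
  have := (h.transport hP).transport (isSym_diag.isPolyomino hP)
  rw [isSym_diag.map_map, List.map_append, isSym_diag.map_dir] at this
  simpa [diagDir] using this

theorem Ready.of_flipX {σ τ : List Dir} {P : Finset Cell}
    (h : Ready (σ.map flipXDir ++ τ) (P.map TiltAssembly.flipX.toEmbedding)) :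
    Ready (σ ++ τ.map flipXDir) P := by
  have := h.flipX
  rwa [isSym_flipX.map_map, List.map_append, isSym_flipX.map_dir] at this

/-- The steps that merge pieces along a cut with vertical segments. -/
def horizontalSteps : List Dir :=
  [.left, .down, .right, .down, .left, .up] ++ [.right, .down, .left, .down, .right, .up]

theorem Ready.horizontalSteps {σ : List Dir} {P : Finset Cell} (h : Ready σ P)
    (hP : IsPolyomino P) : Ready (σ ++ horizontalSteps) P := by
  have := ((h.cycle hP).flipX.cycle (isSym_flipX.isPolyomino hP)).of_flipX
  rwa [List.append_assoc] at this

/-- `Ready.mergeLeft` wants a topmost tile in the piece that rests at the left. If `A` has one, the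
first six steps merge and the last six only carry; otherwise the first six carry, and the reflected
last six merge with `B` in the role of the resting piece. -/
theorem Ready.horizontalCut {σ : List Dir} {P A B : Finset Cell} (rA : Ready σ A) (rB : Ready σ B)
    (hc : IsTwoCut P A B) (hpull : CanPullApart Dir.right A B) :
    Ready (σ ++ TiltAssembly.horizontalSteps) P := by
  obtain ⟨hP, rfl, hdisj, hA, hB⟩ := hc
  obtain ⟨a, ha, hmax⟩ := Finset.exists_max_image (A ∪ B) Prod.snd hP.nonempty
  by_cases haA : a ∈ A
  · have h1 := rA.mergeLeft rB hA hP hdisj hpull ⟨a, haA, hmax⟩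
    have := (h1.flipX.cycle (isSym_flipX.isPolyomino hP)).of_flipX
    rwa [List.append_assoc] at this
  · have haB : a ∈ B := (Finset.mem_union.1 ha).resolve_left haA
    have fA := (rA.cycle hA).flipX
    have fB := (rB.cycle hB).flipX
    have hmem : ∀ p, p ∈ B.map TiltAssembly.flipX.toEmbedding ∪ A.map TiltAssembly.flipX.toEmbedding ↔
        TiltAssembly.flipX p ∈ A ∪ B := by
      intro p
      rw [Finset.mem_union, isSym_flipX.mem_map, isSym_flipX.mem_map, Finset.mem_union, or_comm]
    have hPm : B.map TiltAssembly.flipX.toEmbedding ∪ A.map TiltAssembly.flipX.toEmbedding =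
        (A ∪ B).map TiltAssembly.flipX.toEmbedding := by
      ext p; rw [hmem, isSym_flipX.mem_map]
    have h1 := fB.mergeLeft fA (isSym_flipX.isPolyomino hB)
      (by rw [hPm]; exact isSym_flipX.isPolyomino hP)
      ((Finset.disjoint_map _).2 hdisj.symm) (hpull.symm.map isSym_flipX)
      ⟨TiltAssembly.flipX a, by rwa [isSym_flipX.mem_map, isSym_flipX.apply_apply],
        fun p hp => by simpa using hmax _ ((hmem p).1 hp)⟩
    rw [hPm] at h1
    have := h1.of_flipX
    rwa [List.append_assoc] at this

/-- The steps that merge pieces along an arbitrary cut. -/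
def levelSteps : List Dir :=
  horizontalSteps ++ [.left, .down, .right] ++ horizontalSteps.map diagDir ++ [.down, .left, .up]

theorem Ready.of_diag {σ : List Dir} {P : Finset Cell} (hP : IsPolyomino P)
    (h : Ready ((σ ++ TiltAssembly.horizontalSteps ++ [Dir.left, .down, .right]).map diagDir ++
      TiltAssembly.horizontalSteps) (P.map diag.toEmbedding)) : Ready (σ ++ levelSteps) P := by
  have := h.transport (isSym_diag.isPolyomino hP)
  rw [isSym_diag.map_map, List.append_assoc, List.map_append, isSym_diag.map_dir] at this
  simpa [levelSteps, diagDir] using this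

theorem Ready.levelSteps {σ : List Dir} {P : Finset Cell} (h : Ready σ P)
    (hP : IsPolyomino P) : Ready (σ ++ levelSteps) P :=
  (((h.horizontalSteps hP).transport hP).horizontalSteps (isSym_diag.isPolyomino hP)).of_diag hP

/-- One sequence serves all four directions: cuts with vertical segments are undone in the first
`horizontalSteps`, cuts with horizontal segments in the copy reflected in the diagonal, and opposite
directions exchange `A` and `B`. -/
theorem Ready.cut {σ : List Dir} {P A B : Finset Cell} (rA : Ready σ A) (rB : Ready σ B)
    (hc : IsValidStraightTwoCut P A B) : Ready (σ ++ TiltAssembly.levelSteps) P := by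
  have hor : ∀ {A B : Finset Cell}, Ready σ A → Ready σ B → IsTwoCut P A B →
      CanPullApart Dir.right A B → Ready (σ ++ TiltAssembly.levelSteps) P := by
    intro A B rA rB hc hp
    exact ((((rA.horizontalCut rB hc hp).transport hc.polyomino).horizontalSteps
      (isSym_diag.isPolyomino hc.polyomino))).of_diag hc.polyomino
  have ver : ∀ {A B : Finset Cell}, Ready σ A → Ready σ B → IsTwoCut P A B →
      CanPullApart Dir.up A B → Ready (σ ++ TiltAssembly.levelSteps) P := by
    intro A B rA rB hc hp
    exact (((rA.horizontalSteps hc.left).transport hc.left).horizontalCut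
      ((rB.horizontalSteps hc.right).transport hc.right) (hc.map isSym_diag)
      (hp.map isSym_diag)).of_diag hc.polyomino
  obtain ⟨hc', d, -, hp⟩ := hc
  have hc'' : IsTwoCut P B A := ⟨hc'.polyomino, by rw [Finset.union_comm, hc'.union],
    hc'.disjoint.symm, hc'.right, hc'.left⟩
  cases d with
  | right => exact hor rA rB hc' hp
  | up => exact ver rA rB hc' hp
  | left => exact hor rB rA hc'' hp.symm
  | down => exact ver rB rA hc'' hp.symm

/-! ### Rectangles -/

theorem exists_rep {ι : Type} {pos : ι → Cell} (h : Function.Injective pos) (col : ι → Colour) :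
    ∃ c, Rep c pos col := by
  classical
  refine ⟨fun q => if hq : ∃ i, pos i = q then some (col hq.choose) else none, h, ?_, ?_⟩
  · intro i
    have hi : ∃ j, pos j = pos i := ⟨i, rfl⟩
    simp only [hi, dif_pos]
    rw [h hi.choose_spec]
  · intro q hq
    by_cases hq' : ∃ i, pos i = q
    · exact ⟨hq'.choose, hq'.choose_spec.symm⟩
    · simp [hq'] at hq

/-- The rectangle with columns `x₁, …, x₂` and rows `y₁, …, y₂`. -/
noncomputable def rect (x₁ x₂ y₁ y₂ : ℤ) : Finset Cell := Finset.Icc x₁ x₂ ×ˢ Finset.Icc y₁ y₂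

theorem mem_rect {x₁ x₂ y₁ y₂ : ℤ} {p : Cell} :
    p ∈ rect x₁ x₂ y₁ y₂ ↔ (x₁ ≤ p.1 ∧ p.1 ≤ x₂) ∧ (y₁ ≤ p.2 ∧ p.2 ≤ y₂) := by
  simp [rect]

theorem Rep.isInitial {ι : Type} [Finite ι] {c : Config} {pos : ι → Cell} {col : ι → Colour}
    (h : Rep c pos col) {W : Finset Cell} (hW : ∀ i, pos i ∉ W)
    (hadj : ∀ i j, ¬ gridGraph.Adj (pos i) (pos j)) : IsInitial W c := by
  refine ⟨(Set.finite_range pos).subset fun q hq => ?_, fun w hw => ?_, ?_⟩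
  · obtain ⟨i, rfl⟩ := h.surj q hq
    exact ⟨i, rfl⟩
  · by_contra hn
    obtain ⟨i, rfl⟩ := h.surj w (Option.isSome_iff_ne_none.2 hn)
    exact hW i hw
  · rintro p q ⟨ha, u, v, hu, hv, -⟩
    obtain ⟨i, rfl⟩ := h.surj p (by simp [hu])
    obtain ⟨j, rfl⟩ := h.surj q (by simp [hv])
    exact hadj i j ha

/-- The tiles start on a lattice of mesh two, so none stick. The step to the right closes up each
row against its own obstacle while the rows stay two apart; the step up then stacks the rows under
one obstacle above the right end of the top row. -/
theorem ready_rect (x₁ x₂ y₁ y₂ : ℤ) : Ready [.right, .up] (rect x₁ x₂ y₁ y₂) := by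
  intro K
  set P := rect x₁ x₂ y₁ y₂ with hP
  have memP : ∀ p : P, (x₁ ≤ (p : Cell).1 ∧ (p : Cell).1 ≤ x₂) ∧
      (y₁ ≤ (p : Cell).2 ∧ (p : Cell).2 ≤ y₂) := fun p => mem_rect.1 p.2
  -- The first condition puts the finished rectangle more than `K` rows above the row obstacles; the
  -- second makes every upward distance `Y - y` positive.
  obtain ⟨Y, hY, hY'⟩ : ∃ Y : ℤ, 2 * y₂ + K < y₁ + Y ∧ y₂ < Y :=
    ⟨max (2 * y₂ + K - y₁) y₂ + 1, by omega, by omega⟩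
  set O : Finset Cell := (Finset.Icc y₁ y₂).image (fun y => (2 * x₂ + 1, 2 * y)) with hO
  set W : Finset Cell := insert (2 * x₂, y₂ + Y + 1) O with hW
  have memW : ∀ w ∈ W, (w.1 = 2 * x₂ ∧ w.2 = y₂ + Y + 1) ∨
      (w.1 = 2 * x₂ + 1 ∧ ∃ y, y₁ ≤ y ∧ y ≤ y₂ ∧ w.2 = 2 * y) := by
    intro w hw
    simp only [hW, hO, Finset.mem_insert, Finset.mem_image, Finset.mem_Icc] at hw
    rcases hw with rfl | ⟨y, hy, rfl⟩
    · simp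
    · exact Or.inr ⟨rfl, y, hy.1, hy.2, rfl⟩
  obtain ⟨c, hc⟩ := exists_rep (pos := fun p : P => ((2 * (p : Cell).1, 2 * (p : Cell).2) : Cell))
    (fun p q h => by
      simp only [Prod.mk.injEq] at h
      exact Subtype.ext (Prod.ext (by omega) (by omega))) (fun p => tileColour p)
  have hini : IsInitial W c := by
    refine hc.isInitial ?_ ?_
    · intro p hp
      have := memP p
      rcases memW _ hp with ⟨h1, h2⟩ | ⟨h1, h2⟩ <;> simp only at h1 h2 <;> omega
    · intro p q h
      rw [adj_iff] at h
      simp only at h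
      omega
  obtain ⟨c₁, m₁, hc₁⟩ := hc.isMove (W := W) (d := .right) (fun p => (x₂ - (p : Cell).1).toNat)
    (by
      intro p s hs hw
      have := memP p
      rcases memW _ hw with ⟨h1, h2⟩ | ⟨h1, h2⟩ <;> simp [Dir.vec] at h1 h2 <;> omega)
    (by
      intro p q s hq hs
      have := memP p
      have := memP q
      constructor
      · intro h
        have h1 := congrArg Prod.fst h
        have h2 := congrArg Prod.snd h
        simp [Dir.vec] at h1 h2
        omega
      · intro h
        rw [adj_iff] at h
        simp [Dir.vec] at h
        omega)
    (by
      intro s c' hr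
      have key : ∀ (k : ℕ) (p : P), (x₂ - (p : Cell).1).toNat = k → k ≤ s →
          Blocked W .right c' ((2 * (p : Cell).1, 2 * (p : Cell).2) +
            (x₂ - (p : Cell).1).toNat • Dir.right.vec) := by
        intro k
        induction k with
        | zero =>
          intro p hp hs
          have hm := memP p
          have := hr.col p
          rw [hp, Nat.min_zero] at this
          rw [hp]
          refine Blocked.obstacle (by rw [this]; rfl) ?_
          simp only [hW, hO, Finset.mem_insert, Finset.mem_image, Finset.mem_Icc]
          refine Or.inr ⟨(p : Cell).2, hm.2, ?_⟩
          ext <;> simp [Dir.vec]; omega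
        | succ k ih =>
          intro p hp hs
          have hm := memP p
          have := hr.col p
          rw [hp, min_eq_right hs] at this
          rw [hp]
          refine Blocked.tile (by rw [this]; rfl) ?_
          have := ih ⟨((p : Cell).1 + 1, (p : Cell).2), mem_rect.2 (by simp only; omega)⟩
            (by simp only; omega) (by omega)
          convert this using 1
          ext <;> simp [Dir.vec]; omega
      intro p hp
      exact key _ p rfl hp)
  have e₁ : (fun p : P => ((2 * (p : Cell).1, 2 * (p : Cell).2) : Cell) +
      (x₂ - (p : Cell).1).toNat • Dir.right.vec) =
      fun p : P => (((p : Cell).1 + x₂, 2 * (p : Cell).2) : Cell) := by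
    funext p
    have := memP p
    ext <;> simp [Dir.vec]; omega
  rw [e₁] at hc₁
  obtain ⟨c₂, m₂, hc₂⟩ := hc₁.isMove (W := W) (d := .up) (fun p => (Y - (p : Cell).2).toNat)
    (by
      intro p s hs hw
      have := memP p
      rcases memW _ hw with ⟨h1, h2⟩ | ⟨h1, h2⟩ <;> simp [Dir.vec] at h1 h2 <;> omega)
    (by
      intro p q s hq hs
      have := memP p
      have := memP q
      constructor
      · intro h
        have h1 := congrArg Prod.fst h
        have h2 := congrArg Prod.snd h
        simp [Dir.vec] at h1 h2
        omega
      · intro h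
        rw [adj_iff] at h
        simp [Dir.vec] at h
        omega)
    (by
      intro s c' hr
      have e₂ : ∀ p : P, (((p : Cell).1 + x₂, 2 * (p : Cell).2) : Cell) +
          (Y - (p : Cell).2).toNat • Dir.up.vec = (p : Cell) + (x₂, Y) := by
        intro p
        have := memP p
        ext <;> simp [Dir.vec]; omega
      have hcol : ∀ p : P, (Y - (p : Cell).2).toNat ≤ s →
          c' ((p : Cell) + (x₂, Y)) = some (tileColour p) := by
        intro p hp
        have := hr.col p
        rwa [min_eq_right hp, e₂] at this
      have top : ∀ (k : ℕ) (p : P), (x₂ - (p : Cell).1).toNat = k → (p : Cell).2 = y₂ →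
          (Y - (p : Cell).2).toNat ≤ s → Blocked W .up c' ((p : Cell) + (x₂, Y)) := by
        intro k
        induction k with
        | zero =>
          intro p hp hy hs
          have hm := memP p
          refine Blocked.obstacle (by rw [hcol p hs]; rfl) ?_
          rw [hW, Finset.mem_insert]
          left
          ext <;> simp [Dir.vec] <;> omega
        | succ k ih =>
          intro p hp hy hs
          have hm := memP p
          set q : P := ⟨((p : Cell).1 + 1, (p : Cell).2), mem_rect.2 (by simp only; omega)⟩ with hq
          have hpq : gridGraph.Adj (p : Cell) q := by rw [adj_iff]; simp [hq]
          refine Blocked.bond (q := (q : Cell) + (x₂, Y)) ⟨adj_add_right.2 hpq, _, _, hcol p hs,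
            hcol q hs, tileColour_ne_of_adj hpq⟩ (ih q (by simp only [hq]; omega) hy hs)
      have key : ∀ (k : ℕ) (p : P), (y₂ - (p : Cell).2).toNat = k →
          (Y - (p : Cell).2).toNat ≤ s → Blocked W .up c' ((p : Cell) + (x₂, Y)) := by
        intro k
        induction k with
        | zero =>
          intro p hp hs
          have hm := memP p
          exact top _ p rfl (by omega) hs
        | succ k ih =>
          intro p hp hs
          have hm := memP p
          refine Blocked.tile (by rw [hcol p hs]; rfl) ?_
          have := ih ⟨((p : Cell).1, (p : Cell).2 + 1), mem_rect.2 (by simp only; omega)⟩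
            (by simp only; omega) (by simp only; omega)
          convert this using 1
          ext <;> simp [Dir.vec]; omega
      intro p hp
      rw [e₂]
      exact key _ p rfl hp)
  have hfin : c₂ = place P (x₂, Y) := by
    refine hc₂.ext ?_
    have := place_rep P (x₂, Y)
    convert this using 2 with p
    have := memP p
    ext <;> simp [Dir.vec]; omega
  refine ⟨W, c, (x₂, Y), hini, ⟨c₁, m₁, c₂, m₂, hfin.symm⟩, ?_⟩
  intro w hw
  rcases memW w hw with ⟨h1, h2⟩ | ⟨h1, y, h2, h3, h4⟩
  · refine Or.inr fun p hp => ?_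
    have := memP ⟨p, hp⟩
    simp only at this ⊢
    omega
  · refine Or.inl fun p hp => ?_
    have := memP ⟨p, hp⟩
    simp only at this ⊢
    omega

/-! ### Hierarchical constructions -/

/-- `P` is subdivided into rectangles by valid straight cuts, in a hierarchy of depth `n`. -/
inductive HasTree : ℕ → Finset Cell → Prop
  | rect (n : ℕ) {x₁ x₂ y₁ y₂ : ℤ} (h : IsPolyomino (rect x₁ x₂ y₁ y₂)) :
      HasTree n (rect x₁ x₂ y₁ y₂)
  | cut {n : ℕ} {P A B : Finset Cell} (h : IsValidStraightTwoCut P A B) (hA : HasTree n A)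
      (hB : HasTree n B) : HasTree (n + 1) P

theorem HasTree.mono {m n : ℕ} {P : Finset Cell} (h : HasTree m P) (hmn : m ≤ n) : HasTree n P := by
  induction h generalizing n with
  | rect _ hP => exact .rect n hP
  | cut hc _ _ ihA ihB =>
    obtain _ | n := n
    · omega
    · exact .cut hc (ihA (by omega)) (ihB (by omega))

/-- The steps that build a polyomino along a hierarchy of depth `n`. -/
def treeSteps : ℕ → List Dir
  | 0 => [.right, .up]
  | n + 1 => treeSteps n ++ levelSteps

theorem length_treeSteps (n : ℕ) : (treeSteps n).length = 2 + 30 * n := by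
  induction n with
  | zero => rfl
  | succ n ih =>
    rw [treeSteps, List.length_append, ih, show levelSteps.length = 30 from rfl]
    ring

theorem HasTree.ready {n : ℕ} {P : Finset Cell} (h : HasTree n P) : Ready (treeSteps n) P := by
  induction h with
  | rect n hP =>
    induction n with
    | zero => exact ready_rect _ _ _ _
    | succ n ih => exact ih.levelSteps hP
  | cut hc _ _ ihA ihB => exact ihA.cut ihB hc

/-! ### Several copies -/

theorem isCopyAt_place {P : Finset Cell} (hP : IsPolyomino P) (t : Cell) :
    IsCopyAt P (place P t) t := by
  have hcol : ∀ p ∈ P, place P t (p + t) = some (tileColour p) := fun p hp => by simp [place, hp]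
  obtain ⟨p₀, h₀⟩ := hP.nonempty
  refine ⟨⟨p₀ + t, by rw [hcol p₀ h₀]; rfl, ?_⟩, hcol⟩
  ext q
  constructor
  · rintro ⟨p, hp, rfl⟩
    refine hP.induction (motive := fun p => (bondGraph (place P t)).Reachable (p₀ + t) (p + t)) h₀
      (SimpleGraph.Reachable.refl _) ?_ p hp
    intro a ha b hb hab hr
    have hadj : (bondGraph (place P t)).Adj (a + t) (b + t) :=
      ⟨adj_add_right.2 hab, _, _, hcol a ha, hcol b hb, tileColour_ne_of_adj hab⟩
    exact hr.trans hadj.reachable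
  · rintro ⟨w⟩
    have hmem : ∀ {u v : Cell}, (bondGraph (place P t)).Walk u v → (∃ p ∈ P, u = p + t) →
        ∃ p ∈ P, v = p + t := by
      intro u v w
      induction w with
      | nil => exact id
      | @cons a b c hab _ ih =>
        intro _
        refine ih ?_
        obtain ⟨_, u, v, _, hv, _⟩ := hab
        by_cases hb : b - t ∈ P
        · exact ⟨_, hb, by simp⟩
        · simp [place, hb] at hv
    exact hmem w ⟨p₀, h₀, rfl⟩

/-- All copies grow simultaneously in workspaces side by side, so the sequence does not depend on
`D`. -/
theorem copiesBuildableWithin_of_isRun {P W : Finset Cell} (hP : IsPolyomino P) {c : Config}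
    {σ : List Dir} {t : Cell} (hi : IsInitial W c) (hr : IsRun W c σ (place P t)) (D : ℕ) :
    CopiesBuildableWithin P D σ.length := by
  suffices h : ∃ (W : Finset Cell) (c₀ c : Config) (T : Finset Cell), IsInitial W c₀ ∧
      IsRun W c₀ σ c ∧ T.card = D ∧ ∀ t ∈ T, IsCopyAt P c t by
    obtain ⟨W, c₀, c, T, h1, h2, h3⟩ := h
    exact ⟨W, c₀, c, σ, h1, h2, le_rfl, T, h3⟩
  induction D with
  | zero =>
    exact ⟨∅, _, _, ∅, isInitial_none _, (isRunWithin_none (R := ∅) σ).isRun, rfl, by simp⟩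
  | succ D ih =>
    obtain ⟨W₁, c₁, c₁', T, i₁, r₁, hT, hcopy⟩ := ih
    obtain ⟨x, X, R₁, R₂, c₀, -, -, -, hR₁, hR₂, -, -, w₁, w₂, hi', hr'⟩ :=
      exists_join i₁ r₁ hi hr 0 0
    rw [place_addRight] at w₂ hr'
    have hap : Apart R₁ R₂ := apart_of_lt hR₁ hR₂
    have hnew := isCopyAt_place hP (t + (x, 0))
    have hmem₂ : ∀ p ∈ P, p + (t + (x, 0)) ∈ R₂ := fun p hp =>
      w₂ _ (by rw [hnew.2 p hp]; rfl)
    have hmem₁ : ∀ s ∈ T, ∀ p ∈ P, p + s ∈ R₁ := fun s hs p hp =>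
      w₁ _ (by rw [(hcopy s hs).2 p hp]; rfl)
    have hcomm := join_comm_of_apart hap w₁ w₂
    obtain ⟨p₀, h₀⟩ := hP.nonempty
    have hnot : t + (x, 0) ∉ T := fun h => (hap _ (hmem₁ _ h p₀ h₀) _ (hmem₂ p₀ h₀)).1 rfl
    refine ⟨_, c₀, _, insert (t + (x, 0)) T, hi', hr'.isRun, ?_, ?_⟩
    · rw [Finset.card_insert_of_notMem hnot, hT]
    · intro s hs
      rcases Finset.mem_insert.1 hs with rfl | hs
      · rw [hcomm]
        exact ⟨hnew.1.join_left hap.symm w₂ w₁, fun p hp => by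
          rw [join_eq_left hap.symm w₁ (hmem₂ p hp)]; exact hnew.2 p hp⟩
      · exact ⟨(hcopy s hs).1.join_left hap w₁ w₂, fun p hp => by
          rw [join_eq_left hap w₂ (hmem₁ s hs p hp)]; exact (hcopy s hs).2 p hp⟩

theorem CopiesBuildableWithin.mono {P : Finset Cell} {D m n : ℕ} (h : CopiesBuildableWithin P D m)
    (hmn : m ≤ n) : CopiesBuildableWithin P D n := by
  obtain ⟨W, c₀, c, σ, h1, h2, h3, h4⟩ := h
  exact ⟨W, c₀, c, σ, h1, h2, h3.trans hmn, h4⟩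

theorem HasTree.copiesBuildableWithin {n : ℕ} {P : Finset Cell} (h : HasTree n P)
    (hP : IsPolyomino P) (D : ℕ) : CopiesBuildableWithin P D (2 + 30 * n) := by
  obtain ⟨W, c, t, hi, hr, -⟩ := h.ready 0
  rw [← length_treeSteps]
  exact copiesBuildableWithin_of_isRun hP hi hr D

/-! ### Settled ends -/

theorem exists_run_right (p : ℤ → Prop) {a b : ℤ} (hab : a ≤ b) (ha : p a) :
    ∃ x, a ≤ x ∧ x ≤ b ∧ (∀ x', a ≤ x' → x' ≤ x → p x') ∧ (x = b ∨ ¬ p (x + 1)) := by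
  obtain ⟨n, rfl⟩ := Int.le.dest hab
  induction n with
  | zero => exact ⟨a, le_rfl, by omega, fun x' h1 h2 => by rwa [le_antisymm h2 h1], Or.inl (by simp)⟩
  | succ n ih =>
    obtain ⟨x, h1, h2, h3, h4⟩ := ih (by omega)
    by_cases hx : p (x + 1)
    · have hx' := h4.resolve_right (not_not_intro hx)
      refine ⟨x + 1, by omega, by push_cast; omega, fun x' h5 h6 => ?_, Or.inl (by push_cast; omega)⟩
      rcases eq_or_ne x' (x + 1) with rfl | hne
      · exact hx
      · exact h3 x' h5 (by omega)
    · exact ⟨x, h1, by push_cast; omega, h3, Or.inr hx⟩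

theorem exists_run_left (p : ℤ → Prop) {a b : ℤ} (hab : a ≤ b) (hb : p b) :
    ∃ x, a ≤ x ∧ x ≤ b ∧ (∀ x', x ≤ x' → x' ≤ b → p x') ∧ (x = a ∨ ¬ p (x - 1)) := by
  obtain ⟨x, h1, h2, h3, h4⟩ := exists_run_right (fun x => p (-x)) (neg_le_neg hab) (by simpa using hb)
  refine ⟨-x, by omega, by omega, fun x' h5 h6 => by simpa using h3 (-x') (by omega) (by omega), ?_⟩
  rcases h4 with h4 | h4
  · exact Or.inl (by omega)
  · right
    rwa [show -x - 1 = -(x + 1) by ring]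

/-- Above `z`, the polyomino `P` ends in a rectangle of full rows that starts in the row of `z`, with
nothing above it, and beyond this end, the neighbouring columns only contain tiles whose colour
keeps the top row of the rectangle from being moved past them. -/
def Settled (P : Finset Cell) (z : Cell) : Prop :=
  ∃ x₁ x₂ y₂, x₁ ≤ z.1 ∧ z.1 ≤ x₂ ∧ z.2 ≤ y₂ ∧
    (∀ x y, x₁ ≤ x → x ≤ x₂ → z.2 ≤ y → y ≤ y₂ → (x, y) ∈ P) ∧
    (∀ y, z.2 ≤ y → y ≤ y₂ → (x₁ - 1, y) ∉ P ∧ (x₂ + 1, y) ∉ P) ∧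
    (∀ x y, x₁ ≤ x → x ≤ x₂ → y₂ < y → (x, y) ∉ P) ∧
    ∀ y, y₂ < y → ((x₁ - 1, y) ∈ P → tileColour (x₁ - 1, y) ≠ tileColour (x₁, y₂)) ∧
      ((x₂ + 1, y) ∈ P → tileColour (x₂ + 1, y) ≠ tileColour (x₂, y₂))

/-! ### Inheritance of settled ends by the pieces of a cut -/

section Cut

variable {P A B : Finset Cell} {d : Dir}

theorem IsTwoCut.mem_or (h : IsTwoCut P A B) {p : Cell} (hp : p ∈ P) : p ∈ A ∨ p ∈ B := by
  rwa [← h.union, Finset.mem_union] at hp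

theorem IsTwoCut.left_subset (h : IsTwoCut P A B) {p : Cell} (hp : p ∈ A) : p ∈ P := by
  rw [← h.union]; exact Finset.mem_union_left _ hp

theorem IsTwoCut.right_subset (h : IsTwoCut P A B) {p : Cell} (hp : p ∈ B) : p ∈ P := by
  rw [← h.union]; exact Finset.mem_union_right _ hp

theorem IsTwoCut.not_right (h : IsTwoCut P A B) {p : Cell} (hp : p ∈ A) : p ∉ B :=
  fun hb => Finset.disjoint_left.1 h.disjoint hp hb

theorem IsTwoCut.mem_left_of_adj (h : IsTwoCut P A B) (hs : IsStraightCut d A B) {p q : Cell}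
    (hp : p ∈ A) (hq : q ∈ P) (hadj : gridGraph.Adj p q) (hne : q ≠ p + d.vec) : q ∈ A :=
  (h.mem_or hq).resolve_right fun hb => hne (hs p hp q hb hadj)

theorem IsTwoCut.mem_right_of_adj (h : IsTwoCut P A B) (hs : IsStraightCut d A B) {p q : Cell}
    (hp : p ∈ B) (hq : q ∈ P) (hadj : gridGraph.Adj p q) (hne : p ≠ q + d.vec) : q ∈ B :=
  (h.mem_or hq).resolve_left fun hb => hne (hs q hb p hp hadj.symm)

/-- A straight cut meets the end rectangle only along full columns or full rows, so the part of `A`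
around `z` is again a rectangle. The delicate case is a horizontal cut that gives the top of the
rectangle to `B`; the colour clause of `Settled` then keeps `A` out of the neighbouring columns
above. -/
theorem Settled.left (hc : IsTwoCut P A B) (hs : IsStraightCut d A B) (hp : CanPullApart d A B)
    {z : Cell} (hz : z ∈ A) (h : Settled P z) : Settled A z := by
  obtain ⟨zx, zy⟩ := z
  obtain ⟨x₁, x₂, y₂, hx₁, hx₂, hy₂, hin, hside, habove, hcol⟩ := h
  simp only at hx₁ hx₂ hy₂ hin hside
  by_cases hd : d.vec.2 = 0
  · -- the cut has vertical segments, and columns are not separated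
    have hup : ∀ x, (x, zy) ∈ A → x₁ ≤ x → x ≤ x₂ → ∀ y, zy ≤ y → y ≤ y₂ → (x, y) ∈ A := by
      intro x hx h1 h2 y h3
      induction y, h3 using Int.leInduction with
      | base => exact fun _ => hx
      | succ y h3 ih =>
        intro h4
        refine hc.mem_left_of_adj hs (ih (by omega)) (hin x _ h1 h2 (by omega) h4)
          (by rw [adj_iff]; simp) fun h => ?_
        have := congrArg Prod.snd h
        simp only [Prod.snd_add, hd] at this
        omega
    have hdown : ∀ x y, x₁ ≤ x → x ≤ x₂ → zy ≤ y → y ≤ y₂ → (x, y) ∈ A → (x, zy) ∈ A := by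
      intro x y h1 h2 h3
      induction y, h3 using Int.leInduction with
      | base => exact fun _ h => h
      | succ y h3 ih =>
        intro h4 h5
        refine ih (by omega) (hc.mem_left_of_adj hs h5 (hin x _ h1 h2 (by omega) (by omega))
          (by rw [adj_iff]; simp) fun h => ?_)
        have := congrArg Prod.snd h
        simp only [Prod.snd_add, hd] at this
        omega
    obtain ⟨u₁, a1, a2, a3, a4⟩ := exists_run_left (fun x => (x, zy) ∈ A) hx₁ hz
    obtain ⟨u₂, b1, b2, b3, b4⟩ := exists_run_right (fun x => (x, zy) ∈ A) hx₂ hz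
    have hrow : ∀ x, u₁ ≤ x → x ≤ u₂ → (x, zy) ∈ A := by
      intro x h1 h2
      rcases le_total x zx with h | h
      · exact a3 x h1 h
      · exact b3 x h h2
    refine ⟨u₁, u₂, y₂, a2, b1, hy₂, fun x y h1 h2 h3 h4 =>
      hup x (hrow x h1 h2) (by omega) (by omega) y h3 h4, ?_, ?_, ?_⟩
    · intro y h1 h2
      simp only at h1
      constructor
      · intro hm
        rcases eq_or_ne u₁ x₁ with rfl | hne
        · exact (hside y h1 h2).1 (hc.left_subset hm)
        · exact a4.resolve_left hne (hdown _ y (by omega) (by omega) h1 h2 hm)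
      · intro hm
        rcases eq_or_ne u₂ x₂ with rfl | hne
        · exact (hside y h1 h2).2 (hc.left_subset hm)
        · exact b4.resolve_left hne (hdown _ y (by omega) (by omega) h1 h2 hm)
    · exact fun x y h1 h2 h3 hm => habove x y (by omega) (by omega) h3 (hc.left_subset hm)
    · intro y hy
      constructor
      · intro hm
        rcases eq_or_ne u₁ x₁ with rfl | hne
        · exact (hcol y hy).1 (hc.left_subset hm)
        · exact absurd (hc.left_subset hm) (habove _ y (by omega) (by omega) hy)
      · intro hm
        rcases eq_or_ne u₂ x₂ with rfl | hne
        · exact (hcol y hy).2 (hc.left_subset hm)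
        · exact absurd (hc.left_subset hm) (habove _ y (by omega) (by omega) hy)
  · have hd1 : d.vec.1 = 0 := by cases d <;> simp [Dir.vec] at hd ⊢
    -- the cut has horizontal segments, and rows are not separated
    obtain ⟨v, a1, a2, a3, a4⟩ := exists_run_right (fun y => (zx, y) ∈ A) hy₂ hz
    have hright : ∀ y, zy ≤ y → y ≤ v → ∀ x, zx ≤ x → x ≤ x₂ → (x, y) ∈ A := by
      intro y h1 h2 x h3
      induction x, h3 using Int.leInduction with
      | base => exact fun _ => a3 y h1 h2
      | succ x h3 ih =>
        intro h4
        refine hc.mem_left_of_adj hs (ih (by omega)) (hin _ y (by omega) h4 h1 (by omega))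
          (by rw [adj_iff]; simp) fun h => ?_
        have := congrArg Prod.fst h
        simp only [Prod.fst_add, hd1] at this
        omega
    have hleft : ∀ y, zy ≤ y → y ≤ v → ∀ x, x ≤ zx → x₁ ≤ x → (x, y) ∈ A := by
      intro y h1 h2 x h3
      induction x, h3 using Int.leInductionDown with
      | base => exact fun _ => a3 y h1 h2
      | pred x h3 ih =>
        intro h4
        refine hc.mem_left_of_adj hs (ih (by omega)) (hin _ y (by omega) (by omega) h1 (by omega))
          (by rw [adj_iff]; simp) fun h => ?_
        have := congrArg Prod.fst h
        simp only [Prod.fst_add, hd1] at this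
        omega
    have hrect : ∀ x y, x₁ ≤ x → x ≤ x₂ → zy ≤ y → y ≤ v → (x, y) ∈ A := by
      intro x y h1 h2 h3 h4
      rcases le_total x zx with h | h
      · exact hleft y h3 h4 x h h1
      · exact hright y h3 h4 x h h2
    rcases eq_or_ne v y₂ with rfl | hne
    · exact ⟨x₁, x₂, v, hx₁, hx₂, hy₂, hrect,
        fun y h1 h2 => ⟨fun hm => (hside y h1 h2).1 (hc.left_subset hm),
          fun hm => (hside y h1 h2).2 (hc.left_subset hm)⟩,
        fun x y h1 h2 h3 hm => habove x y h1 h2 h3 (hc.left_subset hm),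
        fun y hy => ⟨fun hm => (hcol y hy).1 (hc.left_subset hm),
          fun hm => (hcol y hy).2 (hc.left_subset hm)⟩⟩
    · have hB₀ : (zx, v + 1) ∈ B :=
        (hc.mem_or (hin _ _ hx₁ hx₂ (by omega) (by omega))).resolve_left (a4.resolve_left hne)
      -- The cut runs between the rows `v` and `v + 1`, with `B` above.
      have hdup : d.vec = (0, 1) := by
        have := hs _ (a3 v a1 le_rfl) _ hB₀ (by rw [adj_iff]; simp)
        have := congrArg Prod.snd this
        simp only [Prod.snd_add] at this
        exact Prod.ext hd1 (by simp only; omega)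
      have hBr : ∀ x, zx ≤ x → x ≤ x₂ → (x, v + 1) ∈ B := by
        intro x h1
        induction x, h1 using Int.leInduction with
        | base => exact fun _ => hB₀
        | succ x h1 ih =>
          intro h2
          refine hc.mem_right_of_adj hs (ih (by omega)) (hin _ _ (by omega) h2 (by omega) (by omega))
            (by rw [adj_iff]; simp) fun h => ?_
          have := congrArg Prod.fst h
          simp only [Prod.fst_add, hd1] at this
          omega
      have hBl : ∀ x, x ≤ zx → x₁ ≤ x → (x, v + 1) ∈ B := by
        intro x h1
        induction x, h1 using Int.leInductionDown with
        | base => exact fun _ => hB₀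
        | pred x h1 ih =>
          intro h2
          refine hc.mem_right_of_adj hs (ih (by omega)) (hin _ _ h2 (by omega) (by omega) (by omega))
            (by rw [adj_iff]; simp) fun h => ?_
          have := congrArg Prod.fst h
          simp only [Prod.fst_add, hd1] at this
          omega
      have hBin : ∀ x y, x₁ ≤ x → x ≤ x₂ → v + 1 ≤ y → y ≤ y₂ → (x, y) ∈ B := by
        intro x y h1 h2 h3
        induction y, h3 using Int.leInduction with
        | base => exact fun _ => (le_total x zx).elim (fun h => hBl x h h1) (fun h => hBr x h h2)
        | succ y h3 ih =>
          intro h4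
          refine hc.mem_right_of_adj hs (ih (by omega)) (hin x _ h1 h2 (by omega) h4)
            (by rw [adj_iff]; simp) fun h => ?_
          have := congrArg Prod.snd h
          simp only [Prod.snd_add, hdup] at this
          omega
      have hBtop : ∀ x, x₁ ≤ x → x ≤ x₂ → (x, y₂) ∈ B := fun x h1 h2 =>
        hBin x y₂ h1 h2 (by omega) le_rfl
      -- Such a tile of `A` would come level with the top row, which belongs to `B`, while being
      -- pulled down. Pulling apart requires equal colours there, `Settled` distinct ones.
      have hfree : ∀ y, y₂ < y → (x₁ - 1, y) ∉ A ∧ (x₂ + 1, y) ∉ A := by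
        intro y hy
        have hk : ∀ x x' : ℤ, (x = x₁ - 1 ∧ x' = x₁) ∨ (x = x₂ + 1 ∧ x' = x₂) → (x, y) ∈ A →
            tileColour (x, y) = tileColour (x', y₂) := by
          intro x x' hx hm
          refine (hp (y - y₂).toNat (by omega) _ hm _ (hBtop x' (by omega) (by omega))).2 ?_
          rw [hdup, adj_iff]
          simp
          omega
        exact ⟨fun hm => (hcol y hy).1 (hc.left_subset hm) (hk _ _ (Or.inl ⟨rfl, rfl⟩) hm),
          fun hm => (hcol y hy).2 (hc.left_subset hm) (hk _ _ (Or.inr ⟨rfl, rfl⟩) hm)⟩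
      have hfree' : ∀ y, zy ≤ y → (x₁ - 1, y) ∉ A ∧ (x₂ + 1, y) ∉ A := by
        intro y hy
        rcases lt_or_ge y₂ y with h | h
        · exact hfree y h
        · exact ⟨fun hm => (hside y hy h).1 (hc.left_subset hm),
            fun hm => (hside y hy h).2 (hc.left_subset hm)⟩
      refine ⟨x₁, x₂, v, hx₁, hx₂, a1, hrect, fun y h1 _ => hfree' y h1, ?_, fun y hy =>
        ⟨fun hm => absurd hm (hfree' y (by omega)).1, fun hm => absurd hm (hfree' y (by omega)).2⟩⟩
      intro x y h1 h2 h3 hm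
      rcases lt_or_ge y₂ y with h | h
      · exact habove x y h1 h2 h (hc.left_subset hm)
      · exact hc.not_right hm (hBin x y h1 h2 (by omega) h)

end Cut

/-! ### The complexity of a polyomino -/

/-- Three cells of a `2 × 2` square, with middle cell `t`, belong to `P`, and the fourth does not. -/
def Corner (P : Finset Cell) (t : Cell) (sx sy : ℤ) : Prop :=
  t ∈ P ∧ (t.1 + sx, t.2) ∈ P ∧ (t.1, t.2 + sy) ∈ P ∧ (t.1 + sx, t.2 + sy) ∉ P

/-- The features of `P` that are counted by its complexity, in one of eight orientations. -/
def Feature (P : Finset Cell) : Fin 4 → Cell → Prop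
  -- Each kind is what some cut at the end of a strip destroys: a corner losing one of its tiles
  -- (0), a surviving corner losing the tile above it (1), or an unsettled strip above a corner
  -- becoming settled (2 and 3).
  | 0, t => Corner P t 1 1
  | 1, t => Corner P t 1 (-1) ∧ (t.1, t.2 + 1) ∈ P
  | 2, t => Corner P t 1 1 ∧ ¬ Settled P (t.1, t.2 + 1)
  | 3, t => Corner P t 1 (-1) ∧ ¬ Settled P t

open Classical in
/-- The number of features of `P`. -/
noncomputable def featureCount (P : Finset Cell) : ℕ :=
  ∑ i, (P.filter (Feature P i)).card

/-- If the missing cell of the square were in `B`, its two neighbours in `A` would both have to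
precede it in the direction `d`, hence coincide. -/
theorem Corner.of_left {P A B : Finset Cell} {d : Dir} (hc : IsTwoCut P A B)
    (hs : IsStraightCut d A B) {t : Cell} {sx sy : ℤ} (hx : sx = 1 ∨ sx = -1)
    (hy : sy = 1 ∨ sy = -1) (h : Corner A t sx sy) : Corner P t sx sy := by
  obtain ⟨h1, h2, h3, h4⟩ := h
  refine ⟨hc.left_subset h1, hc.left_subset h2, hc.left_subset h3, fun hm => ?_⟩
  have hb := (hc.mem_or hm).resolve_left h4
  have e1 := hs _ h2 _ hb (by
    rw [adj_iff]; rcases hx with rfl | rfl <;> rcases hy with rfl | rfl <;> simp)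
  have e2 := hs _ h3 _ hb (by
    rw [adj_iff]; rcases hx with rfl | rfl <;> rcases hy with rfl | rfl <;> simp)
  have := congrArg Prod.fst (add_right_cancel (e1.symm.trans e2))
  simp only at this
  omega

theorem Feature.of_left {P A B : Finset Cell} {d : Dir} (hc : IsTwoCut P A B)
    (hs : IsStraightCut d A B) (hp : CanPullApart d A B) {i : Fin 4} {t : Cell}
    (h : Feature A i t) : Feature P i t := by
  have c1 := fun h => Corner.of_left hc hs (t := t) (Or.inl rfl) (Or.inl rfl) h
  have c2 := fun h => Corner.of_left hc hs (t := t) (Or.inl rfl) (Or.inr rfl) h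
  fin_cases i
  · exact c1 h
  · exact ⟨c2 h.1, hc.left_subset h.2⟩
  · exact ⟨c1 h.1, fun hS => h.2 (hS.left hc hs hp h.1.2.2.1)⟩
  · exact ⟨c2 h.1, fun hS => h.2 (hS.left hc hs hp h.1.1)⟩

theorem Feature.of_right {P A B : Finset Cell} (hc : IsValidStraightTwoCut P A B) {i : Fin 4}
    {t : Cell} (h : Feature B i t) : Feature P i t := by
  obtain ⟨h1, d, h2, h3⟩ := hc.symm
  exact h.of_left h1 h2 h3

theorem Feature.mem {P : Finset Cell} {i : Fin 4} {t : Cell} (h : Feature P i t) : t ∈ P := by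
  fin_cases i
  · exact h.1
  · exact h.1.1
  · exact h.1.1
  · exact h.1.1

/-- Every feature of a piece is a feature of `P` at the same tile, and the pieces share no tile. -/
theorem featureCount_add_le {P A B : Finset Cell} (hc : IsValidStraightTwoCut P A B) :
    featureCount A + featureCount B ≤ featureCount P := by
  classical
  rw [featureCount, featureCount, ← Finset.sum_add_distrib]
  refine Finset.sum_le_sum fun i _ => ?_
  rw [← Finset.card_union_of_disjoint (Finset.disjoint_filter_filter hc.1.disjoint)]
  refine Finset.card_le_card fun t ht => ?_
  simp only [Finset.mem_union, Finset.mem_filter] at ht ⊢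
  rcases ht with ⟨h1, h2⟩ | ⟨h1, h2⟩
  · exact ⟨hc.1.left_subset h1, h2.of_right hc.symm⟩
  · exact ⟨hc.1.right_subset h1, h2.of_right hc⟩

theorem featureCount_lt {P A B : Finset Cell} (hc : IsValidStraightTwoCut P A B) {i : Fin 4}
    {t : Cell} (hP : Feature P i t) (hB : ¬ Feature B i t) : featureCount B < featureCount P := by
  classical
  refine Finset.sum_lt_sum (fun j _ => Finset.card_le_card fun t ht => ?_)
    ⟨i, Finset.mem_univ i, Finset.card_lt_card ⟨fun t ht => ?_, fun h => ?_⟩⟩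
  · simp only [Finset.mem_filter] at ht ⊢
    exact ⟨hc.1.right_subset ht.1, ht.2.of_right hc⟩
  · simp only [Finset.mem_filter] at ht ⊢
    exact ⟨hc.1.right_subset ht.1, ht.2.of_right hc⟩
  · have := h (Finset.mem_filter.2 ⟨hP.mem, hP⟩)
    exact hB (Finset.mem_filter.1 this).2

/-- The reflection in the horizontal axis. -/
def flipY : Cell ≃ Cell := (Equiv.refl ℤ).prodCongr (Equiv.neg ℤ)

/-- The action of `flipY` on directions. -/
def flipYDir : Dir → Dir
  | .up => .down
  | .right => .right
  | .down => .up
  | .left => .left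

@[simp] theorem flipY_apply (p : Cell) : flipY p = (p.1, -p.2) := rfl

@[simp] theorem flipY_symm : flipY.symm = flipY := by ext p <;> rfl

theorem isSym_flipY : IsSym flipY flipYDir where
  vec p d := by cases d <;> ext <;> simp [flipYDir, Dir.vec, add_comm]
  adj p q := by simp only [adj_iff, flipY_apply]; omega
  add p q := by ext <;> simp [add_comm]
  colour p := by rw [tileColour_eq_iff]; simp only [flipY_apply, Int.even_iff]; omega
  symm_eq := by simp
  dir d := by cases d <;> rfl

/-- The number of features up to reflection in the vertical axis. -/
noncomputable def featureCountX (P : Finset Cell) : ℕ :=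
  featureCount P + featureCount (P.map flipX.toEmbedding)

/-- The number of features up to reflections in both axes. -/
noncomputable def featureCountXY (P : Finset Cell) : ℕ :=
  featureCountX P + featureCountX (P.map flipY.toEmbedding)

/-- The number of features of `P` in all orientations. -/
noncomputable def complexity (P : Finset Cell) : ℕ :=
  featureCountXY P + featureCountXY (P.map diag.toEmbedding)

theorem featureCountX_flipX (P : Finset Cell) :
    featureCountX (P.map flipX.toEmbedding) = featureCountX P := by
  rw [featureCountX, featureCountX, isSym_flipX.map_map, add_comm]

theorem map_flipX_flipY (P : Finset Cell) : (P.map flipX.toEmbedding).map flipY.toEmbedding =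
    (P.map flipY.toEmbedding).map flipX.toEmbedding := by
  ext p; simp

theorem map_flipX_diag (P : Finset Cell) : (P.map flipX.toEmbedding).map diag.toEmbedding =
    (P.map diag.toEmbedding).map flipY.toEmbedding := by
  ext p; simp

theorem map_flipY_diag (P : Finset Cell) : (P.map flipY.toEmbedding).map diag.toEmbedding =
    (P.map diag.toEmbedding).map flipX.toEmbedding := by
  ext p; simp

theorem featureCountXY_flipX (P : Finset Cell) :
    featureCountXY (P.map flipX.toEmbedding) = featureCountXY P := by
  rw [featureCountXY, featureCountXY, map_flipX_flipY, featureCountX_flipX, featureCountX_flipX]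

theorem featureCountXY_flipY (P : Finset Cell) :
    featureCountXY (P.map flipY.toEmbedding) = featureCountXY P := by
  rw [featureCountXY, featureCountXY, isSym_flipY.map_map, add_comm]

theorem complexity_flipX (P : Finset Cell) :
    complexity (P.map flipX.toEmbedding) = complexity P := by
  rw [complexity, complexity, map_flipX_diag, featureCountXY_flipX, featureCountXY_flipY]

theorem complexity_flipY (P : Finset Cell) :
    complexity (P.map flipY.toEmbedding) = complexity P := by
  rw [complexity, complexity, map_flipY_diag, featureCountXY_flipX, featureCountXY_flipY]

theorem complexity_diag (P : Finset Cell) :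
    complexity (P.map diag.toEmbedding) = complexity P := by
  rw [complexity, complexity, isSym_diag.map_map, add_comm]

/-! ### Decrease of the complexity under cuts -/

section Cut

variable {P A B : Finset Cell}

theorem featureCountX_add_le (hc : IsValidStraightTwoCut P A B) :
    featureCountX A + featureCountX B ≤ featureCountX P := by
  have h1 := featureCount_add_le hc
  have h2 := featureCount_add_le (hc.map isSym_flipX)
  simp only [featureCountX]; omega

theorem featureCountXY_add_le (hc : IsValidStraightTwoCut P A B) :
    featureCountXY A + featureCountXY B ≤ featureCountXY P := by
  have h1 := featureCountX_add_le hc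
  have h2 := featureCountX_add_le (hc.map isSym_flipY)
  simp only [featureCountXY]; omega

/-- In each of the other seven orientations the count does not increase, so a loss in one suffices.
-/
theorem complexity_lt_of_featureCount (hc : IsValidStraightTwoCut P A B)
    (h : featureCount B < featureCount P) : complexity B < complexity P := by
  have h2 := featureCount_add_le (hc.map isSym_flipX)
  have h3 := featureCountX_add_le (hc.map isSym_flipY)
  have h4 := featureCountXY_add_le (hc.map isSym_diag)
  simp only [complexity, featureCountXY, featureCountX] at *; omega

theorem complexity_lt_of_feature (hc : IsValidStraightTwoCut P A B) {i : Fin 4}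
    {t : Cell} (hP : Feature P i t) (hB : ¬ Feature B i t) : complexity B < complexity P :=
  complexity_lt_of_featureCount hc (featureCount_lt hc hP hB)

theorem corner_flipX {t : Cell} {sx sy : ℤ} :
    Corner (P.map flipX.toEmbedding) (flipX t) sx sy ↔ Corner P t (-sx) sy := by
  simp only [Corner, isSym_flipX.mem_map, flipX_apply, neg_neg, neg_add]

theorem corner_flipY {t : Cell} {sx sy : ℤ} :
    Corner (P.map flipY.toEmbedding) (flipY t) sx sy ↔ Corner P t sx (-sy) := by
  simp only [Corner, isSym_flipY.mem_map, flipY_apply, neg_neg, neg_add]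

theorem complexity_lt_of_corner (hc : IsValidStraightTwoCut P A B) {t : Cell} {sx sy : ℤ}
    (hx : sx = 1 ∨ sx = -1) (hy : sy = 1 ∨ sy = -1) (hP : Corner P t sx sy)
    (hB : ¬ Corner B t sx sy) : complexity B < complexity P := by
  have key : ∀ {P A B : Finset Cell}, IsValidStraightTwoCut P A B → ∀ {t : Cell} {sy : ℤ},
      (sy = 1 ∨ sy = -1) → Corner P t 1 sy → ¬ Corner B t 1 sy → complexity B < complexity P := by
    intro P A B hc t sy hy hP hB
    rcases hy with rfl | rfl
    · exact complexity_lt_of_feature hc (i := 0) hP hB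
    · rw [← complexity_flipY B, ← complexity_flipY P]
      exact complexity_lt_of_feature (hc.map isSym_flipY) (i := 0) (t := flipY t)
        (corner_flipY.2 hP) (fun h => hB (corner_flipY.1 h))
  rcases hx with rfl | rfl
  · exact key hc hy hP hB
  · rw [← complexity_flipX B, ← complexity_flipX P]
    exact key (hc.map isSym_flipX) hy (corner_flipX.2 hP) (fun h => hB (corner_flipX.1 h))

/-- A corner of `A` is a corner of `P` that `B` lacks. So if `B` keeps the complexity of `P`, then
`A` has no corner at all. -/
theorem complexity_lt_of_corner_left (hc : IsValidStraightTwoCut P A B) {t : Cell} {sx sy : ℤ}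
    (hx : sx = 1 ∨ sx = -1) (hy : sy = 1 ∨ sy = -1) (hA : Corner A t sx sy) :
    complexity B < complexity P := by
  obtain ⟨h1, d, h2, h3⟩ := id hc
  exact complexity_lt_of_corner hc hx hy (hA.of_left h1 h2 hx hy)
    fun hB => h1.not_right hA.1 hB.1

end Cut

/-! ### Complexity and locally reflex tiles -/

theorem reflexCount_map_le {e : Cell ≃ Cell} {δ : Dir → Dir} (he : IsSym e δ) (P : Finset Cell)
    (h : ∀ t, IsLocallyReflex (P.map e.toEmbedding) t → IsLocallyReflex P (e t)) :
    reflexCount (P.map e.toEmbedding) ≤ reflexCount P := by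
  refine Finset.card_le_card_of_injOn e (fun t ht => ?_) e.injective.injOn
  simp only [Finset.coe_filter, Set.mem_ofPred_eq] at ht ⊢
  exact ⟨he.mem_map.1 ht.1, h t ht.2⟩

theorem reflexCount_flipX_le (P : Finset Cell) :
    reflexCount (P.map flipX.toEmbedding) ≤ reflexCount P := by
  refine reflexCount_map_le isSym_flipX P ?_
  rintro t ⟨h1, sx, hx, sy, hy, h2, h3, h4⟩
  simp only [isSym_flipX.mem_map, flipX_apply, neg_add] at h1 h2 h3 h4
  refine ⟨h1, -sx, ?_, sy, hy, h2, h3, h4⟩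
  simp only [Finset.mem_insert, Finset.mem_singleton] at hx ⊢
  omega

theorem reflexCount_flipY_le (P : Finset Cell) :
    reflexCount (P.map flipY.toEmbedding) ≤ reflexCount P := by
  refine reflexCount_map_le isSym_flipY P ?_
  rintro t ⟨h1, sx, hx, sy, hy, h2, h3, h4⟩
  simp only [isSym_flipY.mem_map, flipY_apply, neg_add] at h1 h2 h3 h4
  refine ⟨h1, sx, hx, -sy, ?_, h2, h3, h4⟩
  simp only [Finset.mem_insert, Finset.mem_singleton] at hy ⊢
  omega

theorem reflexCount_diag_le (P : Finset Cell) :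
    reflexCount (P.map diag.toEmbedding) ≤ reflexCount P := by
  refine reflexCount_map_le isSym_diag P ?_
  rintro t ⟨h1, sx, hx, sy, hy, h2, h3, h4⟩
  simp only [isSym_diag.mem_map, diag_apply] at h1 h2 h3 h4
  exact ⟨h1, sy, hy, sx, hx, h3, h2, h4⟩

theorem featureCount_le (P : Finset Cell) : featureCount P ≤ 4 * reflexCount P := by
  classical
  have : ∀ i ∈ (Finset.univ : Finset (Fin 4)),
      (P.filter (Feature P i)).card ≤ reflexCount P := by
    intro i _
    refine Finset.card_le_card fun t ht => ?_
    rw [Finset.mem_filter] at ht ⊢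
    have key : ∀ sy : ℤ, sy ∈ ({1, -1} : Finset ℤ) → Corner P t 1 sy → IsLocallyReflex P t :=
      fun sy hsy h => ⟨h.1, 1, by simp, sy, hsy, h.2.1, h.2.2.1, h.2.2.2⟩
    refine ⟨ht.1, ?_⟩
    have h := ht.2
    fin_cases i
    · exact key 1 (by simp) h
    · exact key (-1) (by simp) h.1
    · exact key 1 (by simp) h.1
    · exact key (-1) (by simp) h.1
  simpa [featureCount] using Finset.sum_le_card_nsmul _ _ _ this

theorem featureCountXY_le (P : Finset Cell) : featureCountXY P ≤ 16 * reflexCount P := by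
  have h1 := featureCount_le P
  have h2 := featureCount_le (P.map flipX.toEmbedding)
  have h3 := featureCount_le (P.map flipY.toEmbedding)
  have h4 := featureCount_le ((P.map flipY.toEmbedding).map flipX.toEmbedding)
  have h5 := reflexCount_flipX_le P
  have h6 := reflexCount_flipY_le P
  have h7 := reflexCount_flipX_le (P.map flipY.toEmbedding)
  simp only [featureCountXY, featureCountX]
  omega

/-- Each of the four kinds of features in each of the eight orientations is counted at most once per
reflex tile. -/
theorem complexity_le (P : Finset Cell) : complexity P ≤ 32 * reflexCount P := by
  have h1 := featureCountXY_le P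
  have h2 := featureCountXY_le (P.map diag.toEmbedding)
  have h3 := reflexCount_diag_le P
  simp only [complexity]
  omega

/-! ### Tabs -/

/-- `X` is attached to the rest of `P` from above: below each cell of `X` there is a cell of `P`, and
`X` contains all other neighbours of its cells. -/
structure IsTab (P X : Finset Cell) : Prop where
  subset : ∀ p ∈ X, p ∈ P
  below : ∀ p ∈ X, (p.1, p.2 - 1) ∈ P
  above : ∀ p ∈ X, (p.1, p.2 + 1) ∈ P → (p.1, p.2 + 1) ∈ X
  side : ∀ p ∈ X, ∀ q ∈ P, q.2 = p.2 → (q.1 = p.1 + 1 ∨ p.1 = q.1 + 1) → q ∈ X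

/-- Each tile of the tab is pushed straight down to the first tile outside it. By the closure of
tabs under neighbours, horizontally adjacent tiles of the tab drop equally far, so a path in `P`
becomes a path that avoids the tab. -/
theorem IsTab.isPolyomino_sdiff {P X : Finset Cell} (hP : IsPolyomino P) (hX : IsTab P X) :
    IsPolyomino (P \ X) := by
  obtain ⟨p₀, h₀, hmin⟩ := Finset.exists_min_image P Prod.snd hP.nonempty
  have h₀X : p₀ ∉ X := fun h => by
    have := hmin _ (hX.below _ h)
    simp only at this
    omega
  refine isPolyomino_of_induction (p₀ := p₀) (Finset.mem_sdiff.2 ⟨h₀, h₀X⟩) ?_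
  intro motive base step
  have key := hP.induction (motive := fun p => ∃ j : ℕ, (p.1, p.2 - j) ∈ P \ X ∧
    motive (p.1, p.2 - j) ∧ ∀ i : ℕ, i < j → (p.1, p.2 - i) ∈ X) h₀
    ⟨0, by simpa using ⟨h₀, h₀X⟩, by simpa using base, by simp⟩ ?_
  · intro p hp
    obtain ⟨hpP, hpX⟩ := Finset.mem_sdiff.1 hp
    obtain ⟨j, -, h2, h3⟩ := key p hpP
    rcases Nat.eq_zero_or_pos j with rfl | hj
    · simpa using h2
    · exact absurd (by simpa using h3 0 hj) hpX
  · rintro ⟨px, py⟩ hp ⟨qx, qy⟩ hq hadj ⟨j, h1, h2, h3⟩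
    simp only at h1 h2 h3 ⊢
    have same : j = 0 → (qx, qy) ∉ X → ∃ j : ℕ, (qx, qy - j) ∈ P \ X ∧ motive (qx, qy - j) ∧
        ∀ i : ℕ, i < j → (qx, qy - i) ∈ X := by
      rintro rfl hqX
      simp only [Nat.cast_zero, sub_zero] at h1 h2
      have hq' := Finset.mem_sdiff.2 ⟨hq, hqX⟩
      exact ⟨0, by simpa using hq', by simpa using step _ h1 _ hq' hadj h2, by simp⟩
    have hj0 : j = 0 → (px, py) ∉ X := by
      rintro rfl
      simpa using (Finset.mem_sdiff.1 h1).2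
    have hjp : 0 < j → (px, py) ∈ X := fun h => by simpa using h3 0 h
    rw [adj_iff] at hadj
    simp only at hadj
    rcases hadj with ⟨rfl, rfl | rfl⟩ | ⟨rfl, hx⟩
    · by_cases hqX : (px, py + 1) ∈ X
      · refine ⟨j + 1, ?_, ?_, ?_⟩
        · rwa [show py + 1 - ((j + 1 : ℕ) : ℤ) = py - j by push_cast; ring]
        · rwa [show py + 1 - ((j + 1 : ℕ) : ℤ) = py - j by push_cast; ring]
        · rintro (_ | i) hi
          · simpa using hqX
          · rw [show py + 1 - ((i + 1 : ℕ) : ℤ) = py - i by push_cast; ring]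
            exact h3 i (by omega)
      · rcases Nat.eq_zero_or_pos j with hj | hj
        · exact same hj hqX
        · exact absurd (hX.above _ (hjp hj) hq) hqX
    · rcases Nat.eq_zero_or_pos j with hj | hj
      · exact same hj fun h => hj0 hj (hX.above _ h hp)
      · obtain ⟨j, rfl⟩ := Nat.exists_eq_succ_of_ne_zero hj.ne'
        have e : ∀ i : ℕ, qy + 1 - ((i + 1 : ℕ) : ℤ) = qy - i := fun i => by push_cast; ring
        rw [Nat.succ_eq_add_one, e] at h1 h2
        exact ⟨j, h1, h2, fun i hi => by rw [← e]; exact h3 (i + 1) (by omega)⟩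
    · rcases Nat.eq_zero_or_pos j with hj | hj
      · exact same hj fun h => hj0 hj (hX.side _ h _ hp rfl (by simp only; omega))
      · have hall : ∀ i : ℕ, i < j → (qx, py - i) ∈ X := by
          intro i
          induction i with
          | zero => exact fun _ => hX.side _ (hjp hj) _ (by simpa using hq) (by simp) hx
          | succ i ih =>
            intro hi
            have := hX.below _ (ih (by omega))
            simp only at this
            refine hX.side _ (h3 (i + 1) hi) _ ?_ rfl hx
            rwa [show py - ((i + 1 : ℕ) : ℤ) = py - i - 1 by push_cast; ring]
        have hq' : (qx, py - j) ∈ P := by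
          obtain ⟨j, rfl⟩ := Nat.exists_eq_succ_of_ne_zero hj.ne'
          have := hX.below _ (hall j (by omega))
          simp only at this
          rwa [show py - ((j.succ : ℕ) : ℤ) = py - j - 1 by push_cast; ring]
        obtain ⟨hpj, hpjX⟩ := Finset.mem_sdiff.1 h1
        have hqd : (qx, py - (j : ℤ)) ∈ P \ X := Finset.mem_sdiff.2 ⟨hq', fun h =>
          hpjX (hX.side _ h _ hpj rfl (by simp only; omega))⟩
        exact ⟨j, hqd, step _ h1 _ hqd (adj_iff.2 (Or.inr ⟨rfl, hx⟩)) h2, hall⟩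

theorem StraightTwoCuttable.isPolyomino {P : Finset Cell} (h : StraightTwoCuttable P) :
    IsPolyomino P := by
  cases h with
  | monotone hP _ => exact hP
  | cut h _ _ => exact h.1.polyomino

/-- If a cell between two remaining cells on a convex line were in the tab, the tab would continue
up to the far one. -/
theorem IsTab.isMonotone_sdiff {P X : Finset Cell} (hX : IsTab P X) (hm : IsMonotone P) :
    IsMonotone (P \ X) := by
  rcases hm with hm | hm
  · left
    intro x y₁ y₂ y h1 h2 h3 h4
    rw [Finset.mem_sdiff] at h1 h2 ⊢
    refine ⟨hm x y₁ y₂ y h1.1 h2.1 h3 h4, fun hy => h2.2 ?_⟩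
    have key : ∀ y', y ≤ y' → y' ≤ y₂ → (x, y') ∈ X := by
      intro y' hy'
      induction y', hy' using Int.leInduction with
      | base => exact fun _ => hy
      | succ y' hy' ih =>
        intro h5
        exact hX.above _ (ih (by omega)) (hm x y₁ y₂ _ h1.1 h2.1 (by omega) h5)
    exact key y₂ h4 le_rfl
  · right
    intro y x₁ x₂ x h1 h2 h3 h4
    rw [Finset.mem_sdiff] at h1 h2 ⊢
    refine ⟨hm y x₁ x₂ x h1.1 h2.1 h3 h4, fun hy => h2.2 ?_⟩
    have key : ∀ x', x ≤ x' → x' ≤ x₂ → (x', y) ∈ X := by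
      intro x' hx'
      induction x', hx' using Int.leInduction with
      | base => exact fun _ => hy
      | succ x' hx' ih =>
        intro h5
        exact hX.side _ (ih (by omega)) _ (hm y x₁ x₂ _ h1.1 h2.1 (by omega) h5) rfl (Or.inl rfl)
    exact key x₂ h4 le_rfl

theorem IsTab.inter {P A X : Finset Cell} (hX : IsTab P X) (hAP : ∀ p ∈ A, p ∈ P)
    (hb : ∀ p ∈ X, p ∈ A → (p.1, p.2 - 1) ∈ A) : IsTab A (X ∩ A) where
  subset _ hp := (Finset.mem_inter.1 hp).2
  below p hp := hb p (Finset.mem_inter.1 hp).1 (Finset.mem_inter.1 hp).2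
  above p hp h := Finset.mem_inter.2 ⟨hX.above p (Finset.mem_inter.1 hp).1 (hAP _ h), h⟩
  side p hp q hq h1 h2 :=
    Finset.mem_inter.2 ⟨hX.side p (Finset.mem_inter.1 hp).1 q (hAP _ hq) h1 h2, hq⟩

theorem sdiff_inter_right (A X : Finset Cell) : A \ (X ∩ A) = A \ X := by
  ext p; simp only [Finset.mem_sdiff, Finset.mem_inter]; tauto

/-- The same cuts work for what remains. The tab restricts to a tab of each piece unless a
horizontal cut separates one of its tiles from the tile below; then the upper piece lies entirely in
the tab and disappears, together with the cut. -/
theorem StraightTwoCuttable.sdiff_tab {P X : Finset Cell} (hP : StraightTwoCuttable P)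
    (hX : IsTab P X) : StraightTwoCuttable (P \ X) := by
  induction hP generalizing X with
  | monotone hP hm => exact .monotone (hX.isPolyomino_sdiff hP) (hX.isMonotone_sdiff hm)
  | @cut P A B hc hA hB ihA ihB =>
    -- the case in which both pieces keep a tab
    have both : ∀ {A B : Finset Cell}, IsValidStraightTwoCut P A B →
        StraightTwoCuttable (A \ X) → StraightTwoCuttable (B \ X) →
        StraightTwoCuttable (P \ X) := by
      intro A B hc hA hB
      obtain ⟨h1, d, h2, h3⟩ := hc
      refine .cut ⟨⟨hX.isPolyomino_sdiff h1.polyomino, ?_, ?_, hA.isPolyomino, hB.isPolyomino⟩,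
        d, ?_, ?_⟩ hA hB
      · rw [← Finset.union_sdiff_distrib, h1.union]
      · exact h1.disjoint.mono Finset.sdiff_subset Finset.sdiff_subset
      · exact fun a ha b hb => h2 a (Finset.mem_sdiff.1 ha).1 b (Finset.mem_sdiff.1 hb).1
      · exact fun k hk a ha b hb =>
          h3 k hk a (Finset.mem_sdiff.1 ha).1 b (Finset.mem_sdiff.1 hb).1
    -- the upper piece is either contained in `X` or keeps a tab
    have up : ∀ {A B : Finset Cell}, IsTwoCut P A B → IsStraightCut .up A B →
        CanPullApart .up A B → (∀ {X}, IsTab A X → StraightTwoCuttable (A \ X)) →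
        (∀ {X}, IsTab B X → StraightTwoCuttable (B \ X)) → StraightTwoCuttable (P \ X) := by
      intro A B hc hs hp ihA ihB
      have tA := ihA (hX.inter (fun _ => hc.left_subset) fun _ hpX hpA =>
        hc.mem_left_of_adj hs hpA (hX.below _ hpX) (by rw [adj_iff]; simp) fun h => by
          have := congrArg Prod.snd h
          simp [Dir.vec] at this
          omega)
      rw [sdiff_inter_right] at tA
      have sideA : ∀ p q : Cell, p ∈ A → q ∈ P → q.2 = p.2 → (q.1 = p.1 + 1 ∨ p.1 = q.1 + 1) →
          q ∈ A := fun p q hpA hq h1 h2 =>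
        hc.mem_left_of_adj hs hpA hq (by rw [adj_iff]; omega) fun h => by
          have := congrArg Prod.snd h
          simp [Dir.vec] at this
          omega
      have sideB : ∀ p q : Cell, p ∈ B → q ∈ P → q.2 = p.2 → (q.1 = p.1 + 1 ∨ p.1 = q.1 + 1) →
          q ∈ B := fun p q hpB hq h1 h2 =>
        hc.mem_right_of_adj hs hpB hq (by rw [adj_iff]; omega) fun h => by
          have := congrArg Prod.snd h
          simp [Dir.vec] at this
          omega
      by_cases hb : ∀ p ∈ X, p ∈ B → (p.1, p.2 - 1) ∈ B
      · have tB := ihB (hX.inter (fun _ => hc.right_subset) hb)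
        rw [sdiff_inter_right] at tB
        exact both ⟨hc, _, hs, hp⟩ tA tB
      · push Not at hb
        obtain ⟨x, hxX, hxB, hxb⟩ := hb
        have hxA := (hc.mem_or (hX.below x hxX)).resolve_right hxb
        -- Propagated through the connected piece `B`: below every tile, a column of tiles of `X` in
        -- `B` leads down to `A`.
        have hBX : ∀ p ∈ B, ∃ j : ℕ, 0 < j ∧ (∀ i : ℕ, i < j → (p.1, p.2 - i) ∈ X ∧
            (p.1, p.2 - i) ∈ B) ∧ (p.1, p.2 - j) ∈ A := by
          refine hc.right.induction hxB ⟨1, one_pos, fun i hi => ?_, by simpa using hxA⟩ ?_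
          · obtain rfl : i = 0 := by omega
            simpa using ⟨hxX, hxB⟩
          · rintro ⟨px, py⟩ hpB ⟨qx, qy⟩ hqB hadj ⟨j, h1, h2, h3⟩
            simp only at h2 h3 ⊢
            have hpX : (px, py) ∈ X := by simpa using (h2 0 h1).1
            rw [adj_iff] at hadj
            simp only at hadj
            rcases hadj with ⟨rfl, rfl | rfl⟩ | ⟨rfl, hx⟩
            · have e : ∀ i : ℕ, py + 1 - ((i + 1 : ℕ) : ℤ) = py - i := fun i => by
                push_cast; ring
              refine ⟨j + 1, by omega, ?_, by rwa [e]⟩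
              rintro (_ | i) hi
              · simpa using ⟨hX.above _ hpX (hc.right_subset hqB), hqB⟩
              · rw [e]
                exact h2 i (by omega)
            · have e : ∀ i : ℕ, qy + 1 - ((i + 1 : ℕ) : ℤ) = qy - i := fun i => by
                push_cast; ring
              obtain ⟨j, rfl⟩ := Nat.exists_eq_succ_of_ne_zero h1.ne'
              rw [Nat.succ_eq_add_one, e] at h3
              rcases Nat.eq_zero_or_pos j with rfl | hj
              · exact absurd hqB (hc.not_right (by simpa using h3))
              · exact ⟨j, hj, fun i hi => by rw [← e]; exact h2 (i + 1) (by omega), h3⟩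
            · have hall : ∀ i : ℕ, i < j → (qx, py - i) ∈ X ∧ (qx, py - i) ∈ B := by
                intro i
                induction i with
                | zero =>
                  intro _
                  simpa using ⟨hX.side _ hpX _ (hc.right_subset hqB) rfl hx, hqB⟩
                | succ i ih =>
                  intro hi
                  have hP' := hX.below _ (ih (by omega)).1
                  simp only at hP'
                  rw [show py - (i : ℤ) - 1 = py - ((i + 1 : ℕ) : ℤ) by push_cast; ring] at hP'
                  obtain ⟨g1, g2⟩ := h2 (i + 1) hi
                  exact ⟨hX.side _ g1 _ hP' rfl hx, sideB _ _ g2 hP' rfl hx⟩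
              refine ⟨j, h1, hall, ?_⟩
              obtain ⟨j, rfl⟩ := Nat.exists_eq_succ_of_ne_zero h1.ne'
              have hP' := hX.below _ (hall j (by omega)).1
              simp only at hP'
              rw [show py - (j : ℤ) - 1 = py - ((j + 1 : ℕ) : ℤ) by push_cast; ring] at hP'
              exact sideA _ _ h3 hP' rfl hx
        have : P \ X = A \ X := by
          ext p
          simp only [Finset.mem_sdiff]
          refine ⟨fun h => ⟨(hc.mem_or h.1).resolve_right fun hpB => h.2 ?_, h.2⟩,
            fun h => ⟨hc.left_subset h.1, h.2⟩⟩
          obtain ⟨j, hj, h2, -⟩ := hBX p hpB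
          simpa using (h2 0 hj).1
        rw [this]
        exact tA
    have hc' := hc
    obtain ⟨h1, d, h2, h3⟩ := hc
    have h1' := hc'.symm.1
    have horizontal : d.vec.2 = 0 → StraightTwoCuttable (P \ X) := by
      intro hd
      have tA := ihA (hX.inter (fun _ => h1.left_subset) fun p hpX hpA =>
        h1.mem_left_of_adj h2 hpA (hX.below p hpX) (by rw [adj_iff]; simp) fun h => by
          have := congrArg Prod.snd h
          simp only [Prod.snd_add, hd] at this
          omega)
      have tB := ihB (hX.inter (fun _ => h1.right_subset) fun p hpX hpB =>
        h1.mem_right_of_adj h2 hpB (hX.below p hpX) (by rw [adj_iff]; simp) fun h => by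
          have := congrArg Prod.snd h
          simp only [Prod.snd_add, hd] at this
          omega)
      rw [sdiff_inter_right] at tA tB
      exact both hc' tA tB
    cases d with
    | right => exact horizontal rfl
    | left => exact horizontal rfl
    | up => exact up h1 h2 h3 ihA ihB
    | down => exact up h1' h2.symm h3.symm ihB ihA

/-! ### Rectangles -/

theorem isPolyomino_rect {x₁ x₂ y₁ y₂ : ℤ} (hx : x₁ ≤ x₂) (hy : y₁ ≤ y₂) :
    IsPolyomino (rect x₁ x₂ y₁ y₂) := by
  refine isPolyomino_of_induction (p₀ := (x₁, y₁)) (mem_rect.2 ⟨⟨le_rfl, hx⟩, le_rfl, hy⟩) ?_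
  intro motive base step
  have hrow : ∀ x, x₁ ≤ x → x ≤ x₂ → motive (x, y₁) := by
    intro x h1
    induction x, h1 using Int.leInduction with
    | base => exact fun _ => base
    | succ x h1 ih =>
      intro h2
      exact step (x, y₁) (mem_rect.2 ⟨⟨h1, by simp only; omega⟩, le_rfl, hy⟩) _
        (mem_rect.2 ⟨⟨by simp only; omega, h2⟩, le_rfl, hy⟩) (by rw [adj_iff]; simp) (ih (by omega))
  have hcol : ∀ x y, x₁ ≤ x → x ≤ x₂ → y₁ ≤ y → y ≤ y₂ → motive (x, y) := by
    intro x y h1 h2 h3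
    induction y, h3 using Int.leInduction with
    | base => exact fun _ => hrow x h1 h2
    | succ y h3 ih =>
      intro h4
      exact step (x, y) (mem_rect.2 ⟨⟨h1, h2⟩, h3, by simp only; omega⟩) _
        (mem_rect.2 ⟨⟨h1, h2⟩, by simp only; omega, h4⟩) (by rw [adj_iff]; simp) (ih (by omega))
  intro p hp
  obtain ⟨⟨h1, h2⟩, h3, h4⟩ := mem_rect.1 hp
  exact hcol p.1 p.2 h1 h2 h3 h4

/-- A maximal run of cells in a row. -/
structure IsRow (P : Finset Cell) (x₁ x₂ y : ℤ) : Prop where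
  mem : ∀ x, x₁ ≤ x → x ≤ x₂ → (x, y) ∈ P
  left : (x₁ - 1, y) ∉ P
  right : (x₂ + 1, y) ∉ P

/-- Going along the run, the adjacent row can begin or end only at a corner. -/
theorem IsRow.next_mem {P : Finset Cell} {x₁ x₂ y s : ℤ} (h : IsRow P x₁ x₂ y)
    (hP : ∀ t sx, (sx = 1 ∨ sx = -1) → x₁ ≤ t → t ≤ x₂ → ¬ Corner P (t, y) sx s)
    {x : ℤ} (h1 : x₁ ≤ x) (h2 : x ≤ x₂) (hx : (x, y + s) ∈ P) :
    ∀ x', x₁ ≤ x' → x' ≤ x₂ → (x', y + s) ∈ P := by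
  have hright : ∀ x', x ≤ x' → x' ≤ x₂ → (x', y + s) ∈ P := by
    intro x' h3
    induction x', h3 using Int.leInduction with
    | base => exact fun _ => hx
    | succ x' h3 ih =>
      intro h4
      by_contra hn
      exact hP x' 1 (Or.inl rfl) (by omega) (by omega)
        ⟨h.mem x' (by omega) (by omega), h.mem _ (by omega) h4, ih (by omega), hn⟩
  have hleft : ∀ x', x' ≤ x → x₁ ≤ x' → (x', y + s) ∈ P := by
    intro x' h3
    induction x', h3 using Int.leInductionDown with
    | base => exact fun _ => hx
    | pred x' h3 ih =>
      intro h4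
      by_contra hn
      exact hP x' (-1) (Or.inr rfl) (by omega) (by omega)
        ⟨h.mem x' (by omega) (by omega), h.mem _ h4 (by omega), ih (by omega), hn⟩
  exact fun x' h3 h4 => (le_total x' x).elim (fun h => hleft x' h h3) (fun h => hright x' h h4)

theorem IsRow.next {P : Finset Cell} {x₁ x₂ y s : ℤ} (h : IsRow P x₁ x₂ y)
    (hP : ∀ t sx, (sx = 1 ∨ sx = -1) → x₁ ≤ t → t ≤ x₂ → ¬ Corner P (t, y) sx s)
    (hP' : ∀ t sx, (sx = 1 ∨ sx = -1) → x₁ ≤ t → t ≤ x₂ → ¬ Corner P (t, y + s) sx (-s))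
    {x : ℤ} (h1 : x₁ ≤ x) (h2 : x ≤ x₂) (hx : (x, y + s) ∈ P) : IsRow P x₁ x₂ (y + s) := by
  have hmem := h.next_mem hP h1 h2 hx
  have h12 := h1.trans h2
  refine ⟨hmem, fun hm => ?_, fun hm => ?_⟩
  · refine hP' x₁ (-1) (Or.inr rfl) le_rfl h12 ⟨hmem x₁ le_rfl h12, hm, ?_, ?_⟩
    · simpa using h.mem x₁ le_rfl h12
    · simpa [← sub_eq_add_neg] using h.left
  · refine hP' x₂ 1 (Or.inl rfl) h12 le_rfl ⟨hmem x₂ h12 le_rfl, hm, ?_, ?_⟩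
    · simpa using h.mem x₂ h12 le_rfl
    · simpa using h.right

/-- A polyomino whose rows `y₁, …, y₂` between `x₁` and `x₂` are full, and that does not continue
beyond them, is a rectangle. -/
theorem eq_rect_of_isRow {P : Finset Cell} (hP : IsPolyomino P) {x₁ x₂ y₁ y₂ : ℤ} (hx : x₁ ≤ x₂)
    (hy : y₁ ≤ y₂) (hrow : ∀ y, y₁ ≤ y → y ≤ y₂ → IsRow P x₁ x₂ y)
    (hbelow : ∀ x, x₁ ≤ x → x ≤ x₂ → (x, y₁ - 1) ∉ P)
    (habove : ∀ x, x₁ ≤ x → x ≤ x₂ → (x, y₂ + 1) ∉ P) : P = rect x₁ x₂ y₁ y₂ := by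
  have key : ∀ p ∈ P, p ∈ rect x₁ x₂ y₁ y₂ := by
    refine hP.induction (p₀ := (x₁, y₁)) ((hrow y₁ le_rfl hy).mem x₁ le_rfl hx)
      (mem_rect.2 ⟨⟨le_rfl, hx⟩, le_rfl, hy⟩) ?_
    rintro ⟨px, py⟩ - ⟨qx, qy⟩ hq hadj hp
    rw [mem_rect] at hp ⊢
    rw [adj_iff] at hadj
    simp only at hp hadj ⊢
    have c1 : ¬ (qx = x₁ - 1 ∧ y₁ ≤ qy ∧ qy ≤ y₂) := by
      rintro ⟨rfl, h1, h2⟩; exact (hrow qy h1 h2).left hq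
    have c2 : ¬ (qx = x₂ + 1 ∧ y₁ ≤ qy ∧ qy ≤ y₂) := by
      rintro ⟨rfl, h1, h2⟩; exact (hrow qy h1 h2).right hq
    have c3 : ¬ (qy = y₁ - 1 ∧ x₁ ≤ qx ∧ qx ≤ x₂) := by
      rintro ⟨rfl, h1, h2⟩; exact hbelow qx h1 h2 hq
    have c4 : ¬ (qy = y₂ + 1 ∧ x₁ ≤ qx ∧ qx ≤ x₂) := by
      rintro ⟨rfl, h1, h2⟩; exact habove qx h1 h2 hq
    omega
  ext p
  refine ⟨key p, fun hp => ?_⟩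
  obtain ⟨⟨h1, h2⟩, h3, h4⟩ := mem_rect.1 hp
  exact (hrow p.2 h3 h4).mem p.1 h1 h2

/-- A run of a predicate with bounded support is finite. -/
theorem exists_max_run (p : ℤ → Prop) {N a : ℤ} (hN : ∀ x, p x → x ≤ N) (ha : p a) :
    ∃ x, a ≤ x ∧ (∀ x', a ≤ x' → x' ≤ x → p x') ∧ ¬ p (x + 1) := by
  obtain ⟨x, h1, h2, h3, h4⟩ := exists_run_right p (hN a ha) ha
  refine ⟨x, h1, h3, h4.elim (fun h hp => ?_) id⟩
  have := hN _ hp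
  omega

theorem exists_min_run (p : ℤ → Prop) {N a : ℤ} (hN : ∀ x, p x → N ≤ x) (ha : p a) :
    ∃ x, x ≤ a ∧ (∀ x', x ≤ x' → x' ≤ a → p x') ∧ ¬ p (x - 1) := by
  obtain ⟨x, h1, h2, h3, h4⟩ := exists_run_left p (hN a ha) ha
  refine ⟨x, h2, h3, h4.elim (fun h hp => ?_) id⟩
  have := hN _ hp
  omega

theorem exists_isRow {P : Finset Cell} {a : Cell} (ha : a ∈ P) :
    ∃ x₁ x₂, x₁ ≤ a.1 ∧ a.1 ≤ x₂ ∧ IsRow P x₁ x₂ a.2 := by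
  obtain ⟨N, hN⟩ := exists_bound P.finite_toSet
  obtain ⟨x₁, a1, a2, a3⟩ := exists_min_run (fun x => (x, a.2) ∈ P) (N := -N)
    (fun x hx => (hN _ hx).1) ha
  obtain ⟨x₂, b1, b2, b3⟩ := exists_max_run (fun x => (x, a.2) ∈ P) (N := N)
    (fun x hx => (hN _ hx).2.1) ha
  exact ⟨x₁, x₂, a1, b1, fun x h1 h2 => (le_total x a.1).elim (a2 x h1) (fun h => b2 x h h2), a3, b3⟩

/-- Without corners, a maximal run is repeated unchanged in the rows above and below for as long as
they have any tile next to it. -/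
theorem exists_eq_rect {P : Finset Cell} (hP : IsPolyomino P) (hc : ∀ t sx sy,
    (sx = 1 ∨ sx = -1) → (sy = 1 ∨ sy = -1) → ¬ Corner P t sx sy) :
    ∃ x₁ x₂ y₁ y₂, x₁ ≤ x₂ ∧ y₁ ≤ y₂ ∧ P = rect x₁ x₂ y₁ y₂ := by
  obtain ⟨a, ha⟩ := hP.nonempty
  obtain ⟨N, hN⟩ := exists_bound P.finite_toSet
  obtain ⟨x₁, x₂, hx₁, hx₂, hr⟩ := exists_isRow ha
  have hb : ∀ y, IsRow P x₁ x₂ y → -(N : ℤ) ≤ y ∧ y ≤ N := fun y h =>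
    (hN _ (h.mem x₁ le_rfl (by omega))).2.2
  obtain ⟨y₁, a1, a2, a3⟩ := exists_min_run (IsRow P x₁ x₂) (fun y h => (hb y h).1) hr
  obtain ⟨y₂, b1, b2, b3⟩ := exists_max_run (IsRow P x₁ x₂) (fun y h => (hb y h).2) hr
  refine ⟨x₁, x₂, y₁, y₂, by omega, by omega, eq_rect_of_isRow hP (by omega) (by omega)
    (fun y h1 h2 => (le_total y a.2).elim (a2 y h1) (fun h => b2 y h h2)) ?_ ?_⟩
  · exact fun x h1 h2 hm => a3 ((a2 y₁ le_rfl a1).next (fun t sx hs _ _ => hc _ _ _ hs (Or.inr rfl))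
      (fun t sx hs _ _ => hc _ _ _ hs (Or.inl (neg_neg 1))) h1 h2 hm)
  · exact fun x h1 h2 hm => b3 ((b2 y₂ b1 le_rfl).next (fun t sx hs _ _ => hc _ _ _ hs (Or.inl rfl))
      (fun t sx hs _ _ => hc _ _ _ hs (Or.inr rfl)) h1 h2 hm)

/-! ### Cutting off ends -/

/-- `P` is a rectangle, or a valid straight cut splits off a rectangle and reduces complexity. -/
def Improvable (P : Finset Cell) : Prop :=
  (∃ x₁ x₂ y₁ y₂, P = rect x₁ x₂ y₁ y₂) ∨ ∃ A B : Finset Cell, IsValidStraightTwoCut P A B ∧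
    (∃ x₁ x₂ y₁ y₂, A = rect x₁ x₂ y₁ y₂) ∧ StraightTwoCuttable B ∧ complexity B < complexity P

/-- A valid cut that separates the upper end of `P`. -/
theorem isValidStraightTwoCut_end {P : Finset Cell} (hP : IsPolyomino P) {x₁ x₂ y₁ y₂ : ℤ}
    (hx : x₁ ≤ x₂) (hy : y₁ ≤ y₂) (hrow : ∀ y, y₁ ≤ y → y ≤ y₂ → IsRow P x₁ x₂ y)
    (hbelow : ∀ x, x₁ ≤ x → x ≤ x₂ → (x, y₁ - 1) ∈ P)
    (habove : ∀ x y, x₁ ≤ x → x ≤ x₂ → y₂ < y → (x, y) ∉ P)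
    (hfree : ∀ y, y₂ < y → (x₁ - 1, y) ∉ P ∧ (x₂ + 1, y) ∉ P) :
    IsTab P (rect x₁ x₂ y₁ y₂) ∧
      IsValidStraightTwoCut P (rect x₁ x₂ y₁ y₂) (P \ rect x₁ x₂ y₁ y₂) := by
  have hsub : ∀ p ∈ rect x₁ x₂ y₁ y₂, p ∈ P := by
    intro p hp
    obtain ⟨⟨h1, h2⟩, h3, h4⟩ := mem_rect.1 hp
    exact (hrow p.2 h3 h4).mem p.1 h1 h2
  have hside : ∀ x y, y₁ ≤ y → (x, y) ∈ P → ¬ (x = x₁ - 1) ∧ ¬ (x = x₂ + 1) := by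
    intro x y h1 h2
    rcases lt_or_ge y₂ y with h | h
    · exact ⟨by rintro rfl; exact (hfree y h).1 h2, by rintro rfl; exact (hfree y h).2 h2⟩
    · exact ⟨by rintro rfl; exact (hrow y h1 h).left h2, by rintro rfl; exact (hrow y h1 h).right h2⟩
  have hab : ∀ x y, (x, y) ∈ P → x₁ ≤ x → x ≤ x₂ → y ≤ y₂ := fun x y h h1 h2 =>
    not_lt.1 fun hlt => habove x y h1 h2 hlt h
  have hT : IsTab P (rect x₁ x₂ y₁ y₂) := by
    refine ⟨hsub, ?_, ?_, ?_⟩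
    · intro p hp
      rw [mem_rect] at hp
      rcases eq_or_ne p.2 y₁ with h | h
      · rw [h]; exact hbelow p.1 hp.1.1 hp.1.2
      · exact hsub _ (mem_rect.2 (by simp only; omega))
    · intro p hp h
      rw [mem_rect] at hp ⊢
      have := hab _ _ h hp.1.1 hp.1.2
      simp only
      omega
    · intro p hp q hq h1 h2
      rw [mem_rect] at hp ⊢
      have := hside q.1 q.2 (by omega) hq
      omega
  refine ⟨hT, ⟨hP, Finset.union_sdiff_of_subset hsub, Finset.disjoint_sdiff,
    isPolyomino_rect hx hy, hT.isPolyomino_sdiff hP⟩, .down, ?_, ?_⟩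
  · intro a ha b hb hab'
    rw [Finset.mem_sdiff, mem_rect] at hb
    rw [mem_rect] at ha
    have g1 := hside b.1 b.2
    have g2 := hab b.1 b.2 hb.1
    rw [adj_iff] at hab'
    have hb' : ¬ ((x₁ ≤ b.1 ∧ b.1 ≤ x₂) ∧ y₁ ≤ b.2 ∧ b.2 ≤ y₂) := hb.2
    have : b.1 = a.1 ∧ b.2 = a.2 - 1 := by
      by_cases h : y₁ ≤ b.2
      · have := g1 h hb.1
        omega
      · omega
    ext <;> simp [Dir.vec] <;> omega
  · intro k hk a ha b hb
    rw [Finset.mem_sdiff, mem_rect] at hb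
    rw [mem_rect] at ha
    have g1 := hside b.1 b.2
    have g2 := hab b.1 b.2 hb.1
    have hb' : ¬ ((x₁ ≤ b.1 ∧ b.1 ≤ x₂) ∧ y₁ ≤ b.2 ∧ b.2 ≤ y₂) := hb.2
    have key : ¬ (y₁ ≤ b.2 ∧ x₁ - 1 ≤ b.1 ∧ b.1 ≤ x₂ + 1) := by
      rintro ⟨h1, h2⟩
      have := g1 h1 hb.1
      omega
    refine ⟨?_, fun h => ?_⟩
    · rintro rfl
      simp [Dir.vec] at key
      omega
    · rw [adj_iff] at h
      simp [Dir.vec] at h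
      omega

theorem settled_flipX {P : Finset Cell} {z : Cell} (h : Settled P z) :
    Settled (P.map flipX.toEmbedding) (flipX z) := by
  obtain ⟨x₁, x₂, y₂, h1, h2, h3, h4, h5, h6, h7⟩ := h
  have hm : ∀ x y : ℤ, (x, y) ∈ P.map flipX.toEmbedding ↔ (-x, y) ∈ P := fun x y => by
    rw [isSym_flipX.mem_map]; rfl
  have hcol : ∀ x y : ℤ, tileColour (-x, y) = tileColour (x, y) := fun x y =>
    isSym_flipX.colour (x, y)
  refine ⟨-x₂, -x₁, y₂, by simpa using h2, by simpa using h1, h3, ?_, ?_, ?_, ?_⟩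
  · intro x y g1 g2 g3 g4
    exact (hm x y).2 (h4 _ _ (by omega) (by omega) g3 g4)
  · intro y g1 g2
    rw [hm, hm]
    have := h5 y g1 g2
    rw [show -(-x₂ - 1) = x₂ + 1 by ring, show -(-x₁ + 1) = x₁ - 1 by ring]
    exact this.symm
  · intro x y g1 g2 g3
    rw [hm]
    exact h6 _ _ (by omega) (by omega) g3
  · intro y g
    rw [hm, hm, hcol, hcol, ← hcol (-x₂ - 1), ← hcol (-x₁ + 1),
      show -(-x₂ - 1) = x₂ + 1 by ring, show -(-x₁ + 1) = x₁ - 1 by ring]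
    exact (h7 y g).symm

/-! ### Symmetries of straight 2-cuttable polyominoes -/

/-- A symmetry of the grid that preserves monotone polyominoes, rectangles and complexity. -/
structure IsShapeSym (e : Cell ≃ Cell) (δ : Dir → Dir) : Prop extends IsSym e δ where
  monotone : ∀ P, IsMonotone P → IsMonotone (P.map e.toEmbedding)
  rect : ∀ x₁ x₂ y₁ y₂, ∃ x₁' x₂' y₁' y₂',
    (rect x₁ x₂ y₁ y₂).map e.toEmbedding = TiltAssembly.rect x₁' x₂' y₁' y₂'
  complexity : ∀ P, complexity (P.map e.toEmbedding) = TiltAssembly.complexity P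

theorem isShapeSym_diag : IsShapeSym diag diagDir where
  toIsSym := isSym_diag
  monotone P h := by
    rcases h with h | h
    · refine Or.inr fun y x₁ x₂ x h1 h2 h3 h4 => ?_
      rw [isSym_diag.mem_map] at *
      exact h y x₁ x₂ x h1 h2 h3 h4
    · refine Or.inl fun x y₁ y₂ y h1 h2 h3 h4 => ?_
      rw [isSym_diag.mem_map] at *
      exact h x y₁ y₂ y h1 h2 h3 h4
  rect x₁ x₂ y₁ y₂ := ⟨y₁, y₂, x₁, x₂, by
    ext p; rw [isSym_diag.mem_map, mem_rect, mem_rect, diag_apply]; tauto⟩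
  complexity := complexity_diag

theorem isShapeSym_flipY : IsShapeSym flipY flipYDir where
  toIsSym := isSym_flipY
  monotone P h := by
    rcases h with h | h
    · refine Or.inl fun x y₁ y₂ y h1 h2 h3 h4 => ?_
      rw [isSym_flipY.mem_map] at *
      exact h x (-y₂) (-y₁) (-y) h2 h1 (by omega) (by omega)
    · refine Or.inr fun y x₁ x₂ x h1 h2 h3 h4 => ?_
      rw [isSym_flipY.mem_map] at *
      exact h (-y) x₁ x₂ x h1 h2 h3 h4
  rect x₁ x₂ y₁ y₂ := ⟨x₁, x₂, -y₂, -y₁, by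
    ext p; rw [isSym_flipY.mem_map, mem_rect, mem_rect, flipY_apply]; simp only; omega⟩
  complexity := complexity_flipY

section Sym

variable {e : Cell ≃ Cell} {δ : Dir → Dir} {P : Finset Cell}

theorem StraightTwoCuttable.map (h : IsShapeSym e δ) (hP : StraightTwoCuttable P) :
    StraightTwoCuttable (P.map e.toEmbedding) := by
  induction hP with
  | monotone hP hm => exact .monotone (h.isPolyomino hP) (h.monotone _ hm)
  | cut hc _ _ ihA ihB => exact .cut (hc.map h.toIsSym) ihA ihB

theorem Improvable.of_map (h : IsShapeSym e δ) (hP : Improvable (P.map e.toEmbedding)) :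
    Improvable P := by
  rcases hP with ⟨x₁, x₂, y₁, y₂, hr⟩ | ⟨A, B, hc, ⟨x₁, x₂, y₁, y₂, hr⟩, hB, hμ⟩
  · left
    rw [← h.map_map P, hr]
    exact h.rect x₁ x₂ y₁ y₂
  · right
    have hc' := hc.map h.toIsSym
    rw [h.map_map] at hc'
    refine ⟨_, _, hc', ?_, hB.map h, ?_⟩
    · rw [hr]
      exact h.rect x₁ x₂ y₁ y₂
    · rwa [h.complexity, ← h.complexity P]

end Sym

/-! ### Cuts that reduce complexity -/

section Cut

variable {P A B : Finset Cell}

theorem settled_flipX_iff {z : Cell} :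
    Settled (P.map flipX.toEmbedding) (flipX z) ↔ Settled P z := by
  refine ⟨fun h => ?_, settled_flipX⟩
  have := settled_flipX h
  rwa [isSym_flipX.map_map, isSym_flipX.apply_apply] at this

theorem complexity_lt_of_feature_flipX (hc : IsValidStraightTwoCut P A B) {i : Fin 4} {t : Cell}
    (hP : Feature (P.map flipX.toEmbedding) i (flipX t))
    (hB : ¬ Feature (B.map flipX.toEmbedding) i (flipX t)) : complexity B < complexity P := by
  rw [← complexity_flipX B, ← complexity_flipX P]
  exact complexity_lt_of_feature (hc.map isSym_flipX) hP hB

theorem complexity_lt_of_not_mem (hc : IsValidStraightTwoCut P A B) {t : Cell} {sx : ℤ}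
    (hx : sx = 1 ∨ sx = -1) (h : Corner P t sx (-1)) (hP : (t.1, t.2 + 1) ∈ P)
    (hB : (t.1, t.2 + 1) ∉ B) : complexity B < complexity P := by
  rcases hx with rfl | rfl
  · exact complexity_lt_of_feature hc (i := 1) ⟨h, hP⟩ fun hf => hB hf.2
  · refine complexity_lt_of_feature_flipX hc (i := 1) (t := t)
      ⟨corner_flipX.2 h, by rw [isSym_flipX.mem_map]; simpa using hP⟩ fun hf => hB ?_
    have := hf.2
    rw [isSym_flipX.mem_map] at this
    simpa using this

theorem complexity_lt_of_settled_above (hc : IsValidStraightTwoCut P A B) {t : Cell} {sx : ℤ}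
    (hx : sx = 1 ∨ sx = -1) (h : Corner P t sx 1) (hP : ¬ Settled P (t.1, t.2 + 1))
    (hB : Settled B (t.1, t.2 + 1)) : complexity B < complexity P := by
  rcases hx with rfl | rfl
  · exact complexity_lt_of_feature hc (i := 2) ⟨h, hP⟩ fun hf => hf.2 hB
  · exact complexity_lt_of_feature_flipX hc (i := 2) (t := t)
      ⟨corner_flipX.2 h, fun hS => hP (settled_flipX_iff.1 hS)⟩
      fun hf => hf.2 (settled_flipX_iff.2 hB)

theorem complexity_lt_of_settled (hc : IsValidStraightTwoCut P A B) {t : Cell} {sx : ℤ}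
    (hx : sx = 1 ∨ sx = -1) (h : Corner P t sx (-1)) (hP : ¬ Settled P t) (hB : Settled B t) :
    complexity B < complexity P := by
  rcases hx with rfl | rfl
  · exact complexity_lt_of_feature hc (i := 3) ⟨h, hP⟩ fun hf => hf.2 hB
  · exact complexity_lt_of_feature_flipX hc (i := 3) (t := t)
      ⟨corner_flipX.2 h, fun hS => hP (settled_flipX_iff.1 hS)⟩
      fun hf => hf.2 (settled_flipX_iff.2 hB)

/-- A tile obstructed by a tile of the same colour in a neighbouring column prevents the upper end
of `P` from being settled. -/
theorem not_settled {x₁ x₂ y₁ y₂ : ℤ} (hrow : ∀ y, y₁ ≤ y → y ≤ y₂ → IsRow P x₁ x₂ y)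
    (habove : ∀ x y, x₁ ≤ x → x ≤ x₂ → y₂ < y → (x, y) ∉ P)
    (hobs : ∃ y, y₂ < y ∧ (((x₁ - 1, y) ∈ P ∧ tileColour (x₁ - 1, y) = tileColour (x₁, y₂)) ∨
      ((x₂ + 1, y) ∈ P ∧ tileColour (x₂ + 1, y) = tileColour (x₂, y₂))))
    {z : Cell} (h1 : x₁ ≤ z.1) (h2 : z.1 ≤ x₂) (h3 : y₁ ≤ z.2) (h4 : z.2 ≤ y₂) :
    ¬ Settled P z := by
  rintro ⟨u₁, u₂, v, a1, a2, a3, hin, hside, hab, hcol⟩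
  have hz := hrow z.2 h3 h4
  have e1 : u₁ = x₁ := by
    rcases lt_trichotomy u₁ x₁ with h | h | h
    · exact absurd (hin _ _ (by omega) (by omega) le_rfl a3) hz.left
    · exact h
    · exact absurd (hz.mem _ (by omega) (by omega)) (hside _ le_rfl a3).1
  have e2 : u₂ = x₂ := by
    rcases lt_trichotomy u₂ x₂ with h | h | h
    · exact absurd (hz.mem _ (by omega) (by omega)) (hside _ le_rfl a3).2
    · exact h
    · exact absurd (hin _ _ (by omega) (by omega) le_rfl a3) hz.right
  have e3 : v = y₂ := by
    rcases lt_trichotomy v y₂ with h | h | h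
    · exact absurd ((hrow _ (by omega) le_rfl).mem _ h1 h2) (hab z.1 y₂ a1 a2 h)
    · exact h
    · exact absurd (hin z.1 v a1 a2 a3 le_rfl) (habove _ _ h1 h2 h)
  subst e1 e2 e3
  obtain ⟨y, hy, ⟨h, h'⟩ | ⟨h, h'⟩⟩ := hobs
  · exact (hcol y hy).1 h h'
  · exact (hcol y hy).2 h h'

/-- `A` is the upper piece and `B` keeps the complexity, so `A` is a rectangle at the top of a strip
of equal rows. Either a longer end of this strip is cut off, or an obstruction beside the strip
shows that `B` has lost a feature. -/
theorem improvable_of_down (hc : IsTwoCut P A B) (hs : IsStraightCut .down A B)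
    (hp : CanPullApart .down A B) (hP : StraightTwoCuttable P)
    (hμ : ¬ complexity B < complexity P) : Improvable P := by
  have hv : IsValidStraightTwoCut P A B := ⟨hc, _, hs, hp⟩
  obtain ⟨x₁, x₂, y₀, y₂, hx, hy, rfl⟩ := exists_eq_rect hc.left fun t sx sy hx hy h =>
    hμ (complexity_lt_of_corner_left hv hx hy h)
  have hd : ∀ x y, (x, y) ∈ rect x₁ x₂ y₀ y₂ ↔ (x₁ ≤ x ∧ x ≤ x₂) ∧ (y₀ ≤ y ∧ y ≤ y₂) :=
    fun x y => mem_rect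
  have hdown : ∀ a ∈ rect x₁ x₂ y₀ y₂, ∀ q ∈ P, q ∉ rect x₁ x₂ y₀ y₂ → gridGraph.Adj a q →
      q.1 = a.1 ∧ q.2 = a.2 - 1 := by
    intro a ha q hq hqA hadj
    have := hs a ha q ((hc.mem_or hq).resolve_left hqA) hadj
    rw [this]
    exact ⟨by simp [Dir.vec], by simp [Dir.vec, sub_eq_add_neg]⟩
  have hrowA : ∀ y, y₀ ≤ y → y ≤ y₂ → IsRow P x₁ x₂ y := by
    intro y h1 h2
    refine ⟨fun x h3 h4 => hc.left_subset ((hd x y).2 ⟨⟨h3, h4⟩, h1, h2⟩), fun hm => ?_,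
      fun hm => ?_⟩
    · have := (hdown (x₁, y) ((hd _ _).2 ⟨⟨le_rfl, hx⟩, h1, h2⟩) _ hm
        (fun h => by rw [hd] at h; omega) (by rw [adj_iff]; simp)).1
      simp only at this
      omega
    · have := (hdown (x₂, y) ((hd _ _).2 ⟨⟨hx, le_rfl⟩, h1, h2⟩) _ hm
        (fun h => by rw [hd] at h; omega) (by rw [adj_iff]; simp)).1
      simp only at this
      omega
  have habove : ∀ x y, x₁ ≤ x → x ≤ x₂ → y₂ < y → (x, y) ∉ P := by
    intro x y h1 h2 h3 hm
    have hB := (hc.mem_or hm).resolve_left (fun h => by rw [hd] at h; omega)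
    refine (hp (y - y₂).toNat (by omega) _ ((hd x y₂).2 ⟨⟨h1, h2⟩, hy, le_rfl⟩) _ hB).1 ?_
    ext <;> simp [Dir.vec]
    omega
  -- Pulled up, every row of `A` passes each tile in the neighbouring columns above, so all these
  -- tiles agree in colour.
  have hcolour : ∀ x' x y y', ((x' = x₁ - 1 ∧ x = x₁) ∨ (x' = x₂ + 1 ∧ x = x₂)) → y₂ < y →
      (x', y) ∈ P → y₀ ≤ y' → y' ≤ y₂ → tileColour (x', y) = tileColour (x, y') := by
    intro x' x y y' h1 h2 hm h3 h4
    have hB := (hc.mem_or hm).resolve_left (fun h => by rw [hd] at h; omega)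
    refine ((hp (y - y').toNat (by omega) _ ((hd x y').2 ⟨by omega, h3, h4⟩) _ hB).2 ?_).symm
    rw [adj_iff]
    simp [Dir.vec]
    omega
  -- the row below the upper piece
  have hrow₀ : IsRow P x₁ x₂ (y₀ - 1) := by
    have : ∃ x, x₁ ≤ x ∧ x ≤ x₂ ∧ (x, y₀ - 1) ∈ P := by
      by_contra! hn
      obtain ⟨b, hb⟩ := hc.right.nonempty
      refine hc.not_right (hc.polyomino.induction (motive := (· ∈ rect x₁ x₂ y₀ y₂))
        (p₀ := (x₁, y₀)) (hc.left_subset ?_) ?_ ?_ b (hc.right_subset hb)) hb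
      · exact (hd _ _).2 ⟨⟨le_rfl, hx⟩, le_rfl, hy⟩
      · exact (hd _ _).2 ⟨⟨le_rfl, hx⟩, le_rfl, hy⟩
      · rintro ⟨px, py⟩ - ⟨qx, qy⟩ hq hadj hpA
        by_contra hqA
        obtain ⟨h1, h2⟩ := hdown _ hpA _ hq hqA hadj
        simp only at h1 h2
        subst h1 h2
        rw [hd] at hpA hqA
        obtain rfl : py = y₀ := by omega
        exact hn _ (by omega) (by omega) hq
    obtain ⟨x, h1, h2, h3⟩ := this
    refine (hrowA y₀ le_rfl hy).next (s := -1) (fun t sx hsx g1 g2 hC => ?_)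
      (fun t sx hsx g1 g2 hC => ?_) h1 h2 h3
    · refine hμ (complexity_lt_of_corner hv hsx (Or.inr rfl) hC fun hB => ?_)
      exact hc.not_right ((hd t y₀).2 ⟨⟨g1, g2⟩, le_rfl, hy⟩) hB.1
    · refine hμ (complexity_lt_of_corner hv hsx (Or.inl (neg_neg 1)) hC fun hB => ?_)
      exact hc.not_right ((hd t _).2 ⟨⟨g1, g2⟩, by omega⟩) hB.2.2.1
  obtain ⟨N, hN⟩ := exists_bound P.finite_toSet
  obtain ⟨y₁, hy₁, hrow₁, hlast⟩ := exists_min_run (IsRow P x₁ x₂) (N := -N)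
    (fun y h => (hN _ (h.mem x₁ le_rfl hx)).2.2.1) hrow₀
  have hrow : ∀ y, y₁ ≤ y → y ≤ y₂ → IsRow P x₁ x₂ y := fun y h1 h2 =>
    (lt_or_ge y y₀).elim (fun h => hrow₁ y h1 (by omega)) (fun h => hrowA y h h2)
  by_cases hbelow : ∃ x, x₁ ≤ x ∧ x ≤ x₂ ∧ (x, y₁ - 1) ∈ P
  swap
  · push Not at hbelow
    exact Or.inl ⟨x₁, x₂, y₁, y₂, eq_rect_of_isRow hc.polyomino hx (by omega) hrow hbelow
      fun x h1 h2 => habove x _ h1 h2 (by omega)⟩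
  -- the shape of `P` at the lower end of the rows
  have hkind : (∀ x, x₁ ≤ x → x ≤ x₂ → (x, y₁ - 1) ∈ P) ∧ (∃ x sx, (sx = 1 ∨ sx = -1) ∧
        x₁ ≤ x ∧ x ≤ x₂ ∧ Corner P (x, y₁ - 1) sx 1) ∨
      ∃ x sx, (sx = 1 ∨ sx = -1) ∧ x₁ ≤ x ∧ x ≤ x₂ ∧ Corner P (x, y₁) sx (-1) := by
    by_cases hC : ∃ x sx, (sx = 1 ∨ sx = -1) ∧ x₁ ≤ x ∧ x ≤ x₂ ∧ Corner P (x, y₁) sx (-1)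
    · exact Or.inr hC
    · push Not at hC
      obtain ⟨x, h1, h2, h3⟩ := hbelow
      have hr := hrow y₁ le_rfl (by omega)
      refine Or.inl ⟨hr.next_mem (s := -1) hC h1 h2 h3, ?_⟩
      by_contra! hC'
      exact hlast (hr.next (s := -1) hC hC' h1 h2 h3)
  by_cases hfree : ∀ y, y₂ < y → (x₁ - 1, y) ∉ P ∧ (x₂ + 1, y) ∉ P
  · right
    have hne : ∀ y, y ≤ y₂ → ∀ p ∈ P \ rect x₁ x₂ y y₂, ∀ x, x₁ ≤ x → x ≤ x₂ → ∀ y', y ≤ y' →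
        y' ≤ y₂ → p ≠ (x, y') := by
      rintro y - p hp x h1 h2 y' h3 h4 rfl
      exact (Finset.mem_sdiff.1 hp).2 (mem_rect.2 ⟨⟨h1, h2⟩, h3, h4⟩)
    rcases hkind with ⟨hfull, x, sx, hsx, h1, h2, hC⟩ | ⟨x, sx, hsx, h1, h2, hC⟩
    · obtain ⟨hT, hcut⟩ := isValidStraightTwoCut_end hc.polyomino hx (by omega) hrow hfull habove
        hfree
      refine ⟨_, _, hcut, ⟨_, _, _, _, rfl⟩, hP.sdiff_tab hT,
        complexity_lt_of_corner hcut hsx (Or.inl rfl) hC fun hB => ?_⟩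
      exact hne _ (by omega) _ hB.2.2.1 x h1 h2 y₁ le_rfl (by omega) (by simp)
    -- Below the row `y₁` a tile is missing, so this row must stay; its corner survives but loses
    -- the tile above it.
    · obtain ⟨hT, hcut⟩ := isValidStraightTwoCut_end hc.polyomino (y₁ := y₁ + 1) hx (by omega)
        (fun y h1 h2 => hrow y (by omega) h2)
        (fun x h1 h2 => by simpa using (hrow y₁ le_rfl (by omega)).mem x h1 h2) habove hfree
      refine ⟨_, _, hcut, ⟨_, _, _, _, rfl⟩, hP.sdiff_tab hT,
        complexity_lt_of_not_mem hcut hsx hC ((hrow _ (by simp only; omega)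
          (by simp only; omega)).mem x h1 h2) fun hB => ?_⟩
      exact hne _ (by omega) _ hB x h1 h2 (y₁ + 1) le_rfl (by omega) rfl
  · exfalso
    have hobs : ∃ y, y₂ < y ∧ (((x₁ - 1, y) ∈ P ∧ tileColour (x₁ - 1, y) = tileColour (x₁, y₂)) ∨
        ((x₂ + 1, y) ∈ P ∧ tileColour (x₂ + 1, y) = tileColour (x₂, y₂))) := by
      push Not at hfree
      obtain ⟨y, h1, h2⟩ := hfree
      refine ⟨y, h1, ?_⟩
      by_cases h : (x₁ - 1, y) ∈ P
      · exact Or.inl ⟨h, hcolour _ _ _ _ (Or.inl ⟨rfl, rfl⟩) h1 h hy le_rfl⟩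
      · exact Or.inr ⟨h2 h, hcolour _ _ _ _ (Or.inr ⟨rfl, rfl⟩) h1 (h2 h) hy le_rfl⟩
    -- Consecutive rows have opposite colours, but the obstructing tile agrees with all rows of `A`.
    obtain rfl : y₀ = y₂ := by
      by_contra hne
      have step : ∀ x, tileColour (x, y₂) ≠ tileColour (x, y₂ - 1) := fun x =>
        tileColour_ne_of_adj (by rw [adj_iff]; simp)
      obtain ⟨y, h1, ⟨h2, h3⟩ | ⟨h2, h3⟩⟩ := hobs
      · exact step x₁ (h3.symm.trans
          (hcolour _ _ _ _ (Or.inl ⟨rfl, rfl⟩) h1 h2 (by omega) (by omega)))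
      · exact step x₂ (h3.symm.trans
          (hcolour _ _ _ _ (Or.inr ⟨rfl, rfl⟩) h1 h2 (by omega) (by omega)))
    have hsP : ∀ z : Cell, x₁ ≤ z.1 → z.1 ≤ x₂ → y₁ ≤ z.2 → z.2 ≤ y₀ → ¬ Settled P z :=
      fun z => not_settled hrow habove hobs
    have hmemB : ∀ p, p ∈ B → p ∈ P ∧ p ∉ rect x₁ x₂ y₀ y₀ := fun p hp =>
      ⟨hc.right_subset hp, fun h => hc.not_right h hp⟩
    -- The strip of `B` ends one row lower, in the opposite colour, so the tiles that obstructed the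
    -- end of `P` now differ in colour from the top row.
    have hsB : ∀ z : Cell, x₁ ≤ z.1 → z.1 ≤ x₂ → y₁ ≤ z.2 → z.2 < y₀ → Settled B z := by
      intro z h1 h2 h3 h4
      have hflip : ∀ x' x y, ((x' = x₁ - 1 ∧ x = x₁) ∨ (x' = x₂ + 1 ∧ x = x₂)) → y₀ - 1 < y →
          (x', y) ∈ B → tileColour (x', y) ≠ tileColour (x, y₀ - 1) := by
        intro x' x y hxx hy' hm he
        have hm' := (hmemB _ hm).1
        have : y₀ < y := by
          by_contra hle
          obtain rfl : y = y₀ := by omega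
          rcases hxx with ⟨rfl, rfl⟩ | ⟨rfl, rfl⟩
          · exact (hrow y (by omega) le_rfl).left hm'
          · exact (hrow y (by omega) le_rfl).right hm'
        exact tileColour_ne_of_adj (p := (x, y₀)) (q := (x, y₀ - 1)) (by rw [adj_iff]; simp)
          ((hcolour x' x y y₀ hxx this hm' le_rfl le_rfl).symm.trans he)
      refine ⟨x₁, x₂, y₀ - 1, h1, h2, by omega, ?_, ?_, ?_, fun y hy' =>
        ⟨hflip _ _ y (Or.inl ⟨rfl, rfl⟩) hy', hflip _ _ y (Or.inr ⟨rfl, rfl⟩) hy'⟩⟩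
      · intro x y g1 g2 g3 g4
        exact (hc.mem_or ((hrow y (by omega) (by omega)).mem x g1 g2)).resolve_left
          fun h => by rw [hd] at h; omega
      · intro y g1 g2
        have := hrow y (by omega) (by omega)
        exact ⟨fun h => this.left (hmemB _ h).1, fun h => this.right (hmemB _ h).1⟩
      · intro x y g1 g2 g3 hm
        obtain ⟨hm1, hm2⟩ := hmemB _ hm
        rcases lt_or_ge y₀ y with h | h
        · exact habove x y g1 g2 h hm1
        · exact hm2 ((hd x y).2 ⟨⟨g1, g2⟩, by omega⟩)
    rcases hkind with ⟨-, x, sx, hsx, h1, h2, hC⟩ | ⟨x, sx, hsx, h1, h2, hC⟩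
    · refine hμ (complexity_lt_of_settled_above hv hsx hC (hsP _ h1 h2 ?_ ?_) (hsB _ h1 h2 ?_ ?_)) <;>
        simp only <;> omega
    · refine hμ (complexity_lt_of_settled hv hsx hC (hsP _ h1 h2 ?_ ?_) (hsB _ h1 h2 ?_ ?_)) <;>
        simp only <;> omega

end Cut

theorem improvable_of_valid {P A B : Finset Cell} (hv : IsValidStraightTwoCut P A B)
    (hP : StraightTwoCuttable P) (hμ : ¬ complexity B < complexity P) : Improvable P := by
  have up : ∀ {P A B : Finset Cell}, IsTwoCut P A B → IsStraightCut .up A B →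
      CanPullApart .up A B → StraightTwoCuttable P → ¬ complexity B < complexity P →
      Improvable P := by
    intro P A B hc hs hp hP hμ
    refine Improvable.of_map isShapeSym_flipY (improvable_of_down (hc.map isSym_flipY)
      (hs.map isSym_flipY) (hp.map isSym_flipY) (hP.map isShapeSym_flipY) ?_)
    rwa [complexity_flipY, complexity_flipY]
  obtain ⟨hc, d, hs, hp⟩ := hv
  cases d with
  | down => exact improvable_of_down hc hs hp hP hμ
  | up => exact up hc hs hp hP hμ
  | left =>
    refine Improvable.of_map isShapeSym_diag (improvable_of_down (hc.map isSym_diag)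
      (hs.map isSym_diag) (hp.map isSym_diag) (hP.map isShapeSym_diag) ?_)
    rwa [complexity_diag, complexity_diag]
  | right =>
    refine Improvable.of_map isShapeSym_diag (up (hc.map isSym_diag)
      (hs.map isSym_diag) (hp.map isSym_diag) (hP.map isShapeSym_diag) ?_)
    rwa [complexity_diag, complexity_diag]

/-! ### Monotone polyominoes -/

/-- `P` is a rectangle or can be divided into two straight 2-cuttable pieces. -/
def RectOrCut (P : Finset Cell) : Prop :=
  (∃ x₁ x₂ y₁ y₂, P = rect x₁ x₂ y₁ y₂) ∨ ∃ A B : Finset Cell, IsValidStraightTwoCut P A B ∧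
    StraightTwoCuttable A ∧ StraightTwoCuttable B

/-- The first column of an `x`-monotone polyomino can be cut off. -/
theorem IsXMonotone.rectOrCut {P : Finset Cell} (hP : IsPolyomino P) (hm : IsXMonotone P) :
    RectOrCut P := by
  by_cases hC : ∀ t sx sy, (sx = 1 ∨ sx = -1) → (sy = 1 ∨ sy = -1) → ¬ Corner P t sx sy
  · obtain ⟨x₁, x₂, y₁, y₂, -, -, h⟩ := exists_eq_rect hP hC
    exact Or.inl ⟨x₁, x₂, y₁, y₂, h⟩
  push Not at hC
  obtain ⟨t, sx, sy, hsx, hsy, hC⟩ := hC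
  right
  obtain ⟨⟨x₀, y₀⟩, h₀, hmin⟩ := Finset.exists_min_image P Prod.fst hP.nonempty
  simp only at hmin
  set A := P.filter (fun p => p.1 = x₀) with hA
  set B := P.filter (fun p => ¬ p.1 = x₀) with hB
  have memA : ∀ p, p ∈ A ↔ p ∈ P ∧ p.1 = x₀ := fun p => Finset.mem_filter
  have memB : ∀ p, p ∈ B ↔ p ∈ P ∧ ¬ p.1 = x₀ := fun p => Finset.mem_filter
  -- A corner occupies two columns.
  have hne : ∃ p ∈ P, p.1 ≠ x₀ := by
    by_cases h : t.1 = x₀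
    · exact ⟨_, hC.2.1, by simp only; omega⟩
    · exact ⟨t, hC.1, h⟩
  have hnext : ∃ y, (x₀ + 1, y) ∈ P := by
    by_contra! hn
    obtain ⟨p, hp, hpx⟩ := hne
    refine hpx (hP.induction (motive := fun p => p.1 = x₀) h₀ rfl ?_ p hp)
    rintro ⟨px, py⟩ hp ⟨qx, qy⟩ hq hadj hpx
    simp only at hpx ⊢
    subst hpx
    rw [adj_iff] at hadj
    simp only at hadj
    have := hmin _ hq
    simp only at this
    rcases hadj with ⟨h, -⟩ | ⟨-, h | h⟩
    · exact h.symm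
    · exact absurd hq (h ▸ hn qy)
    · omega
  have hAP : IsPolyomino A := by
    have hAne : A.Nonempty := ⟨(x₀, y₀), (memA _).2 ⟨h₀, rfl⟩⟩
    obtain ⟨⟨a, y₁⟩, h1, hmin₁⟩ := Finset.exists_min_image A Prod.snd hAne
    obtain ⟨⟨b, y₂⟩, h2, hmax₂⟩ := Finset.exists_max_image A Prod.snd hAne
    simp only at hmin₁ hmax₂
    obtain ⟨g1, e1⟩ := (memA _).1 h1
    obtain ⟨g2, e2⟩ := (memA _).1 h2
    simp only at e1 e2
    have : A = rect x₀ x₀ y₁ y₂ := by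
      ext p
      rw [mem_rect, memA]
      constructor
      · rintro ⟨hp, hpx⟩
        have := hmin₁ p ((memA _).2 ⟨hp, hpx⟩)
        have := hmax₂ p ((memA _).2 ⟨hp, hpx⟩)
        omega
      · rintro ⟨⟨f1, f2⟩, f3, f4⟩
        obtain rfl : p.1 = x₀ := by omega
        exact ⟨hm p.1 y₁ y₂ p.2 (e1 ▸ g1) (e2 ▸ g2) f3 f4, rfl⟩
    rw [this]
    exact isPolyomino_rect le_rfl (hmin₁ _ h2)
  have hBP : IsPolyomino B := by
    obtain ⟨y₁, hy₁⟩ := hnext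
    refine isPolyomino_of_induction (p₀ := (x₀ + 1, y₁)) ((memB _).2 ⟨hy₁, by simp⟩) ?_
    intro motive base step
    have hcol : ∀ y, (x₀ + 1, y) ∈ P → motive (x₀ + 1, y) := by
      intro y hy
      rcases le_total y₁ y with h | h
      · induction y, h using Int.leInduction with
        | base => exact base
        | succ y h ih =>
          have hy' := hm _ _ _ y hy₁ hy h (by omega)
          exact step _ ((memB _).2 ⟨hy', by simp⟩) _ ((memB _).2 ⟨hy, by simp⟩)
            (by rw [adj_iff]; simp) (ih hy')
      · induction y, h using Int.leInductionDown with
        | base => exact base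
        | pred y h ih =>
          have hy' := hm _ _ _ y hy hy₁ (by omega) h
          exact step _ ((memB _).2 ⟨hy', by simp⟩) _ ((memB _).2 ⟨hy, by simp⟩)
            (by rw [adj_iff]; simp) (ih hy')
    have key := hP.induction (motive := fun p => p.1 = x₀ ∨ motive p) hy₁ (Or.inr base) ?_
    · intro p hp
      obtain ⟨h1, h2⟩ := (memB p).1 hp
      exact (key p h1).resolve_left h2
    · rintro ⟨px, py⟩ hp ⟨qx, qy⟩ hq hadj hpm
      by_cases hqx : qx = x₀
      · exact Or.inl hqx
      right
      by_cases hpx : px = x₀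
      · have := hmin _ hq
        rw [adj_iff] at hadj
        simp only at this hadj
        obtain rfl : qx = x₀ + 1 := by omega
        exact hcol qy hq
      · exact step _ ((memB _).2 ⟨hp, hpx⟩) _ ((memB _).2 ⟨hq, hqx⟩) hadj (hpm.resolve_left hpx)
  have hBx : ∀ p ∈ B, x₀ + 1 ≤ p.1 := by
    intro p hp
    obtain ⟨h1, h2⟩ := (memB p).1 hp
    have := hmin p h1
    omega
  refine ⟨A, B, ⟨⟨hP, Finset.filter_union_filter_not_eq _ _, Finset.disjoint_filter_filter_not _ _ _,
    hAP, hBP⟩, .right, ?_, ?_⟩, .monotone hAP (Or.inl ?_), .monotone hBP (Or.inl ?_)⟩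
  · intro a ha b hb hadj
    have h1 := ((memA a).1 ha).2
    have h2 := hBx b hb
    rw [adj_iff] at hadj
    ext <;> simp [Dir.vec] <;> omega
  · intro k hk a ha b hb
    have h1 := ((memA a).1 ha).2
    have h2 := hBx b hb
    refine ⟨?_, fun h => ?_⟩
    · rintro rfl
      simp [Dir.vec] at h2
      omega
    · rw [adj_iff] at h
      simp [Dir.vec] at h
      omega
  · intro x y₁ y₂ y h1 h2 h3 h4
    rw [memA] at h1 h2 ⊢
    exact ⟨hm x y₁ y₂ y h1.1 h2.1 h3 h4, h1.2⟩
  · intro x y₁ y₂ y h1 h2 h3 h4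
    rw [memB] at h1 h2 ⊢
    exact ⟨hm x y₁ y₂ y h1.1 h2.1 h3 h4, h1.2⟩

theorem RectOrCut.of_diag {P : Finset Cell} (h : RectOrCut (P.map diag.toEmbedding)) :
    RectOrCut P := by
  rcases h with ⟨x₁, x₂, y₁, y₂, hr⟩ | ⟨A, B, hc, hA, hB⟩
  · left
    rw [← isSym_diag.map_map P, hr]
    exact isShapeSym_diag.rect x₁ x₂ y₁ y₂
  · right
    have hc' := hc.map isSym_diag
    rw [isSym_diag.map_map] at hc'
    exact ⟨_, _, hc', hA.map isShapeSym_diag, hB.map isShapeSym_diag⟩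

theorem StraightTwoCuttable.rectOrCut {P : Finset Cell} (h : StraightTwoCuttable P) :
    RectOrCut P := by
  cases h with
  | monotone hP hm =>
    rcases hm with hm | hm
    · exact hm.rectOrCut hP
    · refine RectOrCut.of_diag (IsXMonotone.rectOrCut (isSym_diag.isPolyomino hP) ?_)
      intro x y₁ y₂ y h1 h2 h3 h4
      rw [isSym_diag.mem_map] at *
      exact hm x y₁ y₂ y h1 h2 h3 h4
  | cut hc hA hB => exact Or.inr ⟨_, _, hc, hA, hB⟩

/-! ### Trees of small depth -/

theorem IsTwoCut.card_right_lt {P A B : Finset Cell} (h : IsTwoCut P A B) : B.card < P.card := by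
  rw [← h.union, Finset.card_union_of_disjoint h.disjoint]
  have := h.left.nonempty.card_pos
  omega

/-- Induction on the number of tiles. If both pieces of some cut have smaller complexity, both have
flatter trees. Otherwise the cut is replaced by one that splits off a rectangle, which is a leaf of
any depth, so only the other piece, of smaller complexity, counts. -/
theorem StraightTwoCuttable.hasTree {P : Finset Cell} (h : StraightTwoCuttable P) :
    HasTree (complexity P) P := by
  induction hn : P.card using Nat.strong_induction_on generalizing P with
  | _ n ih =>
    subst hn
    have ofRect : ∀ {Q : Finset Cell} (n : ℕ), IsPolyomino Q →
        (∃ x₁ x₂ y₁ y₂, Q = rect x₁ x₂ y₁ y₂) → HasTree n Q := by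
      rintro Q n hQ ⟨x₁, x₂, y₁, y₂, rfl⟩
      exact .rect n hQ
    have ofCut : ∀ {A B : Finset Cell}, IsValidStraightTwoCut P A B → complexity B < complexity P →
        HasTree (complexity P - 1) A → HasTree (complexity P - 1) B →
        HasTree (complexity P) P := by
      intro A B hc hμ hA hB
      have := HasTree.cut hc hA hB
      rwa [Nat.sub_add_cancel (by omega)] at this
    have small : ∀ {B : Finset Cell}, StraightTwoCuttable B → B.card < P.card →
        complexity B < complexity P → HasTree (complexity P - 1) B := fun hB h1 h2 =>
      (ih _ h1 hB rfl).mono (by omega)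
    have ofImprovable : Improvable P → HasTree (complexity P) P := by
      rintro (hr | ⟨A, B, hc, hr, hB, hμ⟩)
      · exact ofRect _ h.isPolyomino hr
      · exact ofCut hc hμ (ofRect _ hc.1.left hr) (small hB hc.1.card_right_lt hμ)
    rcases h.rectOrCut with hr | ⟨A, B, hc, hA, hB⟩
    · exact ofRect _ h.isPolyomino hr
    · by_cases hμB : complexity B < complexity P
      · by_cases hμA : complexity A < complexity P
        · exact ofCut hc hμB (small hA hc.symm.1.card_right_lt hμA)
            (small hB hc.1.card_right_lt hμB)
        · exact ofImprovable (improvable_of_valid hc.symm h hμA)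
      · exact ofImprovable (improvable_of_valid hc h hμB)

theorem copiesBuildableWithin_zero (P : Finset Cell) (n : ℕ) : CopiesBuildableWithin P 0 n := by
  refine ⟨∅, fun _ => none, fun _ => none, [], ⟨by simp, by simp, ?_⟩, rfl, Nat.zero_le _, ∅,
    rfl, by simp⟩
  rintro p q ⟨-, u, v, hu, -⟩
  exact absurd hu (by simp)

end TiltAssembly

theorem mainTheorem3 :
    ∃ C : ℕ, ∀ P : Finset TiltAssembly.Cell, TiltAssembly.StraightTwoCuttable P →
      TiltAssembly.BuildableWithin P (C * (TiltAssembly.reflexCount P + 1)) ∧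
      ∀ D : ℕ, TiltAssembly.CopiesBuildableWithin P D
        (C * (TiltAssembly.reflexCount P + D)) := by
  -- `960 = 30 * 32`: 30 steps per level and at most 32 levels per reflex tile. The two steps for
  -- rectangles are absorbed by `m ≥ 1`. For `D = 0` the bound may vanish, but no step is needed.
  refine ⟨960, fun P hP => ?_⟩
  have hbound := TiltAssembly.complexity_le P
  have key : ∀ D m : ℕ, 1 ≤ m →
      TiltAssembly.CopiesBuildableWithin P D (960 * (TiltAssembly.reflexCount P + m)) :=
    fun D m hm => (hP.hasTree.copiesBuildableWithin hP.isPolyomino D).mono (by omega)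
  refine ⟨key 1 1 le_rfl, fun D => ?_⟩
  obtain rfl | hD := Nat.eq_zero_or_pos D
  · exact TiltAssembly.copiesBuildableWithin_zero P _
  · exact key D D hD
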